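/- Let $\mathbb{T}=\mathbb{R}/2\pi\mathbb{Z}$, let $1<p<\infty$ and $M>1$. For $\gamma\in W^{2,p}(\mathbb{T};\mathbb{R}^2)$ (identified with its continuous representative) write $\dot\gamma=\partial_\xi\gamma$, $g=|\dot\gamma|$, $\partial_s=\frac1g\partial_\xi$, $\mathbf{T}=\dot\gamma/g$, $\mathbf{N}=-\mathbf{T}^\perp$ with $(x_1,x_2)^\perp=(-x_2,x_1)$, and define the curvature $\kappa$ by $\partial_s\mathbf{T}=-\kappa\mathbf{N}$ almost everywhere. Let $|\xi-\eta|$ denote the distance on $\mathbb{T}$, let $$\Gamma(\gamma)=\sup_{\xi\neq\eta\in\mathbb{T}}\frac{|\xi-\eta|}{|\gamma(\xi)-\gamma(\eta)|},$$ and let $B^M_p$ be the set of all $\gamma\in W^{2,p}(\mathbb{T};\mathbb{R}^2)$ with $|\gamma|_{W^{2,p}(\mathbb{T})}\le M$, $\max\{|1/g|_{L^\infty(\mathbb{T})},|g|_{L^\infty(\mathbb{T})}\}\le M$ and $\Gamma(\gamma)\le M$. Here $|f|_{W^{2,p}(\mathbb{T})}$ is the sum of the $L^p(\mathbb{T})$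 norms of $f$ and of its first two weak derivatives. For $\gamma\in B^M_p$ put $$v(\xi)=\int_{\mathbb{T}}\dot\gamma(\eta)\,\ln|\gamma(\xi)-\gamma(\eta)|\,d\eta .$$ There is a constant $C_M$, depending only on $M$ and $p$, such that for every $\gamma\in B^M_p$ the integral defining $v(\xi)$ converges absolutely for every $\xi$, $v\in W^{2,p}(\mathbb{T})$, and $$|v|_{W^{2,p}(\mathbb{T})}\le C_M .$$ Moreover, with $\mathrm{P.V.}\int_{\mathbb{T}}=\lim_{\epsilon\to0^+}\int_{|\xi-\eta|\ge\epsilon}$: 1. $v$ is differentiable almost everywhere, and for almost every $\xi$ $$\partial_s v(\xi)=\mathrm{P.V.}\int_{\mathbb{T}}\mathbf{T}(\eta)\,\frac{(\gamma(\xi)-\gamma(\eta))\cdot\mathbf{T}(\xi)}{|\gamma(\xi)-\gamma(\eta)|^2}\,g(\eta)\,d\eta ,$$ where the right-hand side exists for every $\xi$ and defines a function in $W^{1,p}(\mathbb{T})$. 2. The function on the right-hand side of 1 is differentiable almost everywhere, and for almost every $\xi$ $$\begin{aligned}\partial_s^2 v(\xi)=&-\mathrm{P.V.}\int_{\mathb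b{T}}\kappa(\eta)\mathbf{N}(\eta)\,\frac{(\gamma(\xi)-\gamma(\eta))\cdot\mathbf{T}(\xi)}{|\gamma(\xi)-\gamma(\eta)|^2}\,g(\eta)\,d\eta\\&+\int_{\mathbb{T}}\mathbf{T}(\eta)\,\frac{(\mathbf{T}(\xi)-\mathbf{T}(\eta))\cdot\mathbf{T}(\xi)-\kappa(\xi)\,(\gamma(\xi)-\gamma(\eta))\cdot\mathbf{N}(\xi)}{|\gamma(\xi)-\gamma(\eta)|^2}\,g(\eta)\,d\eta\\&-2\int_{\mathbb{T}}\mathbf{T}(\eta)\,\frac{\big((\gamma(\xi)-\gamma(\eta))\cdot\mathbf{T}(\xi)\big)\big((\gamma(\xi)-\gamma(\eta))\cdot(\mathbf{T}(\xi)-\mathbf{T}(\eta))\big)}{|\gamma(\xi)-\gamma(\eta)|^4}\,g(\eta)\,d\eta ,\end{aligned}$$ where for almost every $\xi$ the principal value exists and the last two integrals converge absolutely, and the right-hand side defines a function in $L^p(\mathbb{T})$. -/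

import Mathlib

open MeasureTheory Set Filter Topology
open scoped Real ENNReal NNReal ContDiff

noncomputable section

/-- The Euclidean plane. -/
abbrev Plane := EuclideanSpace ℝ (Fin 2)

/-- Rotation by `π / 2` counterclockwise. -/
def Plane.perp (x : Plane) : Plane := !₂[-x 1, x 0]

/-! ### Sobolev spaces on the torus `ℝ / 2πℤ`

Functions on the torus are regarded as `2π`-periodic functions on `ℝ`. -/

/-- Lebesgue measure on one period. -/
def torusMeasure : Measure ℝ := volume.restrict (Ioc 0 (2 * π))

/-- `h` is a weak derivative of `f` on the torus. -/
structure HasWeakDeriv (f h : ℝ → Plane) : Prop where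
  periodic : Function.Periodic f (2 * π)
  periodic' : Function.Periodic h (2 * π)
  integrable : Integrable f torusMeasure
  integrable' : Integrable h torusMeasure
  integral_eq : ∀ φ : ℝ → ℝ, ContDiff ℝ ∞ φ → Function.Periodic φ (2 * π) →
    ∫ x, deriv φ x • f x ∂torusMeasure = - ∫ x, φ x • h x ∂torusMeasure

open Classical in
/-- The weak derivative of `f` (unique up to null sets); `0` if there is none. -/
def weakDeriv (f : ℝ → Plane) : ℝ → Plane :=
  if h : ∃ f', HasWeakDeriv f f' then h.choose else 0

/-- `f` belongs to `W^{k,p}` of the torus. -/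
structure MemSobolev (k : ℕ) (p : ℝ≥0∞) (f : ℝ → Plane) : Prop where
  periodic : Function.Periodic f (2 * π)
  hasWeakDeriv : ∀ i < k, HasWeakDeriv (weakDeriv^[i] f) (weakDeriv^[i + 1] f)
  memLp : ∀ i ≤ k, MemLp (weakDeriv^[i] f) p torusMeasure

/-- The `W^{k,p}` norm: the sum of the `L^p` norms of the weak derivatives up to order `k`.
It is meaningful for `f` with `MemSobolev k p f`. -/
def sobolevNorm (k : ℕ) (p : ℝ≥0∞) (f : ℝ → Plane) : ℝ≥0∞ :=
  ∑ i ∈ Finset.range (k + 1), eLpNorm (weakDeriv^[i] f) p torusMeasure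

/-! ### Geometry of parametrized closed curves -/

/-- The arc-length metric `g = |γ̇|`. -/
def speed (γ : ℝ → Plane) (ξ : ℝ) : ℝ := ‖deriv γ ξ‖

/-- The unit tangent vector `T`. -/
def tangent (γ : ℝ → Plane) (ξ : ℝ) : Plane := (speed γ ξ)⁻¹ • deriv γ ξ

/-- The unit normal vector `N = -T^⊥`, the outer one if the curve is counterclockwise. -/
def normal (γ : ℝ → Plane) (ξ : ℝ) : Plane := -(tangent γ ξ).perp

/-- `d` is the derivative of `f` at `ξ` in the arc-length parameter of `γ`:
`d = ∂_s f = g⁻¹ ∂_ξ f`. -/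
def HasArcDerivAt (γ f : ℝ → Plane) (d : Plane) (ξ : ℝ) : Prop :=
  ∃ f' : Plane, HasDerivAt f f' ξ ∧ d = (speed γ ξ)⁻¹ • f'

/-- The signed curvature `κ`, given by `∂_s T = -κ N`, that is `κ = -∂_s T · N`.
For a `W^{2,p}` curve of positive speed it is defined almost everywhere. -/
def curvature (γ : ℝ → Plane) (ξ : ℝ) : ℝ :=
  -inner ℝ ((speed γ ξ)⁻¹ • deriv (tangent γ) ξ) (normal γ ξ)

/-- The arc-chord constant `Γ`, with the distance of the torus between the labels.
The quotient is `∞` at a self-intersection. -/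
def arcChord (γ : ℝ → Plane) : ℝ≥0∞ :=
  ⨆ (ξ : ℝ) (η : ℝ) (_ : (ξ : AddCircle (2 * π)) ≠ (η : AddCircle (2 * π))),
    ‖(ξ : AddCircle (2 * π)) - (η : AddCircle (2 * π))‖ₑ / ‖γ ξ - γ η‖ₑ

/-- `|g|_* = max {|1/g|_{L^∞}, |g|_{L^∞}}`, with `1/0 = ∞`. -/
def starNorm (g : ℝ → ℝ) : ℝ≥0∞ :=
  max (essSup (fun ξ => ‖g ξ‖ₑ⁻¹) torusMeasure) (essSup (fun ξ => ‖g ξ‖ₑ) torusMeasure)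

/-- The set `X_p` of `W^{2,p}` closed curves with finite arc-chord constant. As usual a Sobolev
function is identified with its continuous representative. -/
def curveSpace (p : ℝ≥0∞) : Set (ℝ → Plane) :=
  {γ | Continuous γ ∧ MemSobolev 2 p γ ∧ arcChord γ < ⊤}

/-- The set `B^M_p`. -/
def curveBall (p : ℝ≥0∞) (M : ℝ) : Set (ℝ → Plane) :=
  {γ | γ ∈ curveSpace p ∧ sobolevNorm 2 p γ ≤ ENNReal.ofReal M ∧
    starNorm (speed γ) ≤ ENNReal.ofReal M ∧ arcChord γ ≤ ENNReal.ofReal M}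

/-! ### The velocity and the singular integrals -/

/-- The integrand of the logarithmic Biot–Savart integral. -/
def velocityKernel (γ : ℝ → Plane) (ξ η : ℝ) : Plane :=
  Real.log ‖γ ξ - γ η‖ • deriv γ η

/-- The boundary velocity `v(γ)` as a function of the label. -/
def velocity (γ : ℝ → Plane) (ξ : ℝ) : Plane :=
  ∫ η, velocityKernel γ ξ η ∂torusMeasure

/-- The principal value integral over the torus of a `2π`-periodic `F` with singularity at `ξ`
exists and is `L`: the part of the torus at distance at least `ε` from `ξ` is written as a subset
of the period `(ξ - π, ξ + π]`. -/
def HasPVIntegral (F : ℝ → Plane) (ξ : ℝ) (L : Plane) : Prop :=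
  (∀ ε : ℝ, 0 < ε → IntegrableOn F {η | η ∈ Ioc (ξ - π) (ξ + π) ∧ ε ≤ |ξ - η|}) ∧
  Tendsto (fun ε : ℝ => ∫ η in {η | η ∈ Ioc (ξ - π) (ξ + π) ∧ ε ≤ |ξ - η|}, F η)
    (𝓝[>] 0) (𝓝 L)

/-- `T(η) ((γ(ξ) - γ(η)) · T(ξ)) / |γ(ξ) - γ(η)|² g(η)`. -/
def firstKernel (γ : ℝ → Plane) (ξ η : ℝ) : Plane :=
  (inner ℝ (γ ξ - γ η) (tangent γ ξ) / ‖γ ξ - γ η‖ ^ 2 * speed γ η) • tangent γ η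

/-- `κ(η) N(η) ((γ(ξ) - γ(η)) · T(ξ)) / |γ(ξ) - γ(η)|² g(η)`. -/
def secondKernelA (γ : ℝ → Plane) (ξ η : ℝ) : Plane :=
  (curvature γ η * (inner ℝ (γ ξ - γ η) (tangent γ ξ) / ‖γ ξ - γ η‖ ^ 2) * speed γ η) •
    normal γ η

/-- `T(η) [(T(ξ) - T(η)) · T(ξ) - κ(ξ) (γ(ξ) - γ(η)) · N(ξ)] / |γ(ξ) - γ(η)|² g(η)`. -/
def secondKernelB (γ : ℝ → Plane) (ξ η : ℝ) : Plane :=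
  ((inner ℝ (tangent γ ξ - tangent γ η) (tangent γ ξ)
      - curvature γ ξ * inner ℝ (γ ξ - γ η) (normal γ ξ)) / ‖γ ξ - γ η‖ ^ 2 * speed γ η) •
    tangent γ η

/-- `T(η) ((γ(ξ) - γ(η)) · T(ξ)) ((γ(ξ) - γ(η)) · (T(ξ) - T(η))) / |γ(ξ) - γ(η)|⁴ g(η)`. -/
def secondKernelC (γ : ℝ → Plane) (ξ η : ℝ) : Plane :=
  (inner ℝ (γ ξ - γ η) (tangent γ ξ) * inner ℝ (γ ξ - γ η) (tangent γ ξ - tangent γ η)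
      / ‖γ ξ - γ η‖ ^ 4 * speed γ η) • tangent γ η

end

/-! ### Integrals of periodic functions over one period -/

section Torus

variable {E : Type*} [NormedAddCommGroup E]

/-! Write `α = 1 - 1/p`, `t` for the torus distance of the labels `ξ, η`, and `Q_s = |γ(ξ) - γ(η)|²
+ s`. Curves in the ball are uniformly `C^{1,α}` with chords comparable to `t`
(`regularCurve_of_mem_curveBall`), and `v` is the logarithmic potential of the density `γ̇`.
Derivatives are computed for `s > 0`, where nothing is singular. The limit `s → 0` is taken in
integrated form under a majorant that is integrable in `(ξ, η)` and independent of `s`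
(`isPrimitive_of_tendsto_integral`).

First derivative. Differentiation produces the kernel `(γ(ξ) - γ(η)) · γ̇(ξ) / Q_s`, of order `1/t`.
With `γ̇(η)` in place of `γ̇(ξ)` it is a total `η`-derivative of integral zero. Subtracting this
second kernel, with vector factor `γ̇(ξ)`, leaves `crossKer`, of size `t^{α-1}`. The subtracted term
also has principal value zero for `s = 0`, because the chords to `ξ + ε` and `ξ - ε` have
asymptotically equal length (`tendsto_integral_inner_deriv`). This gives the first formula at every
point.

Second derivative. Differentiating the tangential derivative and integrating by parts in `η` gives
two terms. One is the derivative of the logarithmic potential of the density `∂_ξ T = -g κ N`. The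
other has the kernel `curvKer`, bounded by `t^{α-2} |T(ξ) - T(η)| + t^{α-1} |∂_ξ T(ξ)|`. The
`η`-integral of this bound lies in `L^p` by Minkowski's inequality, since the difference quotients
of `T` are bounded in `L^p`. The potential is subtracted before the limit and restored afterwards
(`isPrimitive_tangentialDeriv`, `exists_tangentialDeriv_isPrimitive`).

There remains the logarithmic potential of an `L^p` density along `γ` (`exists_logInt_isPrimitive`).
Its kernel differs from `log |e^{iξ} - e^{iη}|` by a function whose `ξ`-derivative is `O(t^{α-1})`,
which Young's inequality handles. On the circle the derivative of the potential is the conjugate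
function. Its `L^p` bound is the theorem of M. Riesz (`exists_lintegral_conjPoisson_le`), proved by
applying a power to an analytic function with positive real part, with duality for `p > 2`. Its
principal value exists at common Lebesgue points of the density and its conjugate, by comparison
with the conjugate Poisson integral (`ae_tendsto_integral_pvDomain_conjKer`). -/

instance isFiniteMeasure_torusMeasure : IsFiniteMeasure torusMeasure := by
  unfold torusMeasure; infer_instance

/-- Periods starting anywhere are interchangeable, which allows passing between `Ioc 0 (2 * π)` and
the window centred at `ξ` used for principal values. -/
theorem isAddFundamentalDomain_period (a : ℝ) :
    IsAddFundamentalDomain (AddSubgroup.zmultiples (2 * π)) (Ioc a (a + 2 * π)) :=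
  isAddFundamentalDomain_Ioc Real.two_pi_pos a

theorem periodic_vadd {β : Type*} {F : ℝ → β} (hF : Function.Periodic F (2 * π))
    (g : AddSubgroup.zmultiples (2 * π)) (x : ℝ) : F (g +ᵥ x) = F x := by
  obtain ⟨_, n, rfl⟩ := g
  have := hF.zsmul n x
  rw [← this, add_comm x]
  rfl

theorem torusMeasure_eq_fundamental :
    torusMeasure = volume.restrict (Ioc (0 : ℝ) (0 + 2 * π)) := by rw [zero_add]; rfl

theorem lintegral_torus_eq_Ioc {F : ℝ → ℝ≥0∞} (hF : Function.Periodic F (2 * π)) (a : ℝ) :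
    ∫⁻ x, F x ∂torusMeasure = ∫⁻ x in Ioc a (a + 2 * π), F x := by
  rw [torusMeasure_eq_fundamental]
  exact (isAddFundamentalDomain_period 0).setLIntegral_eq (isAddFundamentalDomain_period a) F
    (periodic_vadd hF)

theorem integrable_torus_iff_Ioc {F : ℝ → E} (hF : Function.Periodic F (2 * π)) (a : ℝ) :
    Integrable F torusMeasure ↔ IntegrableOn F (Ioc a (a + 2 * π)) := by
  rw [torusMeasure_eq_fundamental]
  exact (isAddFundamentalDomain_period 0).integrableOn_iff (isAddFundamentalDomain_period a)
    (periodic_vadd hF)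

theorem integral_torus_eq_Ioc [NormedSpace ℝ E] {F : ℝ → E} (hF : Function.Periodic F (2 * π))
    (a : ℝ) : ∫ x, F x ∂torusMeasure = ∫ x in Ioc a (a + 2 * π), F x := by
  rw [torusMeasure_eq_fundamental]
  exact (isAddFundamentalDomain_period 0).setIntegral_eq (isAddFundamentalDomain_period a)
    (periodic_vadd hF)

theorem integral_torus_eq_interval [NormedSpace ℝ E] {F : ℝ → E}
    (hF : Function.Periodic F (2 * π)) (a : ℝ) :
    ∫ x, F x ∂torusMeasure = ∫ x in a..(a + 2 * π), F x := by
  rw [integral_torus_eq_Ioc hF a, intervalIntegral.integral_of_le (by linarith [Real.pi_pos])]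

theorem measurePreserving_const_sub (c : ℝ) :
    MeasurePreserving (fun x : ℝ => c - x) volume volume := by
  simpa [Function.comp_def, sub_eq_add_neg] using
    (measurePreserving_add_left volume c).comp (Measure.measurePreserving_neg (volume : Measure ℝ))

theorem lintegral_torus_add_right {F : ℝ → ℝ≥0∞} (hF : Function.Periodic F (2 * π)) (c : ℝ) :
    ∫⁻ x, F (x + c) ∂torusMeasure = ∫⁻ x, F x ∂torusMeasure := by
  have h : MeasurePreserving (fun x : ℝ => x + c) volume volume :=
    measurePreserving_add_right volume c
  rw [lintegral_torus_eq_Ioc hF c, torusMeasure,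
    ← h.setLIntegral_comp_preimage_emb (measurableEmbedding_addRight c) F]
  simp [add_comm]

theorem lintegral_torus_sub_left {F : ℝ → ℝ≥0∞} (hF : Function.Periodic F (2 * π)) (c : ℝ) :
    ∫⁻ x, F (c - x) ∂torusMeasure = ∫⁻ x, F x ∂torusMeasure := by
  have h : MeasurePreserving (fun x : ℝ => c - x) volume volume :=
    measurePreserving_const_sub c
  have he : MeasurableEmbedding (fun x : ℝ => c - x) := (MeasurableEquiv.subLeft c).measurableEmbedding
  rw [lintegral_torus_eq_Ioc hF (c - 2 * π), torusMeasure,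
    ← h.setLIntegral_comp_preimage_emb he F]
  have : (fun x : ℝ => c - x) ⁻¹' Ioc (c - 2 * π) (c - 2 * π + 2 * π) = Ico 0 (2 * π) := by
    ext x; simp
  rw [this]
  exact setLIntegral_congr Ico_ae_eq_Ioc.symm

theorem integral_torus_add_right [NormedSpace ℝ E] {F : ℝ → E} (hF : Function.Periodic F (2 * π))
    (c : ℝ) : ∫ x, F (x + c) ∂torusMeasure = ∫ x, F x ∂torusMeasure := by
  have h : MeasurePreserving (fun x : ℝ => x + c) volume volume :=
    measurePreserving_add_right volume c
  rw [integral_torus_eq_Ioc hF c, torusMeasure,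
    ← h.setIntegral_preimage_emb (measurableEmbedding_addRight c) F]
  simp [add_comm]

theorem integral_torus_sub_left [NormedSpace ℝ E] {F : ℝ → E} (hF : Function.Periodic F (2 * π))
    (c : ℝ) : ∫ x, F (c - x) ∂torusMeasure = ∫ x, F x ∂torusMeasure := by
  have h : MeasurePreserving (fun x : ℝ => c - x) volume volume :=
    measurePreserving_const_sub c
  have he : MeasurableEmbedding (fun x : ℝ => c - x) := (MeasurableEquiv.subLeft c).measurableEmbedding
  rw [integral_torus_eq_Ioc hF (c - 2 * π), torusMeasure,
    ← h.setIntegral_preimage_emb he F]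
  have : (fun x : ℝ => c - x) ⁻¹' Ioc (c - 2 * π) (c - 2 * π + 2 * π) = Ico 0 (2 * π) := by
    ext x; simp
  rw [this]
  exact setIntegral_congr_set Ico_ae_eq_Ioc.symm

theorem integrable_torus_add_right {F : ℝ → E} (hF : Function.Periodic F (2 * π))
    (hi : Integrable F torusMeasure) (c : ℝ) :
    Integrable (fun x => F (x + c)) torusMeasure := by
  have h : MeasurePreserving (fun x : ℝ => x + c) volume volume :=
    measurePreserving_add_right volume c
  rw [integrable_torus_iff_Ioc hF c,
    ← h.integrableOn_comp_preimage (measurableEmbedding_addRight c)] at hi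
  simpa [torusMeasure, IntegrableOn, Function.comp_def, add_comm] using hi

theorem integrable_torus_sub_left {F : ℝ → E} (hF : Function.Periodic F (2 * π))
    (hi : Integrable F torusMeasure) (c : ℝ) :
    Integrable (fun x => F (c - x)) torusMeasure := by
  have h : MeasurePreserving (fun x : ℝ => c - x) volume volume :=
    measurePreserving_const_sub c
  have he : MeasurableEmbedding (fun x : ℝ => c - x) := (MeasurableEquiv.subLeft c).measurableEmbedding
  rw [integrable_torus_iff_Ioc hF (c - 2 * π), ← h.integrableOn_comp_preimage he] at hi
  have : (fun x : ℝ => c - x) ⁻¹' Ioc (c - 2 * π) (c - 2 * π + 2 * π) = Ico 0 (2 * π) := by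
    ext x; simp
  rw [this] at hi
  exact hi.congr_set_ae Ico_ae_eq_Ioc.symm

theorem integrable_torus_iff_intervalIntegrable {F : ℝ → E} (hF : Function.Periodic F (2 * π)) :
    Integrable F torusMeasure ↔ ∀ a b : ℝ, IntervalIntegrable F volume a b := by
  have h0 : Integrable F torusMeasure ↔ IntervalIntegrable F volume 0 (2 * π) := by
    rw [intervalIntegrable_iff_integrableOn_Ioc_of_le Real.two_pi_pos.le]; rfl
  constructor
  · intro h a b
    exact hF.intervalIntegrable₀ Real.two_pi_pos.ne' (h0.1 h) a b
  · exact fun h => h0.2 (h 0 (2 * π))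

open scoped Pointwise in
/-- A periodic property holding almost everywhere on one period holds almost everywhere. -/
theorem ae_of_ae_torus {P : ℝ → Prop} (hP : ∀ x, P (x + 2 * π) ↔ P x)
    (h : ∀ᵐ x ∂torusMeasure, P x) : ∀ᵐ x : ℝ, P x := by
  have hn : ∀ (g : AddSubgroup.zmultiples (2 * π)), g +ᵥ {x | ¬ P x} = {x | ¬ P x} := by
    intro g
    have hper : Function.Periodic P (2 * π) := fun x => propext (hP x)
    ext x
    rw [Set.mem_vadd_set_iff_neg_vadd_mem]
    simp only [mem_ofPred_eq]
    rw [periodic_vadd hper (-g) x]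
  have := (isAddFundamentalDomain_period 0).measure_zero_of_invariant {x | ¬ P x} hn (by
    rw [zero_add]
    have := ae_iff.1 h
    rwa [torusMeasure, Measure.restrict_apply₀' measurableSet_Ioc.nullMeasurableSet] at this)
  exact ae_iff.2 this

theorem ae_torus_of_ae {P : ℝ → Prop} (h : ∀ᵐ x : ℝ, P x) : ∀ᵐ x ∂torusMeasure, P x :=
  ae_restrict_of_ae h

end Torus

/-! ### Indefinite integrals -/

section Primitive

theorem Continuous.integrable_torus {E : Type*} [NormedAddCommGroup E] {f : ℝ → E} (hf : Continuous f) : Integrable f torusMeasure :=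
  (intervalIntegrable_iff_integrableOn_Ioc_of_le Real.two_pi_pos.le).1
    (hf.intervalIntegrable 0 (2 * π))

variable {E : Type*} [NormedAddCommGroup E] [NormedSpace ℝ E]

/-- `f` is an indefinite integral of the locally integrable function `h`. -/
structure IsPrimitive (f h : ℝ → E) : Prop where
  integrable : ∀ a b : ℝ, IntervalIntegrable h volume a b
  eq : ∀ x, f x = f 0 + ∫ t in (0 : ℝ)..x, h t

theorem IsPrimitive.sub_eq {f h : ℝ → E} (H : IsPrimitive f h) (a b : ℝ) :
    f b - f a = ∫ t in a..b, h t := by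
  rw [H.eq a, H.eq b, ← intervalIntegral.integral_interval_sub_left (H.integrable 0 b)
    (H.integrable 0 a)]
  abel

theorem IsPrimitive.continuous {f h : ℝ → E} (H : IsPrimitive f h) : Continuous f := by
  have : f = fun x => f 0 + ∫ t in (0 : ℝ)..x, h t := funext H.eq
  rw [this]
  exact continuous_const.add (intervalIntegral.continuous_primitive H.integrable 0)

theorem IsPrimitive.locallyIntegrable {f h : ℝ → E} (H : IsPrimitive f h) :
    LocallyIntegrable h volume := by
  rw [locallyIntegrable_iff]
  intro k hk
  obtain ⟨r, hr⟩ := hk.isBounded.subset_closedBall 0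
  rw [Real.closedBall_eq_Icc] at hr
  refine IntegrableOn.mono_set ?_ hr
  by_cases h0 : 0 - r ≤ 0 + r
  · exact (intervalIntegrable_iff_integrableOn_Icc_of_le h0).1 (H.integrable _ _)
  · rw [Icc_eq_empty h0]; simp

theorem IsPrimitive.ae_hasDerivAt [CompleteSpace E] {f h : ℝ → E} (H : IsPrimitive f h) :
    ∀ᵐ x, HasDerivAt f (h x) x := by
  filter_upwards [LocallyIntegrable.ae_hasDerivAt_integral H.locallyIntegrable] with x hx
  have : f = fun x => f 0 + ∫ t in (0 : ℝ)..x, h t := funext H.eq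
  rw [this]
  exact (hx 0).const_add _

theorem IsPrimitive.norm_sub_le {f h : ℝ → E} (H : IsPrimitive f h) (a b : ℝ) :
    dist (f a) (f b) ≤ dist (∫ t in (0 : ℝ)..a, ‖h t‖) (∫ t in (0 : ℝ)..b, ‖h t‖) := by
  rw [dist_comm, dist_eq_norm, H.sub_eq, Real.dist_eq, abs_sub_comm,
    intervalIntegral.integral_interval_sub_left (H.integrable 0 b).norm (H.integrable 0 a).norm]
  exact intervalIntegral.norm_integral_le_abs_integral_norm

/-- Absolute continuity sees only increments. This transfers it from `∫ ‖h‖` to a primitive of `h`,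
and from `γ̇` to its speed and its unit tangent. -/
theorem AbsolutelyContinuousOnInterval.of_dist_le {X Y : Type*} [PseudoMetricSpace X]
    [PseudoMetricSpace Y] {f : ℝ → X} {u : ℝ → Y} {a b : ℝ} (C : ℝ)
    (hu : AbsolutelyContinuousOnInterval u a b)
    (h : ∀ x ∈ uIcc a b, ∀ y ∈ uIcc a b, dist (f x) (f y) ≤ C * dist (u x) (u y)) :
    AbsolutelyContinuousOnInterval f a b := by
  rw [absolutelyContinuousOnInterval_iff] at hu ⊢
  intro ε hε
  obtain ⟨δ, hδ, H⟩ := hu (ε / (|C| + 1)) (by positivity)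
  refine ⟨δ, hδ, fun S hS hlt => ?_⟩
  have h1 := H S hS hlt
  calc ∑ i ∈ Finset.range S.1, dist (f (S.2 i).1) (f (S.2 i).2)
      ≤ ∑ i ∈ Finset.range S.1, (|C| + 1) * dist (u (S.2 i).1) (u (S.2 i).2) := by
        refine Finset.sum_le_sum fun i hi => ?_
        refine (h _ (hS.1 i hi).1 _ (hS.1 i hi).2).trans ?_
        gcongr
        linarith [le_abs_self C]
    _ = (|C| + 1) * ∑ i ∈ Finset.range S.1, dist (u (S.2 i).1) (u (S.2 i).2) := by
        rw [Finset.mul_sum]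
    _ < (|C| + 1) * (ε / (|C| + 1)) := by gcongr
    _ = ε := by field_simp

theorem IsPrimitive.absolutelyContinuous {f h : ℝ → E} (H : IsPrimitive f h) (a b : ℝ) :
    AbsolutelyContinuousOnInterval f a b := by
  have hU : ∀ c d : ℝ, 0 ∈ uIcc c d →
      AbsolutelyContinuousOnInterval (fun x => ∫ t in (0 : ℝ)..x, ‖h t‖) c d := fun c d h0 =>
    IntervalIntegrable.absolutelyContinuousOnInterval_intervalIntegral
      (H.integrable c d).norm h0
  -- The interval is enlarged to contain the base point `0` of the indefinite integral.
  have h0 : (0 : ℝ) ∈ uIcc (min (min a b) 0) (max (max a b) 0) := by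
    rw [uIcc_of_le (by simp)]; simp
  refine (AbsolutelyContinuousOnInterval.of_dist_le 1 (hU _ _ h0) fun x _ y _ => ?_).mono ?_
  · rw [one_mul]; exact H.norm_sub_le x y
  · rw [uIcc_of_le (a := min (min a b) 0) (by simp)]
    exact Icc_subset_Icc (by simp) (by simp)

/-- Subtracting the indefinite integral of `h` leaves an absolutely continuous function with
derivative zero almost everywhere, hence a constant. Product rules for Sobolev functions reduce to
this criterion. -/
theorem IsPrimitive.of_absolutelyContinuous [CompleteSpace E] {f h : ℝ → E}
    (hf : ∀ a b, AbsolutelyContinuousOnInterval f a b)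
    (hh : ∀ a b : ℝ, IntervalIntegrable h volume a b)
    (hd : ∀ᵐ x, HasDerivAt f (h x) x) : IsPrimitive f h := by
  refine ⟨hh, fun x => ?_⟩
  set G : ℝ → E := fun x => ∫ t in (0 : ℝ)..x, h t with hG
  have hGp : IsPrimitive G h := ⟨hh, fun x => by simp [hG]⟩
  have hac : AbsolutelyContinuousOnInterval (f - G) 0 x :=
    (hf 0 x).sub (hGp.absolutelyContinuous 0 x)
  have h0 : ∀ᵐ y, y ∈ uIcc 0 x → HasDerivAt (f - G) 0 y := by
    filter_upwards [hd, hGp.ae_hasDerivAt] with y h1 h2 _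
    simpa using h1.sub h2
  obtain ⟨C, hC⟩ := hac.const_of_ae_hasDerivAt_zero h0
  have h1 := hC x right_mem_uIcc
  have h2 := hC 0 left_mem_uIcc
  have : f x - G x = f 0 - G 0 := by simpa using h1.trans h2.symm
  have hG0 : G 0 = 0 := by simp [hG]
  rw [hG0, sub_zero] at this
  rw [← this]; simp [hG]

theorem IsPrimitive.congr_ae {f h h' : ℝ → E} (H : IsPrimitive f h) (hh : h =ᵐ[volume] h') :
    IsPrimitive f h' := by
  refine ⟨fun a b => (H.integrable a b).congr_ae (ae_restrict_of_ae hh), fun x => ?_⟩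
  rw [H.eq x]
  congr 1
  exact intervalIntegral.integral_congr_ae (by filter_upwards [hh] with y hy _ using hy)

theorem IsPrimitive.deriv_ae_eq [CompleteSpace E] {f h : ℝ → E} (H : IsPrimitive f h) :
    deriv f =ᵐ[volume] h := by
  filter_upwards [H.ae_hasDerivAt] with x hx using hx.deriv

theorem isPrimitive_of_hasDerivAt [CompleteSpace E] {f h : ℝ → E}
    (hf : ∀ x, HasDerivAt f (h x) x) (hh : Continuous h) : IsPrimitive f h := by
  refine ⟨fun a b => hh.intervalIntegrable a b, fun x => ?_⟩
  rw [intervalIntegral.integral_eq_sub_of_hasDerivAt (fun y _ => hf y) (hh.intervalIntegrable _ _)]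
  abel

theorem IsPrimitive.smul [CompleteSpace E] {φ φ' : ℝ → ℝ} {f h : ℝ → E} (hφ : IsPrimitive φ φ')
    (H : IsPrimitive f h) : IsPrimitive (fun x => φ x • f x) (fun x => φ x • h x + φ' x • f x) := by
  refine .of_absolutelyContinuous (fun a b => ?_) (fun a b => ?_) ?_
  · exact (hφ.absolutelyContinuous a b).smul (H.absolutelyContinuous a b)
  · exact ((H.integrable a b).continuousOn_smul hφ.continuous.continuousOn).add
      ((hφ.integrable a b).smul_continuousOn H.continuous.continuousOn)
  · filter_upwards [hφ.ae_hasDerivAt, H.ae_hasDerivAt] with x h1 h2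
    exact h1.smul h2

theorem IsPrimitive.clm [CompleteSpace E] {F : Type*} [NormedAddCommGroup F] [NormedSpace ℝ F]
    [CompleteSpace F] (L : E →L[ℝ] F) {f h : ℝ → E} (H : IsPrimitive f h) :
    IsPrimitive (fun x => L (f x)) (fun x => L (h x)) := by
  refine ⟨fun a b => ?_, fun x => ?_⟩
  · have := H.integrable a b
    rw [intervalIntegrable_iff] at this ⊢
    exact L.integrable_comp this
  · rw [H.eq x, map_add, L.intervalIntegral_comp_comm (H.integrable 0 x)]

theorem IsPrimitive.add {f h u w : ℝ → E} (H : IsPrimitive f h) (U : IsPrimitive u w) :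
    IsPrimitive (fun x => f x + u x) (fun x => h x + w x) := by
  refine ⟨fun a b => (H.integrable a b).add (U.integrable a b), fun x => ?_⟩
  rw [intervalIntegral.integral_add (H.integrable 0 x) (U.integrable 0 x), H.eq x, U.eq x]
  abel

/-- The integral over a period of the derivative of a periodic function vanishes. -/
theorem IsPrimitive.integral_torus_eq_zero {f h : ℝ → E} (H : IsPrimitive f h)
    (hf : Function.Periodic f (2 * π)) : ∫ x, h x ∂torusMeasure = 0 := by
  have : ∫ x, h x ∂torusMeasure = ∫ x in (0 : ℝ)..2 * π, h x := by
    rw [intervalIntegral.integral_of_le Real.two_pi_pos.le]; rfl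
  rw [this, ← H.sub_eq]
  have := hf 0
  rw [zero_add] at this
  rw [this, sub_self]

theorem IsPrimitive.integrable_torus {f h : ℝ → E} (H : IsPrimitive f h) :
    Integrable h torusMeasure :=
  (intervalIntegrable_iff_integrableOn_Ioc_of_le Real.two_pi_pos.le).1 (H.integrable 0 (2 * π))

/-- Integration by parts over a period. -/
theorem IsPrimitive.integral_torus_by_parts [CompleteSpace E] {φ φ' : ℝ → ℝ} {f h : ℝ → E}
    (hφ : IsPrimitive φ φ') (H : IsPrimitive f h) (hp : Function.Periodic φ (2 * π))
    (hf : Function.Periodic f (2 * π)) :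
    ∫ x, φ' x • f x ∂torusMeasure = - ∫ x, φ x • h x ∂torusMeasure := by
  have h0 := (hφ.smul H).integral_torus_eq_zero (fun x => by simp [hp x, hf x])
  rw [integral_add] at h0
  · rw [eq_neg_iff_add_eq_zero, add_comm]; exact h0
  · exact (intervalIntegrable_iff_integrableOn_Ioc_of_le Real.two_pi_pos.le).1
      ((H.integrable _ _).continuousOn_smul hφ.continuous.continuousOn)
  · exact (intervalIntegrable_iff_integrableOn_Ioc_of_le Real.two_pi_pos.le).1
      ((hφ.integrable _ _).smul_continuousOn H.continuous.continuousOn)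

theorem IsPrimitive.hasWeakDeriv {f h : ℝ → Plane} (H : IsPrimitive f h)
    (hf : Function.Periodic f (2 * π)) (hh : Function.Periodic h (2 * π)) : HasWeakDeriv f h := by
  refine ⟨hf, hh, H.continuous.integrable_torus, H.integrable_torus, fun φ hφ hp => ?_⟩
  have hφp : IsPrimitive φ (deriv φ) := isPrimitive_of_hasDerivAt
    (fun x => (hφ.differentiable (by simp)).differentiableAt.hasDerivAt)
    (hφ.continuous_deriv (by simp))
  exact hφp.integral_torus_by_parts H hp hf

end Primitive

/-! ### Weak derivatives of periodic functions -/

section WeakDeriv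

theorem MeasureTheory.Integrable.continuous_smul_torus {E : Type*} [NormedAddCommGroup E]
    [NormedSpace ℝ E] {φ : ℝ → ℝ} {u : ℝ → E} (hi : Integrable u torusMeasure)
    (hφ : Continuous φ) : Integrable (fun x => φ x • u x) torusMeasure := by
  obtain ⟨K, hK⟩ := isCompact_Icc.exists_bound_of_continuousOn
    (hφ.continuousOn (s := Icc 0 (2 * π)))
  refine hi.bdd_smul K hφ.aestronglyMeasurable ?_
  rw [torusMeasure]
  filter_upwards [ae_restrict_mem measurableSet_Ioc] with x hx using hK x ⟨hx.1.le, hx.2⟩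

/-- A smooth function supported in a period extends to a smooth periodic function. -/
theorem exists_periodic_contDiff_extension {φ : ℝ → ℝ} (hφ : ContDiff ℝ ∞ φ)
    (hs : tsupport φ ⊆ Ioo 0 (2 * π)) :
    ∃ ψ : ℝ → ℝ, ContDiff ℝ ∞ ψ ∧ Function.Periodic ψ (2 * π) ∧
      ∀ x ∈ Ioc (0 : ℝ) (2 * π), ψ x = φ x := by
  have hpi := Real.two_pi_pos
  have h0 : ∀ x, x ≤ 0 ∨ 2 * π ≤ x → φ x = 0 := by
    intro x hx
    by_contra hne
    have := hs (subset_tsupport _ (Function.mem_support.2 hne))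
    rcases hx with h | h <;> [linarith [this.1]; linarith [this.2]]
  set ψ : ℝ → ℝ := fun x => φ (toIcoMod hpi 0 x) with hψ
  have hmod : ∀ (n : ℤ) (y : ℝ), 2 * π * n ≤ y → y < 2 * π * (n + 1) →
      toIcoMod hpi 0 y = y - 2 * π * n := by
    intro n y h1 h2
    rw [toIcoMod_eq_iff]
    refine ⟨⟨by linarith, by linarith⟩, n, ?_⟩
    simp; ring
  -- On two consecutive periods `ψ` is a sum of two translates of `φ`, at most one of which is
  -- nonzero at each point. This makes smoothness across the common endpoint evident.
  have hloc : ∀ (n : ℤ) (y : ℝ), y ∈ Ioo (2 * π * (n - 1)) (2 * π * (n + 1)) →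
      ψ y = φ (y - 2 * π * (n - 1)) + φ (y - 2 * π * n) := by
    intro n y hy
    rcases lt_or_ge y (2 * π * n) with h | h
    · have := hmod (n - 1) y (by push_cast; linarith [hy.1]) (by push_cast; linarith)
      rw [hψ]; simp only [this]
      rw [h0 (y - 2 * π * n) (Or.inl (by linarith))]
      push_cast; ring
    · have := hmod n y h hy.2
      rw [hψ]; simp only [this]
      rw [h0 (y - 2 * π * (n - 1)) (Or.inr (by linarith))]
      ring
  refine ⟨ψ, ?_, fun x => by simp [hψ], fun x hx => ?_⟩
  · rw [contDiff_iff_contDiffAt]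
    intro x
    set n : ℤ := toIcoDiv hpi 0 x with hn
    have h1 : 2 * π * n ≤ x ∧ x < 2 * π * (n + 1) := by
      have h2 := sub_toIcoDiv_zsmul_mem_Ico hpi 0 x
      rw [← hn] at h2
      simp only [zsmul_eq_mul, mem_Ico, zero_add] at h2
      constructor <;> nlinarith [h2.1, h2.2]
    have hx : x ∈ Ioo (2 * π * ((n : ℝ) - 1)) (2 * π * ((n : ℝ) + 1)) :=
      ⟨by linarith, h1.2⟩
    have hev : ψ =ᶠ[𝓝 x] fun y => φ (y - 2 * π * (n - 1)) + φ (y - 2 * π * n) := by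
      filter_upwards [Ioo_mem_nhds hx.1 hx.2] with y hy using hloc n y hy
    refine ContDiffAt.congr_of_eventuallyEq ?_ hev
    exact ((hφ.comp (contDiff_id.sub contDiff_const)).add
      (hφ.comp (contDiff_id.sub contDiff_const))).contDiffAt
  · rcases eq_or_lt_of_le hx.2 with h | h
    · have : toIcoMod hpi 0 x = 0 := by
        rw [hmod 1 x (by simp [h]) (by push_cast; linarith)]; simp [h]
      rw [hψ]; simp only [this]
      rw [h0 0 (by simp), h0 x (Or.inr h.ge)]
    · have := hmod 0 x (by simpa using hx.1.le) (by simpa using h)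
      rw [hψ]; simp only [this]; simp

/-- **Du Bois-Reymond lemma** for periodic functions. -/
theorem ae_eq_const_of_integral_deriv_eq_zero {u : ℝ → Plane} (hu : Function.Periodic u (2 * π))
    (hi : Integrable u torusMeasure)
    (h : ∀ φ : ℝ → ℝ, ContDiff ℝ ∞ φ → Function.Periodic φ (2 * π) →
      ∫ x, deriv φ x • u x ∂torusMeasure = 0) :
    ∃ c, ∀ᵐ x, u x = c := by
  set c : Plane := (2 * π)⁻¹ • ∫ x, u x ∂torusMeasure with hc
  refine ⟨c, ae_of_ae_torus (fun x => by rw [hu x]) ?_⟩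
  have hreal : torusMeasure.real univ = 2 * π := by
    simp [torusMeasure, Measure.real, Real.pi_pos.le]
  have key : ∀ ψ : ℝ → ℝ, ContDiff ℝ ∞ ψ → Function.Periodic ψ (2 * π) →
      ∫ x, ψ x • (u x - c) ∂torusMeasure = 0 := by
    intro ψ hψ hp
    -- After subtraction of its mean, `ψ` is the derivative of a periodic function, so the
    -- hypothesis applies to it.
    set m : ℝ := (2 * π)⁻¹ * ∫ x, ψ x ∂torusMeasure with hm
    have hψc := hψ.continuous
    set φ : ℝ → ℝ := fun x => ∫ t in (0 : ℝ)..x, (ψ t - m) with hφ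
    have hcont : Continuous fun t => ψ t - m := hψc.sub continuous_const
    have hd : ∀ x, HasDerivAt φ (ψ x - m) x := fun x =>
      intervalIntegral.integral_hasDerivAt_right (hcont.intervalIntegrable _ _)
        (hcont.stronglyMeasurableAtFilter _ _) hcont.continuousAt
    have hdφ : deriv φ = fun x => ψ x - m := funext fun x => (hd x).deriv
    have hcd : ContDiff ℝ ∞ φ := by
      rw [contDiff_infty_iff_deriv, hdφ]
      exact ⟨fun x => (hd x).differentiableAt, hψ.sub contDiff_const⟩
    have hmean : ∫ x, (ψ x - m) ∂torusMeasure = 0 := by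
      rw [integral_sub hψc.integrable_torus (integrable_const _), integral_const, hreal, hm]
      have := Real.pi_pos
      simp only [smul_eq_mul]; field_simp; ring
    have hper : Function.Periodic φ (2 * π) := by
      intro x
      have hp' : Function.Periodic (fun t => ψ t - m) (2 * π) := fun t => by simp [hp t]
      have h1 := integral_torus_eq_interval hp' x
      rw [hmean] at h1
      simp only [hφ]
      rw [← intervalIntegral.integral_add_adjacent_intervals (hcont.intervalIntegrable 0 x)
        (hcont.intervalIntegrable x _), ← h1, add_zero]
    have h2 := h φ hcd hper
    rw [hdφ] at h2
    have hint : Integrable (fun x => ψ x • u x) torusMeasure :=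
      hi.continuous_smul_torus hψc
    simp_rw [sub_smul] at h2
    rw [integral_sub hint (hi.fun_smul m), integral_smul, sub_eq_zero] at h2
    simp_rw [smul_sub]
    rw [integral_sub hint (hψc.integrable_torus.smul_const c), h2, integral_smul_const, hc, hm,
      smul_smul, mul_comm, sub_self]
  have hloc : LocallyIntegrableOn (fun x => u x - c) (Ioo 0 (2 * π)) := by
    refine IntegrableOn.locallyIntegrableOn ?_
    have : IntegrableOn (fun x => u x - c) (Ioc 0 (2 * π)) := hi.sub (integrable_const c)
    exact this.mono_set Ioo_subset_Ioc_self
  have := isOpen_Ioo.ae_eq_zero_of_integral_contDiff_smul_eq_zero hloc ?_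
  · rw [torusMeasure, ae_restrict_iff' measurableSet_Ioc]
    have hne : ∀ᵐ x : ℝ, x ≠ 2 * π := by simp [ae_iff]
    filter_upwards [this, hne] with x hx hx2 hx3
    exact sub_eq_zero.1 (hx ⟨hx3.1, lt_of_le_of_ne hx3.2 hx2⟩)
  · intro φ hφ _ hs
    obtain ⟨ψ, hψ, hψp, hψφ⟩ := exists_periodic_contDiff_extension hφ hs
    have h1 := key ψ hψ hψp
    rw [← h1, torusMeasure, ← setIntegral_eq_integral_of_forall_compl_eq_zero (s := Ioc 0 (2 * π))]
    · exact setIntegral_congr_fun measurableSet_Ioc fun x hx => by simp only [hψφ x hx]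
    · intro x hx
      have : φ x = 0 := by
        by_contra hne
        exact hx (Ioo_subset_Ioc_self (hs (subset_tsupport _ (Function.mem_support.2 hne))))
      simp [this]

theorem HasWeakDeriv.integral_eq_zero {f h : ℝ → Plane} (H : HasWeakDeriv f h) :
    ∫ x, h x ∂torusMeasure = 0 := by
  have := H.integral_eq (fun _ => 1) contDiff_const (fun _ => rfl)
  simpa using this

/-- A function with a weak derivative is almost everywhere an indefinite integral. -/
theorem HasWeakDeriv.exists_isPrimitive {f h : ℝ → Plane} (H : HasWeakDeriv f h) :
    ∃ F, IsPrimitive F h ∧ Function.Periodic F (2 * π) ∧ f =ᵐ[volume] F := by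
  have hh := (integrable_torus_iff_intervalIntegrable H.periodic').1 H.integrable'
  set G : ℝ → Plane := fun x => ∫ t in (0 : ℝ)..x, h t with hG
  have hGp : IsPrimitive G h := ⟨hh, fun x => by simp [hG]⟩
  have hper : Function.Periodic G (2 * π) := by
    intro x
    rw [← sub_eq_zero, hGp.sub_eq, ← integral_torus_eq_interval H.periodic', H.integral_eq_zero]
  have hw := hGp.hasWeakDeriv hper H.periodic'
  obtain ⟨c, hc⟩ := ae_eq_const_of_integral_deriv_eq_zero (u := fun x => f x - G x)
    (fun x => by simp [H.periodic x, hper x]) (H.integrable.sub hw.integrable) (by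
      intro φ hφ hp
      have hb : ∀ (w : ℝ → Plane), Integrable w torusMeasure →
          Integrable (fun x => deriv φ x • w x) torusMeasure := by
        exact fun w hw => hw.continuous_smul_torus (hφ.continuous_deriv (by simp))
      simp_rw [smul_sub]
      rw [integral_sub (hb f H.integrable) (hb G hw.integrable), H.integral_eq φ hφ hp,
        hw.integral_eq φ hφ hp, sub_self])
  refine ⟨fun x => G x + c, ?_, fun x => by simp [hper x], ?_⟩
  · refine ⟨hh, fun x => ?_⟩
    simp [hG]; abel
  · filter_upwards [hc] with x hx
    rw [← hx]; abel

/-- Both densities have a primitive that agrees with `f` almost everywhere. The two primitives are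
continuous, so they coincide, and so do their derivatives. -/
theorem HasWeakDeriv.ae_eq {f h h' : ℝ → Plane} (H : HasWeakDeriv f h) (H' : HasWeakDeriv f h') :
    h =ᵐ[volume] h' := by
  obtain ⟨F, hF, -, h1⟩ := H.exists_isPrimitive
  obtain ⟨F', hF', -, h2⟩ := H'.exists_isPrimitive
  have : F = F' := (hF.continuous.ae_eq_iff_eq volume hF'.continuous).1 (h1.symm.trans h2)
  subst this
  exact hF.deriv_ae_eq.symm.trans hF'.deriv_ae_eq

theorem HasWeakDeriv.congr {f f' h : ℝ → Plane} (H : HasWeakDeriv f h) (hf : f =ᵐ[volume] f')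
    (hp : Function.Periodic f' (2 * π)) : HasWeakDeriv f' h := by
  have hf' : f =ᵐ[torusMeasure] f' := ae_torus_of_ae hf
  refine ⟨hp, H.periodic', H.integrable.congr hf', H.integrable', fun φ h1 h2 => ?_⟩
  rw [← H.integral_eq φ h1 h2]
  refine integral_congr_ae ?_
  filter_upwards [hf'] with x hx
  simp only [hx]

theorem HasWeakDeriv.weakDeriv {f h : ℝ → Plane} (H : HasWeakDeriv f h) :
    HasWeakDeriv f (weakDeriv f) := by
  have h1 : ∃ f', HasWeakDeriv f f' := ⟨h, H⟩
  rw [_root_.weakDeriv, dif_pos h1]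
  exact h1.choose_spec

theorem HasWeakDeriv.weakDeriv_ae_eq {f h : ℝ → Plane} (H : HasWeakDeriv f h) :
    _root_.weakDeriv f =ᵐ[volume] h :=
  H.weakDeriv.ae_eq H

/-- A continuous function with a weak derivative is an indefinite integral of it. -/
theorem HasWeakDeriv.isPrimitive {f h : ℝ → Plane} (H : HasWeakDeriv f h) (hf : Continuous f) :
    IsPrimitive f h := by
  obtain ⟨F, hF, -, h1⟩ := H.exists_isPrimitive
  rwa [(hf.ae_eq_iff_eq volume hF.continuous).1 h1]

end WeakDeriv

/-! ### Integral inequalities -/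

section Young

/-- A weighted Minkowski inequality for integrals. -/
theorem lintegral_rpow_lintegral_mul_le {α β : Type*} [MeasurableSpace α] [MeasurableSpace β]
    {μ : Measure α} {ν : Measure β} [SFinite μ] [SFinite ν] {p : ℝ} (hp : 1 < p)
    {w : β → ℝ≥0∞} (hw : Measurable w) {a : α → β → ℝ≥0∞} (ha : Measurable (Function.uncurry a))
    {K : ℝ≥0∞} (h : ∀ y, ∫⁻ x, a x y ^ p ∂μ ≤ K) :
    ∫⁻ x, (∫⁻ y, w y * a x y ∂ν) ^ p ∂μ ≤ (∫⁻ y, w y ∂ν) ^ p * K := by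
  have hp0 : 0 < p := by linarith
  set q := p.conjExponent with hq
  have hpq : p.HolderConjugate q := Real.HolderConjugate.conjExponent hp
  have hax : ∀ x, Measurable (a x) := fun x => ha.comp measurable_prodMk_left
  set W := ∫⁻ y, w y ∂ν with hW
  -- Hölder's inequality for the factorization `w a = w^{1/q} (w^{1/p} a)`; Tonelli's theorem then
  -- finishes.
  have h1 : ∀ x, (∫⁻ y, w y * a x y ∂ν) ^ p ≤ W ^ (p / q) * ∫⁻ y, w y * a x y ^ p ∂ν := by
    intro x
    have e : ∀ y, w y * a x y = (w y ^ (1 / q)) * (w y ^ (1 / p) * a x y) := by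
      intro y
      rw [← mul_assoc, ← ENNReal.rpow_add_of_nonneg _ _ hpq.symm.one_div_nonneg
        hpq.one_div_nonneg]
      have := hpq.inv_add_inv_eq_one
      rw [show 1 / q + 1 / p = 1 by rw [one_div, one_div]; linarith, ENNReal.rpow_one]
    have H := ENNReal.lintegral_mul_le_Lp_mul_Lq ν hpq.symm (f := fun y => w y ^ (1 / q))
      (g := fun y => w y ^ (1 / p) * a x y) (hw.pow_const _).aemeasurable
      ((hw.pow_const _).mul (hax x)).aemeasurable
    simp only [Pi.mul_apply] at H
    calc (∫⁻ y, w y * a x y ∂ν) ^ p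
        = (∫⁻ y, (w y ^ (1 / q)) * (w y ^ (1 / p) * a x y) ∂ν) ^ p := by
          congr 1; exact lintegral_congr e
      _ ≤ _ := ENNReal.rpow_le_rpow H hp0.le
      _ = W ^ (p / q) * ∫⁻ y, w y * a x y ^ p ∂ν := by
          rw [ENNReal.mul_rpow_of_nonneg _ _ hp0.le, ← ENNReal.rpow_mul, ← ENNReal.rpow_mul]
          congr 1
          · rw [hW]
            congr 1
            · refine lintegral_congr fun y => ?_
              rw [← ENNReal.rpow_mul, one_div_mul_cancel hpq.symm.ne_zero, ENNReal.rpow_one]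
            · ring
          · rw [one_div_mul_cancel hp0.ne', ENNReal.rpow_one]
            refine lintegral_congr fun y => ?_
            rw [ENNReal.mul_rpow_of_nonneg _ _ hp0.le, ← ENNReal.rpow_mul,
              one_div_mul_cancel hp0.ne', ENNReal.rpow_one]
  calc ∫⁻ x, (∫⁻ y, w y * a x y ∂ν) ^ p ∂μ
      ≤ ∫⁻ x, W ^ (p / q) * ∫⁻ y, w y * a x y ^ p ∂ν ∂μ := lintegral_mono h1
    _ = W ^ (p / q) * ∫⁻ x, ∫⁻ y, w y * a x y ^ p ∂ν ∂μ := by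
        refine lintegral_const_mul _ ?_
        refine Measurable.lintegral_prod_right ?_
        exact (hw.comp measurable_snd).mul (ha.pow_const p)
    _ = W ^ (p / q) * ∫⁻ y, ∫⁻ x, w y * a x y ^ p ∂μ ∂ν := by
        rw [lintegral_lintegral_swap]
        exact ((hw.comp measurable_snd).mul (ha.pow_const p)).aemeasurable
    _ ≤ W ^ (p / q) * ∫⁻ y, w y * K ∂ν := by
        gcongr with y
        have hay : Measurable fun x => a x y := ha.comp measurable_prodMk_right
        rw [lintegral_const_mul _ (hay.pow_const p)]
        gcongr
        exact h y
    _ = W ^ p * K := by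
        rw [lintegral_mul_const _ hw, ← mul_assoc]
        congr 1
        rw [← hW]
        have e : W ^ (p / q) * W = W ^ (p / q) * W ^ (1 : ℝ) := by rw [ENNReal.rpow_one]
        rw [e, ← ENNReal.rpow_add_of_nonneg _ _ (div_nonneg hp0.le hpq.symm.nonneg) zero_le_one]
        congr 1
        have := hpq.inv_add_inv_eq_one
        have hq0 : q ≠ 0 := hpq.symm.ne_zero
        field_simp at this ⊢
        linarith

/-- Young's convolution inequality on the torus. -/
theorem lintegral_rpow_convolution_le {p : ℝ} (hp : 1 < p) {w f : ℝ → ℝ≥0∞} (hw : Measurable w)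
    (hf : Measurable f) (hwp : Function.Periodic w (2 * π)) (hfp : Function.Periodic f (2 * π)) :
    ∫⁻ x, (∫⁻ y, w (x - y) * f y ∂torusMeasure) ^ p ∂torusMeasure ≤
      (∫⁻ y, w y ∂torusMeasure) ^ p * ∫⁻ y, f y ^ p ∂torusMeasure := by
  have h1 : ∀ x, ∫⁻ y, w (x - y) * f y ∂torusMeasure = ∫⁻ y, w y * f (x - y) ∂torusMeasure := by
    intro x
    have := lintegral_torus_sub_left (F := fun y => w y * f (x - y))
      (fun y => by simp only [hwp y]; congr 1; rw [← hfp, sub_add_eq_sub_sub, sub_add_cancel]) x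
    rw [← this]
    simp
  simp_rw [h1]
  refine lintegral_rpow_lintegral_mul_le hp hw
    (a := fun x y => f (x - y)) (hf.comp (measurable_fst.sub measurable_snd)) (fun y => ?_)
  have := lintegral_torus_add_right (F := fun x => f x ^ p) (fun x => by simp only [hfp x]) (-y)
  rw [← this]
  simp [sub_eq_add_neg]

/-- The `L^p` modulus of continuity of an indefinite integral. -/
theorem IsPrimitive.lintegral_enorm_sub_rpow_le {E : Type*} [NormedAddCommGroup E]
    [NormedSpace ℝ E] [MeasurableSpace E] [BorelSpace E] {p : ℝ} (hp : 1 < p) {f h : ℝ → E}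
    (H : IsPrimitive f h) (hm : Measurable h) (hper : Function.Periodic h (2 * π)) (t : ℝ) :
    ∫⁻ x, ‖f (x + t) - f x‖ₑ ^ p ∂torusMeasure ≤
      ‖t‖ₑ ^ p * ∫⁻ x, ‖h x‖ₑ ^ p ∂torusMeasure := by
  have hp0 : 0 < p := by linarith
  -- The increment is `t` times the average of `h` over the segment from `x` to `x + t`. Minkowski's
  -- inequality over the parameter `s` then uses that translations preserve the `L^p` norm.
  have h1 : ∀ x, ‖f (x + t) - f x‖ₑ ≤ ‖t‖ₑ * ∫⁻ s in Ioc (0 : ℝ) 1, ‖h (x + t * s)‖ₑ := by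
    intro x
    have : f (x + t) - f x = t • ∫ s in (0 : ℝ)..1, h (x + t * s) := by
      rw [intervalIntegral.smul_integral_comp_add_mul, H.sub_eq]; simp
    rw [this, enorm_smul, intervalIntegral.integral_of_le zero_le_one]
    gcongr
    exact enorm_integral_le_lintegral_enorm _
  have h2 := lintegral_rpow_lintegral_mul_le (μ := torusMeasure)
    (ν := volume.restrict (Ioc (0 : ℝ) 1)) hp (w := fun _ => 1) measurable_const
    (a := fun x s => ‖h (x + t * s)‖ₑ)
    (hm.comp (measurable_fst.add (measurable_snd.const_mul t))).enorm
    (K := ∫⁻ x, ‖h x‖ₑ ^ p ∂torusMeasure) (fun s => by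
      rw [lintegral_torus_add_right (F := fun x => ‖h x‖ₑ ^ p) (fun x => by simp only [hper x])])
  calc ∫⁻ x, ‖f (x + t) - f x‖ₑ ^ p ∂torusMeasure
      ≤ ∫⁻ x, (‖t‖ₑ * ∫⁻ s in Ioc (0 : ℝ) 1, ‖h (x + t * s)‖ₑ) ^ p ∂torusMeasure := by
        gcongr with x; exact h1 x
    _ = ‖t‖ₑ ^ p * ∫⁻ x, (∫⁻ s in Ioc (0 : ℝ) 1, ‖h (x + t * s)‖ₑ) ^ p ∂torusMeasure := by
        simp_rw [ENNReal.mul_rpow_of_nonneg _ _ hp0.le]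
        refine lintegral_const_mul' _ _ (ENNReal.rpow_ne_top_of_nonneg hp0.le (by simp))
    _ ≤ _ := by
        refine mul_le_mul_right ?_ _
        simpa using h2

end Young

/-! ### The distance to zero on the torus -/

section TorDist

/-- The distance of `x` to `0` on the torus `ℝ / 2πℤ`. -/
noncomputable def torDist (x : ℝ) : ℝ := ‖(x : AddCircle (2 * π))‖

theorem torDist_nonneg (x : ℝ) : 0 ≤ torDist x := norm_nonneg _

theorem torDist_periodic : Function.Periodic torDist (2 * π) := fun x => by
  simp [torDist]

theorem torDist_eq_abs {x : ℝ} (hx : |x| ≤ π) : torDist x = |x| := by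
  rw [torDist, AddCircle.norm_coe_eq_abs_iff _ Real.two_pi_pos.ne', abs_of_pos Real.two_pi_pos]
  linarith

theorem torDist_le_pi (x : ℝ) : torDist x ≤ π := by
  have := AddCircle.norm_le_half_period (2 * π) (x := (x : AddCircle (2 * π))) Real.two_pi_pos.ne'
  rw [abs_of_pos Real.two_pi_pos] at this
  rw [torDist]; linarith

theorem continuous_torDist : Continuous torDist :=
  continuous_norm.comp (AddCircle.continuous_mk' _)

/-- To prove a periodic property, it suffices to consider `[-π, π]`. -/
theorem periodic_induction {P : ℝ → Prop} (hP : ∀ x, P (x + 2 * π) ↔ P x)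
    (h : ∀ x, |x| ≤ π → P x) (x : ℝ) : P x := by
  have hper : Function.Periodic P (2 * π) := fun x => propext (hP x)
  obtain ⟨y, hy, hxy⟩ := hper.exists_mem_Ico Real.two_pi_pos x (-π)
  rw [hxy]
  exact h y (abs_le.2 ⟨hy.1, by linarith [hy.2]⟩)

theorem torDist_le_abs (x : ℝ) : torDist x ≤ |x| := by
  by_cases hx : |x| ≤ π
  · exact (torDist_eq_abs hx).le
  · exact (torDist_le_pi x).trans (not_le.1 hx).le

theorem integrable_torDist_rpow {β : ℝ} (hβ : -1 < β) :
    Integrable (fun x => torDist x ^ β) torusMeasure := by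
  have hper : Function.Periodic (fun x => torDist x ^ β) (2 * π) := fun x => by
    simp only [torDist_periodic x]
  rw [integrable_torus_iff_Ioc hper (-π), show -π + 2 * π = π by ring]
  have h1 : IntervalIntegrable (fun x : ℝ => |x| ^ β) volume (-π) π := by
    have h2 : IntervalIntegrable (fun x : ℝ => |x| ^ β) volume 0 π := by
      refine (intervalIntegral.intervalIntegrable_rpow' (a := 0) (b := π) hβ).congr ?_
      intro x hx
      rw [uIoc_of_le Real.pi_pos.le] at hx
      simp only [abs_of_pos hx.1]
    have h3 : IntervalIntegrable (fun x : ℝ => |x| ^ β) volume (-π) 0 := by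
      have := (IntervalIntegrable.iff_comp_neg (f := fun x : ℝ => |x| ^ β)).1 h2
      simpa using this.symm
    exact h3.trans h2
  rw [intervalIntegrable_iff_integrableOn_Ioc_of_le (by linarith [Real.pi_pos])] at h1
  refine h1.congr_fun (fun x hx => ?_) measurableSet_Ioc
  simp only
  rw [torDist_eq_abs (abs_le.2 ⟨hx.1.le, hx.2⟩)]

theorem lintegral_torDist_rpow_lt_top {β : ℝ} (hβ : -1 < β) :
    ∫⁻ x, ENNReal.ofReal (torDist x ^ β) ∂torusMeasure < ⊤ := by
  have := (integrable_torDist_rpow hβ).2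
  rw [hasFiniteIntegral_iff_ofReal
    (Eventually.of_forall fun x => Real.rpow_nonneg (torDist_nonneg x) _)] at this
  exact this

/-- The `L^p` bound for singular integrals of increments of a Sobolev function. -/
theorem IsPrimitive.lintegral_increment_le {E : Type*} [NormedAddCommGroup E]
    [NormedSpace ℝ E] [MeasurableSpace E] [BorelSpace E] [SecondCountableTopology E]
    {p α : ℝ} (hp : 1 < p) (hα : α < 1)
    {f h : ℝ → E} (H : IsPrimitive f h) (hm : Measurable h) (hf : Function.Periodic f (2 * π))
    (hper : Function.Periodic h (2 * π)) :
    ∫⁻ x, (∫⁻ y, ENNReal.ofReal (torDist (x - y) ^ (α - 2)) * ‖f x - f y‖ₑ ∂torusMeasure) ^ p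
        ∂torusMeasure ≤
      (∫⁻ x, ENNReal.ofReal (torDist x ^ (α - 1)) ∂torusMeasure) ^ p *
        ∫⁻ x, ‖h x‖ₑ ^ p ∂torusMeasure := by
  have hp0 : 0 < p := by linarith
  have hfm : Measurable f := H.continuous.measurable
  have htm : Measurable torDist := continuous_torDist.measurable
  -- With `t = x - y`, the power `α - 2` splits into the integrable weight `t^{α-1}` and the factor
  -- `t⁻¹` that turns the increment into a difference quotient. The latter is bounded in `L^p`
  -- uniformly in `t`.
  have h1 : ∀ x, ∫⁻ y, ENNReal.ofReal (torDist (x - y) ^ (α - 2)) * ‖f x - f y‖ₑ ∂torusMeasure =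
      ∫⁻ t, ENNReal.ofReal (torDist t ^ (α - 1)) *
        (ENNReal.ofReal ((torDist t)⁻¹) * ‖f x - f (x - t)‖ₑ) ∂torusMeasure := by
    intro x
    have := lintegral_torus_sub_left
      (F := fun t => ENNReal.ofReal (torDist t ^ (α - 2)) * ‖f x - f (x - t)‖ₑ)
      (fun t => by
        simp only [torDist_periodic t]
        rw [← hf (x - (t + 2 * π)), sub_add_eq_sub_sub, sub_add_cancel]) x
    simp only [sub_sub_cancel] at this
    rw [this]
    refine lintegral_congr fun t => ?_
    rw [← mul_assoc, ← ENNReal.ofReal_mul (Real.rpow_nonneg (torDist_nonneg _) _)]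
    congr 2
    -- At distance zero both sides vanish, since `0` to a nonzero power is `0`.
    rcases (torDist_nonneg t).eq_or_lt with h0 | h0
    · rw [← h0, Real.zero_rpow (by linarith), Real.zero_rpow (by linarith)]; simp
    · rw [← Real.rpow_neg_one, ← Real.rpow_add h0]; congr 1; ring
  simp_rw [h1]
  refine lintegral_rpow_lintegral_mul_le hp (htm.pow_const _).ennreal_ofReal ?_ (fun t => ?_)
  · refine Measurable.mul ((htm.comp measurable_snd).inv.ennreal_ofReal) ?_
    exact ((hfm.comp measurable_fst).sub (hfm.comp (measurable_fst.sub measurable_snd))).enorm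
  · refine periodic_induction (P := fun t => ∫⁻ x,
      (ENNReal.ofReal ((torDist t)⁻¹) * ‖f x - f (x - t)‖ₑ) ^ p ∂torusMeasure ≤
      ∫⁻ x, ‖h x‖ₑ ^ p ∂torusMeasure) (fun t => ?_) (fun t ht => ?_) t
    · have : ∀ x, f (x - (t + 2 * π)) = f (x - t) := fun x => by
        rw [← hf (x - (t + 2 * π)), sub_add_eq_sub_sub, sub_add_cancel]
      simp only [this, torDist_periodic t]
    · rw [torDist_eq_abs ht]
      rcases eq_or_ne t 0 with rfl | h0
      · simp [hp0]
      have hb := H.lintegral_enorm_sub_rpow_le hp hm hper (-t)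
      simp_rw [ENNReal.mul_rpow_of_nonneg _ _ hp0.le]
      rw [lintegral_const_mul' _ _ (ENNReal.rpow_ne_top_of_nonneg hp0.le (by simp))]
      have e : ∀ x, ‖f x - f (x - t)‖ₑ = ‖f (x + -t) - f x‖ₑ := fun x => by
        rw [← sub_eq_add_neg, ← enorm_neg, neg_sub]
      simp_rw [e]
      calc _ ≤ ENNReal.ofReal |t|⁻¹ ^ p * (‖-t‖ₑ ^ p * ∫⁻ x, ‖h x‖ₑ ^ p ∂torusMeasure) := by
            gcongr
        _ = _ := by
            rw [← mul_assoc, ← ENNReal.mul_rpow_of_nonneg _ _ hp0.le, enorm_neg,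
              Real.enorm_eq_ofReal_abs, ← ENNReal.ofReal_mul (by positivity),
              inv_mul_cancel₀ (abs_ne_zero.2 h0)]
            simp

end TorDist

/-! ### The Poisson kernel and the conjugate Poisson kernel -/

section Kernels

/-- `|1 - r e^{ix}|²`. -/
noncomputable def poissonDenom (r x : ℝ) : ℝ := 1 - 2 * r * Real.cos x + r ^ 2

/-- The Poisson kernel of the unit disc. -/
noncomputable def poissonKer (r x : ℝ) : ℝ := (1 - r ^ 2) / poissonDenom r x

/-- Half of the conjugate Poisson kernel of the unit disc. -/
noncomputable def conjKer (r x : ℝ) : ℝ := r * Real.sin x / poissonDenom r x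

/-- The conjugate Poisson integral, up to normalization. -/
noncomputable def conjPoisson (r : ℝ) (f : ℝ → ℝ) (x : ℝ) : ℝ :=
  ∫ t, f t * conjKer r (x - t) ∂torusMeasure

/-- The Poisson integral. -/
noncomputable def poissonInt (r : ℝ) (f : ℝ → ℝ) (x : ℝ) : ℝ :=
  (2 * π)⁻¹ * ∫ t, f t * poissonKer r (x - t) ∂torusMeasure

theorem poissonDenom_ge {r : ℝ} (hr : 0 ≤ r) (x : ℝ) : (1 - r) ^ 2 ≤ poissonDenom r x := by
  unfold poissonDenom; nlinarith [Real.cos_le_one x]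

theorem poissonDenom_pos {r : ℝ} (hr : 0 ≤ r) (hr1 : r < 1) (x : ℝ) : 0 < poissonDenom r x :=
  lt_of_lt_of_le (by have := sub_pos.2 hr1; positivity) (poissonDenom_ge hr x)

theorem poissonDenom_periodic (r : ℝ) : Function.Periodic (poissonDenom r) (2 * π) := fun x => by
  simp [poissonDenom]

theorem poissonKer_periodic (r : ℝ) : Function.Periodic (poissonKer r) (2 * π) := fun x => by
  simp [poissonKer, poissonDenom_periodic r x]

theorem conjKer_periodic (r : ℝ) : Function.Periodic (conjKer r) (2 * π) := fun x => by
  simp [conjKer, poissonDenom_periodic r x]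

theorem continuous_poissonDenom (r : ℝ) : Continuous (poissonDenom r) := by
  unfold poissonDenom; fun_prop

theorem continuous_poissonKer {r : ℝ} (hr : 0 ≤ r) (hr1 : r < 1) : Continuous (poissonKer r) :=
  continuous_const.div (continuous_poissonDenom r) fun x => (poissonDenom_pos hr hr1 x).ne'

theorem continuous_conjKer {r : ℝ} (hr : 0 ≤ r) (hr1 : r < 1) : Continuous (conjKer r) :=
  (by fun_prop : Continuous fun x => r * Real.sin x).div (continuous_poissonDenom r)
    fun x => (poissonDenom_pos hr hr1 x).ne'

theorem poissonKer_nonneg {r : ℝ} (hr : 0 ≤ r) (hr1 : r < 1) (x : ℝ) : 0 ≤ poissonKer r x :=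
  div_nonneg (by nlinarith) (poissonDenom_pos hr hr1 x).le

theorem poissonKer_pos {r : ℝ} (hr : 0 ≤ r) (hr1 : r < 1) (x : ℝ) : 0 < poissonKer r x :=
  div_pos (by nlinarith) (poissonDenom_pos hr hr1 x)

theorem conjKer_neg (r x : ℝ) : conjKer r (-x) = -conjKer r x := by
  simp [conjKer, poissonDenom, neg_div]

theorem poissonKer_neg (r x : ℝ) : poissonKer r (-x) = poissonKer r x := by
  simp [poissonKer, poissonDenom]

theorem conjKer_le {r : ℝ} (hr : 0 ≤ r) (hr1 : r < 1) (x : ℝ) :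
    |conjKer r x| ≤ 1 / (1 - r) ^ 2 := by
  have := sub_pos.2 hr1
  rw [conjKer, abs_div, abs_of_pos (poissonDenom_pos hr hr1 x), abs_mul, abs_of_nonneg hr]
  refine div_le_div₀ (by positivity) ?_ (by positivity) (poissonDenom_ge hr x)
  nlinarith [Real.abs_sin_le_one x, abs_nonneg (Real.sin x)]

theorem integrable_mul_continuous_torus {f k : ℝ → ℝ} (hf : Integrable f torusMeasure)
    (hk : Continuous k) : Integrable (fun t => f t * k t) torusMeasure := by
  simpa [mul_comm] using hf.continuous_smul_torus hk

/-- The kernel `(ζ + w) / (ζ - w)` depends only on `z = w / ζ = r e^{iu}`. The real and imaginary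
parts of `(1 + z) / (1 - z)` are the Poisson kernel and its conjugate. -/
theorem herglotzRieszKernel_exp {r : ℝ} (hr : 0 ≤ r) (hr1 : r < 1) (θ t : ℝ) :
    herglotzRieszKernel 0 (circleMap 0 r θ) (circleMap 0 1 t) =
      (poissonKer r (θ - t) : ℂ) + ((2 * conjKer r (θ - t) : ℝ) : ℂ) * Complex.I := by
  set u := θ - t with hu
  have hden := poissonDenom_pos hr hr1 u
  have e1 : circleMap 0 r θ = circleMap 0 1 t * (r * Complex.exp (u * Complex.I)) := by
    simp only [circleMap, zero_add, hu]
    push_cast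
    rw [one_mul, mul_left_comm, ← Complex.exp_add]
    congr 2; ring
  have hne : circleMap 0 1 t ≠ 0 := by simp [circleMap]
  have e2 : herglotzRieszKernel 0 (circleMap 0 r θ) (circleMap 0 1 t) =
      (1 + r * Complex.exp (u * Complex.I)) / (1 - r * Complex.exp (u * Complex.I)) := by
    rw [herglotzRieszKernel_def, e1, sub_zero, sub_zero, ← mul_one_add, ← mul_one_sub,
      mul_div_mul_left _ _ hne]
  have hsc := Real.sin_sq_add_cos_sq u
  have hD : poissonDenom r u = 1 - 2 * r * Real.cos u + r ^ 2 := rfl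
  have hP : poissonKer r u * poissonDenom r u = 1 - r ^ 2 := div_mul_cancel₀ _ hden.ne'
  have hQ : conjKer r u * poissonDenom r u = r * Real.sin u := div_mul_cancel₀ _ hden.ne'
  rw [e2, Complex.exp_mul_I, ← Complex.ofReal_cos, ← Complex.ofReal_sin]
  -- What is left is algebra in `c`, `s`, `P`, `Q`, using only `s² + c² = 1` and the defining
  -- equations of the two kernels.
  generalize Real.cos u = c at *
  generalize Real.sin u = s at *
  generalize poissonKer r u = P at *
  generalize conjKer r u = Q at *
  rw [hD] at hden hP hQ
  have hn : (1 - r * ((c : ℂ) + (s : ℂ) * Complex.I)) ≠ 0 := by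
    intro h
    have h1 := congrArg Complex.re h
    have h2 := congrArg Complex.im h
    simp only [Complex.sub_re, Complex.one_re, Complex.mul_re, Complex.ofReal_re, Complex.add_re,
      Complex.I_re, Complex.I_im, Complex.ofReal_im, Complex.add_im, Complex.mul_im, Complex.sub_im,
      Complex.one_im, Complex.zero_re, Complex.zero_im] at h1 h2
    nlinarith
  rw [div_eq_iff hn]
  have hden' := hden.ne'
  apply Complex.ext
  · simp only [Complex.sub_re, Complex.one_re, Complex.mul_re, Complex.ofReal_re, Complex.add_re,
      Complex.I_re, Complex.I_im, Complex.ofReal_im, Complex.add_im, Complex.mul_im, Complex.sub_im,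
      Complex.one_im]
    apply mul_right_cancel₀ hden'
    linear_combination (-(1 - r * c)) * hP - 2 * r * s * hQ - 2 * r ^ 2 * hsc
  · simp only [Complex.sub_re, Complex.one_re, Complex.mul_re, Complex.ofReal_re, Complex.add_re,
      Complex.I_re, Complex.I_im, Complex.ofReal_im, Complex.add_im, Complex.mul_im, Complex.sub_im,
      Complex.one_im]
    apply mul_right_cancel₀ hden'
    linear_combination r * s * hP - 2 * (1 - r * c) * hQ

end Kernels

/-! ### The Herglotz integral -/

section Herglotz

variable {f : ℝ → ℝ}

/-- The analytic function in the disc whose real part has boundary values `f`. -/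
noncomputable def herglotzInt (f : ℝ → ℝ) (w : ℂ) : ℂ :=
  Real.circleAverage (fun ζ => herglotzRieszKernel 0 w ζ • ((f ζ.arg : ℝ) : ℂ)) 0 1

/-- The argument returns `t` modulo `2π`, so a periodic `f` may be transplanted to the circle
through `arg`. -/
theorem apply_arg_circleMap (hf : Function.Periodic f (2 * π)) (t : ℝ) :
    f (circleMap 0 1 t).arg = f t := by
  have : circleMap 0 1 t = Complex.exp (t * Complex.I) := by simp [circleMap]
  rw [this, Complex.arg_exp_mul_I]
  rw [← self_sub_toIocDiv_zsmul]
  exact hf.sub_zsmul_eq _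

theorem differentiableOn_herglotzInt (hf : Function.Periodic f (2 * π))
    (hi : Integrable f torusMeasure) : DifferentiableOn ℂ (herglotzInt f) (Metric.ball 0 1) := by
  intro w hw
  refine (hasDerivAt_circleAverage_herglotzRieszKernel_smul (R := 1) ?_ hw).differentiableAt
    |>.differentiableWithinAt
  simp only [CircleIntegrable, apply_arg_circleMap hf]
  rw [intervalIntegrable_iff_integrableOn_Ioc_of_le Real.two_pi_pos.le]
  exact hi.ofReal

theorem herglotzInt_circleMap (hf : Function.Periodic f (2 * π)) (hi : Integrable f torusMeasure)
    {r : ℝ} (hr : 0 ≤ r) (hr1 : r < 1) (θ : ℝ) :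
    herglotzInt f (circleMap 0 r θ) =
      (poissonInt r f θ : ℂ) + ((π⁻¹ * conjPoisson r f θ : ℝ) : ℂ) * Complex.I := by
  have h1 : Integrable (fun t => f t * poissonKer r (θ - t)) torusMeasure :=
    integrable_mul_continuous_torus hi ((continuous_poissonKer hr hr1).comp (by fun_prop))
  have h2 : Integrable (fun t => f t * conjKer r (θ - t)) torusMeasure :=
    integrable_mul_continuous_torus hi ((continuous_conjKer hr hr1).comp (by fun_prop))
  rw [herglotzInt, Real.circleAverage_def]
  simp only [apply_arg_circleMap hf, herglotzRieszKernel_exp hr hr1]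
  rw [intervalIntegral.integral_of_le Real.two_pi_pos.le]
  change (2 * π)⁻¹ • ∫ t, _ ∂torusMeasure = _
  have e : ∀ t, ((poissonKer r (θ - t) : ℂ) + ((2 * conjKer r (θ - t) : ℝ) : ℂ) * Complex.I) •
      ((f t : ℝ) : ℂ) = ((f t * poissonKer r (θ - t) : ℝ) : ℂ) +
        ((f t * conjKer r (θ - t) : ℝ) : ℂ) * (2 * Complex.I) := by
    intro t; simp only [smul_eq_mul]; push_cast; ring
  simp_rw [e]
  rw [integral_add h1.ofReal (h2.ofReal.mul_const _), integral_mul_const, integral_complex_ofReal,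
    integral_complex_ofReal, poissonInt, conjPoisson, Complex.real_smul]
  have : (π : ℂ) ≠ 0 := by exact_mod_cast Real.pi_ne_zero
  push_cast
  field_simp

/-- The Poisson formula for an analytic function, on the unit circle. -/
theorem poisson_formula_circle {G : ℂ → ℂ} (hG : DiffContOnCl ℂ G (Metric.ball 0 1))
    {r : ℝ} (hr : 0 ≤ r) (hr1 : r < 1) (θ : ℝ) :
    G (circleMap 0 r θ) =
      (2 * π)⁻¹ • ∫ t, (poissonKer r (θ - t)) • G (circleMap 0 1 t) ∂torusMeasure := by
  have hw : circleMap 0 r θ ∈ Metric.ball (0 : ℂ) 1 := by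
    simp [circleMap, abs_of_nonneg hr, hr1]
  rw [← hG.circleAverage_re_herglotzRieszKernel_smul hw, Real.circleAverage_def,
    intervalIntegral.integral_of_le Real.two_pi_pos.le]
  simp only [Pi.smul_apply', Function.comp_apply, herglotzRieszKernel_exp hr hr1]
  simp [torusMeasure]

theorem integral_poissonKer {r : ℝ} (hr : 0 ≤ r) (hr1 : r < 1) :
    ∫ t, poissonKer r t ∂torusMeasure = 2 * π := by
  have h := poisson_formula_circle (G := fun _ => (1 : ℂ)) diffContOnCl_const hr hr1 0
  have h2 : ∫ t, poissonKer r (0 - t) • (1 : ℂ) ∂torusMeasure =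
      ((∫ t, poissonKer r t ∂torusMeasure : ℝ) : ℂ) := by
    simp only [zero_sub, poissonKer_neg]
    rw [← integral_complex_ofReal]
    simp
  rw [h2, Complex.real_smul] at h
  have h3 : (1 : ℝ) = (2 * π)⁻¹ * ∫ t, poissonKer r t ∂torusMeasure := by exact_mod_cast h
  have := Real.pi_pos
  field_simp at h3
  linarith

/-- The function `z ↦ herglotzInt f (s z)` is analytic on a neighbourhood of the closed disc, so the
Poisson formula reproduces it from its values on the unit circle. The identity is its imaginary
part. -/
theorem conjPoisson_semigroup (hf : Function.Periodic f (2 * π)) (hi : Integrable f torusMeasure)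
    {r s : ℝ} (hr : 0 ≤ r) (hr1 : r < 1) (hs : 0 ≤ s) (hs1 : s < 1) (θ : ℝ) :
    conjPoisson (r * s) f θ = poissonInt r (conjPoisson s f) θ := by
  have hsr : r * s < 1 := by nlinarith
  have hG : DiffContOnCl ℂ (fun z => herglotzInt f (s * z)) (Metric.ball 0 1) := by
    refine DifferentiableOn.diffContOnCl ?_
    refine (differentiableOn_herglotzInt hf hi).comp (by fun_prop) ?_
    intro z hz
    rw [closure_ball _ one_ne_zero] at hz
    simp only [mem_closedBall_iff_norm, sub_zero] at hz
    simp only [Metric.mem_ball, dist_zero_right, norm_mul, Complex.norm_real, Real.norm_eq_abs,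
      abs_of_nonneg hs]
    nlinarith [norm_nonneg z]
  have h := poisson_formula_circle hG hr hr1 θ
  have e1 : (s : ℂ) * circleMap 0 r θ = circleMap 0 (r * s) θ := by
    simp [circleMap]; ring
  have e2 : ∀ t, (s : ℂ) * circleMap 0 1 t = circleMap 0 s t := by
    intro t; simp [circleMap]
  simp only [e1, e2, herglotzInt_circleMap hf hi (mul_nonneg hr hs) hsr,
    herglotzInt_circleMap hf hi hs hs1] at h
  have h2 := congrArg Complex.im h
  have hc : Continuous fun t => herglotzInt f (circleMap 0 s t) := by
    refine (differentiableOn_herglotzInt hf hi).continuousOn.comp_continuous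
      (by fun_prop) (fun t => ?_)
    simp [circleMap, abs_of_nonneg hs, hs1]
  simp only [herglotzInt_circleMap hf hi hs hs1] at hc
  have hint : Integrable (fun t => poissonKer r (θ - t) • ((poissonInt s f t : ℂ) +
      ((π⁻¹ * conjPoisson s f t : ℝ) : ℂ) * Complex.I)) torusMeasure :=
    (((continuous_poissonKer hr hr1).comp (by fun_prop)).smul hc).integrable_torus
  rw [Complex.smul_im, ← Complex.imCLM_apply (∫ t, _ ∂torusMeasure),
    ← Complex.imCLM.integral_comp_comm hint] at h2
  simp only [Complex.imCLM_apply, Complex.smul_im, Complex.add_im, Complex.ofReal_im, zero_add,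
    Complex.mul_im, Complex.ofReal_re, Complex.I_im, Complex.I_re, mul_one, mul_zero, add_zero,
    smul_eq_mul] at h2
  rw [poissonInt]
  have hpi := Real.pi_pos
  have e3 : ∀ t, poissonKer r (θ - t) * (π⁻¹ * conjPoisson s f t) =
      π⁻¹ * (conjPoisson s f t * poissonKer r (θ - t)) := fun t => by ring
  simp_rw [e3] at h2
  rw [integral_const_mul] at h2
  field_simp at h2 ⊢
  linarith

end Herglotz

/-! ### The theorem of M. Riesz on conjugate functions -/

section Riesz

variable {f : ℝ → ℝ}

/-- By homogeneity this is an inequality in the angle `φ = |arg w| < π/2`. Since `π/2 < pπ/2 ≤ π`,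
`cos (pφ)` is negative for `φ` near `π/2`, and the term with `B` dominates there. Away from `π/2`,
`cos φ` is bounded below and the term with `A` dominates. -/
theorem exists_abs_im_rpow_le {p : ℝ} (hp : 1 < p) (hp2 : p ≤ 2) :
    ∃ A B : ℝ, 0 ≤ A ∧ 0 ≤ B ∧ ∀ w : ℂ, 0 < w.re →
      |w.im| ^ p ≤ A * w.re ^ p - B * (w ^ (p : ℂ)).re := by
  have hpi := Real.pi_pos
  have hc : Real.cos (π / 2 * p) < 0 :=
    Real.cos_neg_of_pi_div_two_lt_of_lt (by nlinarith) (by nlinarith)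
  set c₀ := -Real.cos (π / 2 * p) with hc₀
  have hc0 : 0 < c₀ := by linarith
  have hcont : Continuous fun x : ℝ => Real.cos (x * p) := by fun_prop
  obtain ⟨δ', hδ', H⟩ := Metric.continuousAt_iff.1 (hcont.continuousAt (x := π / 2)) (c₀ / 2)
    (by positivity)
  set δ := min (δ' / 2) (π / 4) with hδ
  have hδ0 : 0 < δ := by positivity
  have hδ1 : δ ≤ π / 4 := min_le_right _ _
  have hδ2 : δ < δ' := lt_of_le_of_lt (min_le_left _ _) (by linarith)
  have hs : 0 < Real.sin δ := Real.sin_pos_of_pos_of_lt_pi hδ0 (by linarith)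
  -- Chosen so that the term with `B` contributes at least `1` wherever `cos (pφ) ≤ -c₀/2`.
  set B := 2 / c₀ with hB
  have hB0 : 0 ≤ B := by positivity
  refine ⟨(1 + B) / Real.sin δ ^ p, B, by positivity, hB0, fun w hw => ?_⟩
  have hw0 : w ≠ 0 := by rintro rfl; simp at hw
  have hφ : |w.arg| < π / 2 := Complex.abs_arg_lt_pi_div_two_iff.2 (Or.inl hw)
  have hn : 0 ≤ ‖w‖ := norm_nonneg w
  rw [Complex.cpow_ofReal_re]
  have him : |w.im| = ‖w‖ * |Real.sin w.arg| := by
    rw [Complex.sin_arg, abs_div, abs_of_pos (norm_pos_iff.2 hw0)]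
    field_simp
  have hre : w.re = ‖w‖ * Real.cos |w.arg| := by
    rw [Real.cos_abs, Complex.cos_arg hw0]
    field_simp
  have hcos : Real.cos (w.arg * p) = Real.cos (|w.arg| * p) := by
    rw [← Real.cos_abs, abs_mul, abs_of_pos (by linarith : 0 < p)]
  have hcφ : 0 < Real.cos |w.arg| := Real.cos_pos_of_mem_Ioo ⟨by linarith [abs_nonneg w.arg], hφ⟩
  rw [him, hre, hcos, Real.mul_rpow hn (abs_nonneg _), Real.mul_rpow hn hcφ.le]
  have hsp : |Real.sin w.arg| ^ p ≤ 1 :=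
    Real.rpow_le_one (abs_nonneg _) (Real.abs_sin_le_one _) (by linarith)
  suffices h : |Real.sin w.arg| ^ p ≤ (1 + B) / Real.sin δ ^ p * Real.cos |w.arg| ^ p -
      B * Real.cos (|w.arg| * p) by
    have := mul_le_mul_of_nonneg_left h (Real.rpow_nonneg hn p)
    linarith
  rcases le_or_gt |w.arg| (π / 2 - δ) with h1 | h1
  · have h2 : Real.sin δ ≤ Real.cos |w.arg| := by
      rw [← Real.cos_pi_div_two_sub]
      exact Real.cos_le_cos_of_nonneg_of_le_pi (abs_nonneg _) (by linarith) h1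
    have h3 : Real.sin δ ^ p ≤ Real.cos |w.arg| ^ p := Real.rpow_le_rpow hs.le h2 (by linarith)
    have h4 : 1 + B ≤ (1 + B) / Real.sin δ ^ p * Real.cos |w.arg| ^ p := by
      rw [div_mul_eq_mul_div, le_div_iff₀ (by positivity)]
      exact mul_le_mul_of_nonneg_left h3 (by positivity)
    nlinarith [Real.cos_le_one (|w.arg| * p)]
  · have h2 := H (x := |w.arg|) (by rw [Real.dist_eq, abs_lt]; constructor <;> linarith)
    rw [Real.dist_eq, abs_lt] at h2
    have h3 : Real.cos (|w.arg| * p) ≤ -(c₀ / 2) := by linarith [h2.2]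
    have h4 : B * Real.cos (|w.arg| * p) ≤ -1 := by
      calc B * Real.cos (|w.arg| * p) ≤ B * -(c₀ / 2) := mul_le_mul_of_nonneg_left h3 hB0
        _ = -1 := by rw [hB]; field_simp
    have h5 : 0 ≤ (1 + B) / Real.sin δ ^ p * Real.cos |w.arg| ^ p := by positivity
    linarith

theorem continuous_herglotzInt_circleMap (hf : Function.Periodic f (2 * π))
    (hi : Integrable f torusMeasure) {r : ℝ} (hr : 0 ≤ r) (hr1 : r < 1) :
    Continuous fun t => herglotzInt f (circleMap 0 r t) := by
  refine (differentiableOn_herglotzInt hf hi).continuousOn.comp_continuous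
    (by fun_prop) (fun t => ?_)
  simp [circleMap, abs_of_nonneg hr, hr1]

theorem continuous_conjPoisson (hf : Function.Periodic f (2 * π)) (hi : Integrable f torusMeasure)
    {r : ℝ} (hr : 0 ≤ r) (hr1 : r < 1) : Continuous (conjPoisson r f) := by
  have h := Complex.continuous_im.comp (continuous_herglotzInt_circleMap hf hi hr hr1)
  have e : conjPoisson r f = fun t => π * (herglotzInt f (circleMap 0 r t)).im := by
    funext t
    rw [herglotzInt_circleMap hf hi hr hr1]
    simp [Real.pi_ne_zero]
  rw [e]
  exact h.const_mul π

theorem continuous_poissonInt (hf : Function.Periodic f (2 * π)) (hi : Integrable f torusMeasure)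
    {r : ℝ} (hr : 0 ≤ r) (hr1 : r < 1) : Continuous (poissonInt r f) := by
  have h := Complex.continuous_re.comp (continuous_herglotzInt_circleMap hf hi hr hr1)
  have e : poissonInt r f = fun t => (herglotzInt f (circleMap 0 r t)).re := by
    funext t
    rw [herglotzInt_circleMap hf hi hr hr1]
    simp
  rw [e]
  exact h

theorem conjPoisson_periodic (r : ℝ) (f : ℝ → ℝ) :
    Function.Periodic (conjPoisson r f) (2 * π) := fun x => by
  simp only [conjPoisson]
  congr 1; funext t
  rw [← conjKer_periodic r (x - t)]; congr 2; ring

theorem lintegral_poissonInt_rpow_le {p : ℝ} (hp : 1 < p) (hm : Measurable f)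
    (hf : Function.Periodic f (2 * π)) {r : ℝ} (hr : 0 ≤ r) (hr1 : r < 1) :
    ∫⁻ x, ‖poissonInt r f x‖ₑ ^ p ∂torusMeasure ≤ ∫⁻ x, ‖f x‖ₑ ^ p ∂torusMeasure := by
  have hpi := Real.pi_pos
  have hcP := continuous_poissonKer hr hr1
  have hY := lintegral_rpow_convolution_le hp (w := fun x => ‖(2 * π)⁻¹ * poissonKer r x‖ₑ)
    (f := fun x => ‖f x‖ₑ) (by fun_prop) hm.enorm (fun x => by simp only [poissonKer_periodic r x])
    (fun x => by simp only [hf x])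
  have h1 : ∫⁻ x, ‖(2 * π)⁻¹ * poissonKer r x‖ₑ ∂torusMeasure = 1 := by
    have hnn : ∀ x, 0 ≤ (2 * π)⁻¹ * poissonKer r x := fun x =>
      mul_nonneg (by positivity) (poissonKer_nonneg hr hr1 x)
    simp_rw [Real.enorm_eq_ofReal (hnn _)]
    rw [← ofReal_integral_eq_lintegral_ofReal (hcP.const_mul _).integrable_torus
      (Eventually.of_forall hnn), integral_const_mul, integral_poissonKer hr hr1]
    rw [inv_mul_cancel₀ (by positivity)]; simp
  rw [h1, ENNReal.one_rpow, one_mul] at hY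
  refine le_trans (lintegral_mono fun x => ?_) hY
  refine ENNReal.rpow_le_rpow ?_ (by linarith)
  rw [poissonInt, ← integral_const_mul]
  refine (enorm_integral_le_lintegral_enorm _).trans (lintegral_mono fun t => ?_)
  rw [← enorm_mul]
  apply le_of_eq; congr 1; ring

theorem poissonInt_pos (hi : Integrable f torusMeasure)
    (h0 : ∀ x, 0 ≤ f x) (hne : ¬ f =ᵐ[torusMeasure] 0) {r : ℝ} (hr : 0 ≤ r) (hr1 : r < 1) (x : ℝ) :
    0 < poissonInt r f x := by
  have hpi := Real.pi_pos
  refine mul_pos (by positivity) ?_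
  rw [integral_pos_iff_support_of_nonneg
    (fun t => mul_nonneg (h0 t) (poissonKer_nonneg hr hr1 _))
    (integrable_mul_continuous_torus hi ((continuous_poissonKer hr hr1).comp (by fun_prop)))]
  have : (Function.support fun t => f t * poissonKer r (x - t)) = Function.support f := by
    ext t; simp [(poissonKer_pos hr hr1 (x - t)).ne']
  rw [this, pos_iff_ne_zero]
  intro h
  exact hne (by rw [Filter.EventuallyEq, ae_iff]; exact h)

/-- The Herglotz integral maps the disc to the right half-plane, so its `p`-th power is analytic
there. By the mean value property the integral is `2π` times the value at the centre, which is a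
power of a positive real number. -/
theorem integral_re_herglotzInt_cpow_nonneg (hf : Function.Periodic f (2 * π))
    (hi : Integrable f torusMeasure) (h0 : ∀ x, 0 ≤ f x) (hne : ¬ f =ᵐ[torusMeasure] 0) (p : ℝ)
    {r : ℝ} (hr : 0 ≤ r) (hr1 : r < 1) :
    0 ≤ ∫ t, (herglotzInt f (circleMap 0 r t) ^ (p : ℂ)).re ∂torusMeasure := by
  have hpos : ∀ z ∈ Metric.ball (0 : ℂ) 1, 0 < (herglotzInt f z).re := by
    intro z hz
    have hz' : ‖z‖ < 1 := by simpa using hz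
    have : z = circleMap 0 ‖z‖ z.arg := by simp [circleMap]
    rw [this, herglotzInt_circleMap hf hi (norm_nonneg z) hz']
    simpa using poissonInt_pos hi h0 hne (norm_nonneg z) hz' _
  have hmaps : MapsTo (fun z : ℂ => (r : ℂ) * z) (Metric.closedBall 0 1) (Metric.ball 0 1) := by
    intro z hz
    simp only [mem_closedBall_iff_norm, sub_zero] at hz
    simp only [Metric.mem_ball, dist_zero_right, norm_mul, Complex.norm_real, Real.norm_eq_abs,
      abs_of_nonneg hr]
    nlinarith [norm_nonneg z]
  have hG : DiffContOnCl ℂ (fun z => herglotzInt f (r * z) ^ (p : ℂ)) (Metric.ball 0 1) := by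
    refine DifferentiableOn.diffContOnCl ?_
    rw [closure_ball _ one_ne_zero]
    have hd : DifferentiableOn ℂ (fun z => herglotzInt f (r * z)) (Metric.closedBall 0 1) :=
      (differentiableOn_herglotzInt hf hi).comp (by fun_prop) hmaps
    exact hd.cpow_const fun z hz => Or.inl (hpos _ (hmaps hz))
  -- At radius `0` the Poisson kernel is `1`, so this is the mean value property.
  have h := poisson_formula_circle hG le_rfl zero_lt_one 0
  have e2 : ∀ t, (r : ℂ) * circleMap 0 1 t = circleMap 0 r t := by
    intro t; simp [circleMap]
  have e3 : ∀ x, poissonKer 0 x = 1 := fun x => by simp [poissonKer, poissonDenom]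
  simp only [e2, e3, one_smul] at h
  have hcont : Continuous fun t => herglotzInt f (circleMap 0 r t) ^ (p : ℂ) := by
    refine (continuous_herglotzInt_circleMap hf hi hr hr1).cpow continuous_const fun t => ?_
    exact Or.inl (hpos _ (by simp [circleMap, abs_of_nonneg hr, hr1]))
  have h2 := congrArg Complex.re h
  rw [Complex.smul_re, ← Complex.reCLM_apply (∫ t, _ ∂torusMeasure),
    ← Complex.reCLM.integral_comp_comm hcont.integrable_torus] at h2
  simp only [Complex.reCLM_apply, smul_eq_mul] at h2
  have hpi := Real.pi_pos
  have h3 : 0 ≤ ((herglotzInt f (↑r * circleMap 0 0 0)) ^ (p : ℂ)).re := by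
    have e4 : (r : ℂ) * circleMap 0 0 0 = circleMap 0 0 0 := by simp [circleMap]
    rw [e4, herglotzInt_circleMap hf hi le_rfl zero_lt_one]
    have e5 : conjPoisson 0 f 0 = 0 := by simp [conjPoisson, conjKer]
    have h6 := (poissonInt_pos hi h0 hne le_rfl zero_lt_one 0).le
    rw [e5, mul_zero, Complex.ofReal_zero, zero_mul, add_zero, ← Complex.ofReal_cpow h6,
      Complex.ofReal_re]
    positivity
  rw [h2] at h3
  exact nonneg_of_mul_nonneg_right h3 (by positivity)

/-- The pointwise inequality for `|Im w|^p` is integrated over the circle of radius `r`. The term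
with `B` has a favourable sign and is dropped, and the Poisson integral contracts the `L^p` norm. -/
theorem exists_lintegral_conjPoisson_le_of_nonneg {p : ℝ} (hp : 1 < p) (hp2 : p ≤ 2) :
    ∃ C : ℝ≥0, ∀ f : ℝ → ℝ, Measurable f → Function.Periodic f (2 * π) →
      Integrable f torusMeasure → (∀ x, 0 ≤ f x) → ∀ r : ℝ, 0 ≤ r → r < 1 →
      ∫⁻ x, ‖conjPoisson r f x‖ₑ ^ p ∂torusMeasure ≤ C * ∫⁻ x, ‖f x‖ₑ ^ p ∂torusMeasure := by
  obtain ⟨A, B, hA, hB, H⟩ := exists_abs_im_rpow_le hp hp2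
  have hp0 : 0 < p := by linarith
  have hpi := Real.pi_pos
  refine ⟨Real.toNNReal (π ^ p * A), fun f hm hf hi h0 r hr hr1 => ?_⟩
  -- Unless `f` vanishes almost everywhere, its Poisson integral is strictly positive, as the
  -- complex power requires.
  by_cases hne : f =ᵐ[torusMeasure] 0
  · have : ∀ x, conjPoisson r f x = 0 := fun x => by
      rw [conjPoisson]
      refine integral_eq_zero_of_ae ?_
      filter_upwards [hne] with t ht
      simp [ht]
    simp [this, hp0]
  have hU := continuous_poissonInt hf hi hr hr1
  have hV := continuous_conjPoisson hf hi hr hr1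
  have hU0 := poissonInt_pos hi h0 hne hr hr1
  have hpt : ∀ x, |conjPoisson r f x| ^ p ≤ π ^ p * A * poissonInt r f x ^ p -
      π ^ p * B * (herglotzInt f (circleMap 0 r x) ^ (p : ℂ)).re := by
    intro x
    have := H (herglotzInt f (circleMap 0 r x)) (by
      rw [herglotzInt_circleMap hf hi hr hr1]; simpa using hU0 x)
    have e1 : (herglotzInt f (circleMap 0 r x)).re = poissonInt r f x := by
      rw [herglotzInt_circleMap hf hi hr hr1]; simp
    have e2 : (herglotzInt f (circleMap 0 r x)).im = π⁻¹ * conjPoisson r f x := by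
      rw [herglotzInt_circleMap hf hi hr hr1]; simp
    rw [e1, e2, abs_mul, Real.mul_rpow (abs_nonneg _) (abs_nonneg _),
      abs_of_pos (inv_pos.2 hpi), Real.inv_rpow hpi.le] at this
    have h3 := mul_le_mul_of_nonneg_left this (Real.rpow_nonneg hpi.le p)
    have hne' : π ^ p ≠ 0 := (Real.rpow_pos_of_pos hpi p).ne'
    rw [← mul_assoc, mul_inv_cancel₀ hne', one_mul] at h3
    linarith
  have hcU : Continuous fun x => poissonInt r f x ^ p :=
    hU.rpow_const fun x => Or.inl (hU0 x).ne'
  have hcF : Continuous fun t => (herglotzInt f (circleMap 0 r t) ^ (p : ℂ)).re := by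
    refine Complex.continuous_re.comp
      ((continuous_herglotzInt_circleMap hf hi hr hr1).cpow continuous_const fun t => ?_)
    rw [herglotzInt_circleMap hf hi hr hr1]
    left; simpa using hU0 t
  have hcV : Continuous fun x => |conjPoisson r f x| ^ p :=
    hV.abs.rpow_const fun x => Or.inr hp0.le
  have h1 : ∫ x, |conjPoisson r f x| ^ p ∂torusMeasure ≤
      π ^ p * A * ∫ x, poissonInt r f x ^ p ∂torusMeasure := by
    have h2 := integral_mono hcV.integrable_torus
      ((hcU.const_mul (π ^ p * A)).fun_sub (hcF.const_mul (π ^ p * B))).integrable_torus hpt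
    rw [integral_sub (hcU.const_mul _).integrable_torus (hcF.const_mul _).integrable_torus,
      integral_const_mul, integral_const_mul] at h2
    have h3 := mul_nonneg (mul_nonneg (Real.rpow_nonneg hpi.le p) hB)
      (integral_re_herglotzInt_cpow_nonneg hf hi h0 hne p hr hr1)
    linarith
  have e1 : ∀ x, ‖conjPoisson r f x‖ₑ ^ p = ENNReal.ofReal (|conjPoisson r f x| ^ p) := fun x => by
    rw [Real.enorm_eq_ofReal_abs, ENNReal.ofReal_rpow_of_nonneg (abs_nonneg _) hp0.le]
  have e2 : ∀ x, ‖poissonInt r f x‖ₑ ^ p = ENNReal.ofReal (poissonInt r f x ^ p) := fun x => by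
    rw [Real.enorm_eq_ofReal (hU0 x).le, ENNReal.ofReal_rpow_of_nonneg (hU0 x).le hp0.le]
  calc ∫⁻ x, ‖conjPoisson r f x‖ₑ ^ p ∂torusMeasure
      = ENNReal.ofReal (∫ x, |conjPoisson r f x| ^ p ∂torusMeasure) := by
        simp_rw [e1]
        rw [ofReal_integral_eq_lintegral_ofReal hcV.integrable_torus
          (Eventually.of_forall fun x => Real.rpow_nonneg (abs_nonneg _) _)]
    _ ≤ ENNReal.ofReal (π ^ p * A * ∫ x, poissonInt r f x ^ p ∂torusMeasure) :=
        ENNReal.ofReal_le_ofReal h1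
    _ = ENNReal.ofReal (π ^ p * A) * ∫⁻ x, ‖poissonInt r f x‖ₑ ^ p ∂torusMeasure := by
        rw [ENNReal.ofReal_mul (by positivity)]
        simp_rw [e2]
        rw [ofReal_integral_eq_lintegral_ofReal hcU.integrable_torus
          (Eventually.of_forall fun x => Real.rpow_nonneg (hU0 x).le _)]
    _ ≤ _ := by
        rw [ENNReal.ofReal]
        exact mul_le_mul_right (lintegral_poissonInt_rpow_le hp hm hf hr hr1) _

theorem conjPoisson_sub {f g : ℝ → ℝ} (hf : Integrable f torusMeasure)
    (hg : Integrable g torusMeasure) {r : ℝ} (hr : 0 ≤ r) (hr1 : r < 1) (x : ℝ) :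
    conjPoisson r (fun t => f t - g t) x = conjPoisson r f x - conjPoisson r g x := by
  have hc : Continuous fun t => conjKer r (x - t) := (continuous_conjKer hr hr1).comp (by fun_prop)
  simp only [conjPoisson, sub_mul]
  exact integral_sub (integrable_mul_continuous_torus hf hc) (integrable_mul_continuous_torus hg hc)

theorem exists_lintegral_conjPoisson_le_of_le_two {p : ℝ} (hp : 1 < p) (hp2 : p ≤ 2) :
    ∃ C : ℝ≥0, ∀ f : ℝ → ℝ, Measurable f → Function.Periodic f (2 * π) →
      Integrable f torusMeasure → ∀ r : ℝ, 0 ≤ r → r < 1 →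
      ∫⁻ x, ‖conjPoisson r f x‖ₑ ^ p ∂torusMeasure ≤ C * ∫⁻ x, ‖f x‖ₑ ^ p ∂torusMeasure := by
  obtain ⟨C, hC⟩ := exists_lintegral_conjPoisson_le_of_nonneg hp hp2
  have hp0 : 0 < p := by linarith
  refine ⟨2 ^ (p - 1) * (C + C), fun f hm hf hi r hr hr1 => ?_⟩
  set f₁ : ℝ → ℝ := fun x => max (f x) 0
  set f₂ : ℝ → ℝ := fun x => max (-f x) 0
  have e : f = fun x => f₁ x - f₂ x := by
    funext x; simp only [f₁, f₂]
    rcases le_total (f x) 0 with h | h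
    · rw [max_eq_right h, max_eq_left (by linarith)]; ring
    · rw [max_eq_left h, max_eq_right (by linarith)]; ring
  have hi₁ : Integrable f₁ torusMeasure := hi.pos_part
  have hi₂ : Integrable f₂ torusMeasure := hi.neg_part
  have h1 := hC f₁ (hm.max measurable_const) (fun x => by simp [f₁, hf x]) hi₁
    (fun x => le_max_right _ _) r hr hr1
  have h2 := hC f₂ (hm.neg.max measurable_const) (fun x => by simp [f₂, hf x]) hi₂
    (fun x => le_max_right _ _) r hr hr1
  have b1 : ∀ x, ‖f₁ x‖ₑ ≤ ‖f x‖ₑ := fun x => enorm_le_iff_norm_le.2 (by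
    simp only [f₁, Real.norm_eq_abs]
    rw [abs_of_nonneg (le_max_right _ _)]
    exact max_le (le_abs_self _) (abs_nonneg _))
  have b2 : ∀ x, ‖f₂ x‖ₑ ≤ ‖f x‖ₑ := fun x => enorm_le_iff_norm_le.2 (by
    simp only [f₂, Real.norm_eq_abs]
    rw [abs_of_nonneg (le_max_right _ _)]
    exact max_le (neg_le_abs _) (abs_nonneg _))
  have hpt : ∀ x, ‖conjPoisson r f x‖ₑ ^ p ≤
      2 ^ (p - 1) * (‖conjPoisson r f₁ x‖ₑ ^ p + ‖conjPoisson r f₂ x‖ₑ ^ p) := by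
    intro x
    have : conjPoisson r f x = conjPoisson r f₁ x - conjPoisson r f₂ x := by
      conv_lhs => rw [e]
      exact conjPoisson_sub hi₁ hi₂ hr hr1 x
    rw [this]
    refine (ENNReal.rpow_le_rpow enorm_sub_le hp0.le).trans ?_
    exact ENNReal.rpow_add_le_mul_rpow_add_rpow _ _ hp.le
  have hm1 : Measurable fun x => ‖conjPoisson r f₁ x‖ₑ ^ p :=
    (continuous_conjPoisson (fun x => by simp [f₁, hf x]) hi₁ hr hr1).measurable.enorm.pow_const p
  calc ∫⁻ x, ‖conjPoisson r f x‖ₑ ^ p ∂torusMeasure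
      ≤ ∫⁻ x, 2 ^ (p - 1) * (‖conjPoisson r f₁ x‖ₑ ^ p + ‖conjPoisson r f₂ x‖ₑ ^ p)
          ∂torusMeasure := lintegral_mono hpt
    _ = 2 ^ (p - 1) * (∫⁻ x, ‖conjPoisson r f₁ x‖ₑ ^ p ∂torusMeasure +
          ∫⁻ x, ‖conjPoisson r f₂ x‖ₑ ^ p ∂torusMeasure) := by
        rw [lintegral_const_mul' _ _ (ENNReal.rpow_ne_top_of_nonneg (by linarith) (by simp)),
          lintegral_add_left hm1]
    _ ≤ 2 ^ (p - 1) * (C * ∫⁻ x, ‖f x‖ₑ ^ p ∂torusMeasure +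
          C * ∫⁻ x, ‖f x‖ₑ ^ p ∂torusMeasure) := by
        refine mul_le_mul_right (add_le_add (h1.trans ?_) (h2.trans ?_)) _
        · exact mul_le_mul_right (lintegral_mono fun x => ENNReal.rpow_le_rpow (b1 x) hp0.le) _
        · exact mul_le_mul_right (lintegral_mono fun x => ENNReal.rpow_le_rpow (b2 x) hp0.le) _
    _ = _ := by
        rw [← add_mul, ← mul_assoc]
        congr 1
        push_cast
        rw [ENNReal.coe_rpow_of_nonneg _ (by linarith)]
        simp

/-- The kernel is odd, so by Fubini's theorem the operator is minus its own transpose. This is what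
the duality argument for `p > 2` needs. -/
theorem integral_mul_conjPoisson {ψ : ℝ → ℝ}
    (hi : Integrable f torusMeasure) (hψ : Continuous ψ)
    {r : ℝ} (hr : 0 ≤ r) (hr1 : r < 1) :
    ∫ x, ψ x * conjPoisson r f x ∂torusMeasure =
      -∫ t, f t * conjPoisson r ψ t ∂torusMeasure := by
  have hint : Integrable (Function.uncurry fun x t => ψ x * (f t * conjKer r (x - t)))
      (torusMeasure.prod torusMeasure) := by
    have h1 : Integrable (fun z : ℝ × ℝ => ψ z.1 * f z.2) (torusMeasure.prod torusMeasure) :=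
      hψ.integrable_torus.mul_prod hi
    have h2 := h1.bdd_mul (c := 1 / (1 - r) ^ 2)
      (((continuous_conjKer hr hr1).comp (continuous_fst.sub continuous_snd)).aestronglyMeasurable)
      (Eventually.of_forall fun z : ℝ × ℝ => conjKer_le hr hr1 (z.1 - z.2))
    refine h2.congr (Eventually.of_forall fun z => ?_)
    simp only [Function.uncurry, Function.comp_apply, Pi.sub_apply]; ring
  simp only [conjPoisson, ← integral_const_mul]
  rw [integral_integral_swap hint, ← integral_neg]
  congr 1; funext t
  rw [← integral_neg]
  congr 1; funext x
  have : conjKer r (x - t) = - conjKer r (t - x) := by rw [← conjKer_neg, neg_sub]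
  rw [this]; ring

/-- **Theorem of M. Riesz**: conjugate Poisson integrals are bounded on `L^p`. -/
theorem exists_lintegral_conjPoisson_le {p : ℝ} (hp : 1 < p) :
    ∃ C : ℝ≥0, ∀ f : ℝ → ℝ, Measurable f → Function.Periodic f (2 * π) →
      Integrable f torusMeasure → ∀ r : ℝ, 0 ≤ r → r < 1 →
      ∫⁻ x, ‖conjPoisson r f x‖ₑ ^ p ∂torusMeasure ≤ C * ∫⁻ x, ‖f x‖ₑ ^ p ∂torusMeasure := by
  rcases le_or_gt p 2 with hp2 | hp2
  · exact exists_lintegral_conjPoisson_le_of_le_two hp hp2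
  have hp0 : 0 < p := by linarith
  set q := p.conjExponent with hq
  have hpq : p.HolderConjugate q := Real.HolderConjugate.conjExponent hp
  have hq1 : 1 < q := hpq.symm.lt
  have hq2 : q ≤ 2 := by
    rw [hq, Real.conjExponent, div_le_iff₀ (by linarith)]; linarith
  obtain ⟨C, hC⟩ := exists_lintegral_conjPoisson_le_of_le_two hq1 hq2
  refine ⟨C ^ (p / q), fun f hm hf hi r hr hr1 => ?_⟩
  set V := conjPoisson r f with hV
  have hVc : Continuous V := continuous_conjPoisson hf hi hr hr1
  -- The extremal function in duality: `ψ V = |V|^p` and `|ψ|^q = |V|^p`. The exponent `p - 2` is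
  -- positive here, so `ψ` is continuous.
  set ψ : ℝ → ℝ := fun x => V x * |V x| ^ (p - 2) with hψ
  have hψc : Continuous ψ := hVc.mul (hVc.abs.rpow_const fun x => Or.inr (by linarith))
  have hψp : Function.Periodic ψ (2 * π) := fun x => by
    simp only [hψ, hV, conjPoisson_periodic r f x]
  have habs : ∀ x, |ψ x| = |V x| ^ (p - 1) := by
    intro x
    rw [hψ]; simp only
    rw [abs_mul, abs_of_nonneg (Real.rpow_nonneg (abs_nonneg (V x)) _)]
    rcases (abs_nonneg (V x)).eq_or_lt with h | h
    · rw [← h, Real.zero_rpow (by linarith), Real.zero_rpow (by linarith)]; simp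
    · nth_rewrite 1 [← Real.rpow_one |V x|]
      rw [← Real.rpow_add h]; congr 1; ring
  have hψV : ∀ x, ψ x * V x = |V x| ^ p := by
    intro x
    rcases (abs_nonneg (V x)).eq_or_lt with h | h
    · rw [← h, Real.zero_rpow hp0.ne', abs_eq_zero.1 h.symm]; simp
    · rw [hψ]; simp only
      rw [mul_right_comm, ← abs_mul_abs_self (V x), ← sq, ← Real.rpow_natCast, ← Real.rpow_add h]
      congr 1; push_cast; ring
  have hψq : ∀ x, ‖ψ x‖ₑ ^ q = ‖V x‖ₑ ^ p := by
    intro x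
    rw [Real.enorm_eq_ofReal_abs, habs, Real.enorm_eq_ofReal_abs,
      ← ENNReal.ofReal_rpow_of_nonneg (abs_nonneg _) (by linarith), ← ENNReal.rpow_mul]
    congr 1
    exact hpq.sub_one_mul_conj
  set I := ∫⁻ x, ‖V x‖ₑ ^ p ∂torusMeasure with hI
  set N := ∫⁻ x, ‖f x‖ₑ ^ p ∂torusMeasure with hN
  have hcV : Continuous fun x => |V x| ^ p := hVc.abs.rpow_const fun x => Or.inr hp0.le
  have hI1 : I = ENNReal.ofReal (∫ x, ψ x * V x ∂torusMeasure) := by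
    simp_rw [hψV]
    rw [ofReal_integral_eq_lintegral_ofReal hcV.integrable_torus
      (Eventually.of_forall fun x => Real.rpow_nonneg (abs_nonneg _) _)]
    refine lintegral_congr fun x => ?_
    rw [Real.enorm_eq_ofReal_abs, ENNReal.ofReal_rpow_of_nonneg (abs_nonneg _) hp0.le]
  have hItop : I ≠ ⊤ := by rw [hI1]; exact ENNReal.ofReal_ne_top
  have hI2 : I ≤ N ^ (1 / p) * (C * I) ^ (1 / q) := by
    conv_lhs => rw [hI1]
    rw [hV, integral_mul_conjPoisson hi hψc hr hr1, ← integral_neg]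
    refine (ENNReal.ofReal_le_ofReal (le_abs_self _)).trans ?_
    rw [← Real.enorm_eq_ofReal_abs]
    refine (enorm_integral_le_lintegral_enorm _).trans ?_
    simp_rw [enorm_neg, enorm_mul]
    have hψm := (continuous_conjPoisson hψp hψc.integrable_torus hr hr1).measurable
    refine (ENNReal.lintegral_mul_le_Lp_mul_Lq torusMeasure hpq hm.enorm.aemeasurable
      hψm.enorm.aemeasurable).trans ?_
    refine mul_le_mul_right (ENNReal.rpow_le_rpow ?_ (by have := hpq.symm.pos; positivity)) _
    refine (hC ψ hψc.measurable hψp hψc.integrable_torus r hr hr1).trans ?_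
    simp_rw [hψq]
    exact le_rfl
  -- The factor `I^{1/q}` is to be cancelled, so `I` must be neither zero nor infinite. It is finite
  -- because `V` is continuous.
  rcases eq_or_ne I 0 with h0 | h0
  · rw [h0]; exact zero_le
  have hq0 : 0 < q := hpq.symm.pos
  have hI3 : I ^ (1 / p) ≤ N ^ (1 / p) * C ^ (1 / q) := by
    rw [ENNReal.mul_rpow_of_nonneg _ _ (by positivity), ← mul_assoc] at hI2
    have hIq0 : I ^ (1 / q) ≠ 0 := (ENNReal.rpow_pos (pos_iff_ne_zero.2 h0) hItop).ne'
    have hIqt : I ^ (1 / q) ≠ ⊤ := ENNReal.rpow_ne_top_of_nonneg (by positivity) hItop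
    have e : I = I ^ (1 / p) * I ^ (1 / q) := by
      rw [← ENNReal.rpow_add _ _ h0 hItop]
      have := hpq.inv_add_inv_eq_one
      rw [one_div, one_div, this, ENNReal.rpow_one]
    nth_rewrite 1 [e] at hI2
    exact (ENNReal.mul_le_mul_iff_left hIq0 hIqt).1 hI2
  have h4 := ENNReal.rpow_le_rpow hI3 hp0.le
  rw [← ENNReal.rpow_mul, one_div_mul_cancel hp0.ne', ENNReal.rpow_one,
    ENNReal.mul_rpow_of_nonneg _ _ hp0.le, ← ENNReal.rpow_mul, one_div_mul_cancel hp0.ne',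
    ENNReal.rpow_one, ← ENNReal.rpow_mul] at h4
  refine h4.trans (le_of_eq ?_)
  rw [mul_comm, ENNReal.coe_rpow_of_nonneg _ (by positivity)]
  congr 2
  ring

end Riesz

/-! ### Limits of indefinite integrals with densities bounded in `L^p` -/

section LimitPrimitive

/-- Hölder's inequality on a union of disjoint intervals. The resulting modulus of absolute
continuity depends only on the `L^p` norm of the density, so it survives pointwise limits. -/
theorem IsPrimitive.sum_enorm_sub_le {p q : ℝ} (hpq : p.HolderConjugate q) {F V : ℝ → ℝ}
    (H : IsPrimitive F V) (hm : Measurable V) {n : ℕ} {I : ℕ → ℝ × ℝ}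
    (hI : (n, I) ∈ AbsolutelyContinuousOnInterval.disjWithin 0 (2 * π)) :
    ∑ i ∈ Finset.range n, ‖F (I i).2 - F (I i).1‖ₑ ≤
      (∫⁻ x, ‖V x‖ₑ ^ p ∂torusMeasure) ^ (1 / p) *
        (ENNReal.ofReal (∑ i ∈ Finset.range n, dist (I i).1 (I i).2)) ^ (1 / q) := by
  set S := ⋃ i ∈ Finset.range n, uIoc (I i).1 (I i).2 with hS
  have hSm : MeasurableSet S := Finset.measurableSet_biUnion _ fun i _ => measurableSet_uIoc
  have hsub : S ⊆ Ioc 0 (2 * π) := by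
    have := AbsolutelyContinuousOnInterval.biUnion_uIoc_subset_of_mem_disjWithin hI
    rwa [uIoc_of_le Real.two_pi_pos.le] at this
  have h1 : ∑ i ∈ Finset.range n, ‖F (I i).2 - F (I i).1‖ₑ ≤ ∫⁻ x in S, ‖V x‖ₑ := by
    rw [hS, lintegral_biUnion_finset (hI.2) (fun i _ => measurableSet_uIoc)]
    refine Finset.sum_le_sum fun i _ => ?_
    rw [H.sub_eq, ← ofReal_norm, intervalIntegral.norm_integral_eq_norm_integral_uIoc, ofReal_norm]
    exact enorm_integral_le_lintegral_enorm _
  refine h1.trans ?_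
  have h2 := ENNReal.lintegral_mul_le_Lp_mul_Lq (volume.restrict S) hpq hm.enorm.aemeasurable
    (g := fun _ => 1) aemeasurable_const
  simp only [Pi.mul_apply, mul_one, ENNReal.one_rpow, lintegral_const, one_mul,
    Measure.restrict_apply_univ] at h2
  refine h2.trans (mul_le_mul' (ENNReal.rpow_le_rpow ?_ hpq.one_div_nonneg)
    (ENNReal.rpow_le_rpow ?_ hpq.symm.one_div_nonneg))
  · exact lintegral_mono_set hsub
  · refine (measure_biUnion_finset_le _ _).trans (le_of_eq ?_)
    rw [ENNReal.ofReal_sum_of_nonneg fun i _ => dist_nonneg]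
    refine Finset.sum_congr rfl fun i _ => ?_
    rw [uIoc, Real.volume_Ioc, Real.dist_eq, max_sub_min_eq_abs']

/-- A substitute for weak compactness in `L^p`. The uniform modulus makes the limit absolutely
continuous, and its density is its derivative. The `L^p` bound follows from Fatou's lemma, applied
first to increments along the sequence and then to difference quotients. -/
theorem exists_isPrimitive_of_tendsto {p : ℝ} (hp : 1 < p) {F V : ℕ → ℝ → ℝ} {G : ℝ → ℝ}
    (H : ∀ k, IsPrimitive (F k) (V k)) (hm : ∀ k, Measurable (V k))
    (hV : ∀ k, Function.Periodic (V k) (2 * π)) (hG : Function.Periodic G (2 * π))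
    {K : ℝ≥0∞} (hK : K ≠ ⊤) (hb : ∀ k, ∫⁻ x, ‖V k x‖ₑ ^ p ∂torusMeasure ≤ K)
    (hlim : ∀ x, Tendsto (fun k => F k x) atTop (𝓝 (G x))) :
    ∃ h : ℝ → ℝ, Measurable h ∧ Function.Periodic h (2 * π) ∧ IsPrimitive G h ∧
      ∫⁻ x, ‖h x‖ₑ ^ p ∂torusMeasure ≤ K := by
  have hp0 : 0 < p := by linarith
  set q := p.conjExponent with hq
  have hpq : p.HolderConjugate q := Real.HolderConjugate.conjExponent hp
  have hac : AbsolutelyContinuousOnInterval G 0 (2 * π) := by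
    rw [absolutelyContinuousOnInterval_iff]
    intro ε hε
    have hKp : K ^ (1 / p) ≠ ⊤ := ENNReal.rpow_ne_top_of_nonneg (by positivity) hK
    set k := (K ^ (1 / p)).toReal with hk
    have hk0 : 0 ≤ k := ENNReal.toReal_nonneg
    have hq0 := hpq.symm.pos
    -- With `δ` this number, Hölder's bound `k δ^{1/q}` is at most `ε / 2`. The spare half keeps the
    -- inequality strict after passage to the limit.
    refine ⟨(ε / (2 * (k + 1))) ^ q, by positivity, fun ⟨n, I⟩ hI hlt => ?_⟩
    have h1 : ∀ j, ∑ i ∈ Finset.range n, dist (F j (I i).1) (F j (I i).2) ≤ ε / 2 := by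
      intro j
      have h2 := (H j).sum_enorm_sub_le hpq (hm j) hI
      have h3 : ∑ i ∈ Finset.range n, ‖F j (I i).2 - F j (I i).1‖ₑ =
          ENNReal.ofReal (∑ i ∈ Finset.range n, dist (F j (I i).1) (F j (I i).2)) := by
        rw [ENNReal.ofReal_sum_of_nonneg fun i _ => dist_nonneg]
        refine Finset.sum_congr rfl fun i _ => ?_
        rw [dist_comm, dist_eq_norm, ofReal_norm]
      rw [h3] at h2
      have h4 : (∫⁻ x, ‖V j x‖ₑ ^ p ∂torusMeasure) ^ (1 / p) ≤ ENNReal.ofReal k := by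
        rw [hk, ENNReal.ofReal_toReal hKp]
        exact ENNReal.rpow_le_rpow (hb j) (by positivity)
      have h5 : ENNReal.ofReal (∑ i ∈ Finset.range n, dist (I i).1 (I i).2) ^ (1 / q) ≤
          ENNReal.ofReal (ε / (2 * (k + 1))) := by
        refine (ENNReal.rpow_le_rpow (ENNReal.ofReal_le_ofReal hlt.le) (by positivity)).trans ?_
        rw [ENNReal.ofReal_rpow_of_nonneg (by positivity) (by positivity), ← Real.rpow_mul
          (by positivity), mul_one_div_cancel hq0.ne', Real.rpow_one]
      have h6 := h2.trans (mul_le_mul' h4 h5)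
      rw [← ENNReal.ofReal_mul hk0, ENNReal.ofReal_le_ofReal_iff (by positivity)] at h6
      refine h6.trans ?_
      rw [mul_div_assoc', div_le_div_iff₀ (by positivity) (by positivity)]
      nlinarith
    have h2 : Tendsto (fun j => ∑ i ∈ Finset.range n, dist (F j (I i).1) (F j (I i).2)) atTop
        (𝓝 (∑ i ∈ Finset.range n, dist (G (I i).1) (G (I i).2))) :=
      tendsto_finsetSum _ fun i _ => (hlim _).dist (hlim _)
    exact (le_of_tendsto' h2 h1).trans_lt (by linarith)
  set h := deriv G with hh
  have hhp : Function.Periodic h (2 * π) := by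
    intro x
    have : G = fun y => G (y + 2 * π) := funext fun y => (hG y).symm
    rw [hh]
    conv_rhs => rw [this]
    rw [deriv_comp_add_const]
  have hint : ∀ a b, IntervalIntegrable h volume a b := fun a b =>
    hhp.intervalIntegrable₀ Real.two_pi_pos.ne' hac.intervalIntegrable_deriv a b
  have hint' := (integrable_torus_iff_intervalIntegrable hhp).2 hint
  have hFTC : ∀ x ∈ Icc (0 : ℝ) (2 * π), G x = G 0 + ∫ t in (0 : ℝ)..x, h t := by
    intro x hx
    have := (hac.mono (c := 0) (d := x) (by
      rw [uIcc_of_le Real.two_pi_pos.le, uIcc_of_le hx.1]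
      exact Icc_subset_Icc_right hx.2)).integral_deriv_eq_sub
    rw [this]; ring
  have hprim : IsPrimitive G h := by
    refine ⟨hint, fun x => ?_⟩
    have hp2 : Function.Periodic (fun x => G x - (G 0 + ∫ t in (0 : ℝ)..x, h t)) (2 * π) := by
      intro x
      have e1 : ∫ t in (0 : ℝ)..x + 2 * π, h t = ∫ t in (0 : ℝ)..x, h t := by
        rw [← intervalIntegral.integral_add_adjacent_intervals (hint 0 x) (hint x _),
          ← integral_torus_eq_interval hhp x, integral_torus_eq_interval hhp 0, zero_add]
        have := hFTC (2 * π) ⟨Real.two_pi_pos.le, le_rfl⟩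
        have e := hG 0
        rw [zero_add] at e
        linarith
      change G (x + 2 * π) - (G 0 + ∫ t in (0 : ℝ)..x + 2 * π, h t) = _
      rw [e1, hG x]
    obtain ⟨y, hy, hxy⟩ := hp2.exists_mem_Ico₀ Real.two_pi_pos x
    have := hFTC y ⟨hy.1, hy.2.le⟩
    linarith
  have hcG : Continuous G := hprim.continuous
  refine ⟨h, measurable_deriv G, hhp, hprim, ?_⟩
  -- The `L^p` bound on increments at step `t` is stable under pointwise convergence, by Fatou's
  -- lemma.
  have hstep : ∀ t : ℝ, ∫⁻ x, ‖G (x + t) - G x‖ₑ ^ p ∂torusMeasure ≤ ‖t‖ₑ ^ p * K := by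
    intro t
    have hl : ∀ x, ‖G (x + t) - G x‖ₑ ^ p =
        liminf (fun k => ‖F k (x + t) - F k x‖ₑ ^ p) atTop := by
      intro x
      refine (Tendsto.liminf_eq ?_).symm
      exact (((hlim (x + t)).sub (hlim x)).enorm).ennrpow_const p
    simp_rw [hl]
    refine (lintegral_liminf_le fun k => ?_).trans ?_
    · have := (H k).continuous
      exact Measurable.pow_const (by fun_prop) p
    · refine liminf_le_of_le (by isBoundedDefault) fun b hb' => ?_
      obtain ⟨k, hk⟩ := hb'.exists
      refine hk.trans (((H k).lintegral_enorm_sub_rpow_le hp (hm k) (hV k) t).trans ?_)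
      exact mul_le_mul_right (hb k) _
  have hseq : ∀ᵐ x ∂torusMeasure, Tendsto
      (fun n : ℕ => ‖((n : ℝ) + 1) * (G (x + 1 / ((n : ℝ) + 1)) - G x)‖ₑ ^ p) atTop
        (𝓝 (‖h x‖ₑ ^ p)) := by
    refine ae_torus_of_ae ?_
    filter_upwards [hprim.ae_hasDerivAt] with x hx
    have h1 := hx.tendsto_slope_zero
    have h2 : Tendsto (fun n : ℕ => 1 / ((n : ℝ) + 1)) atTop (𝓝[≠] 0) := by
      refine tendsto_nhdsWithin_iff.2 ⟨tendsto_one_div_add_atTop_nhds_zero_nat, ?_⟩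
      filter_upwards with n
      simp only [mem_compl_iff, mem_singleton_iff]
      positivity
    have h3 := h1.comp h2
    refine Tendsto.ennrpow_const p (Tendsto.enorm ?_)
    refine h3.congr fun n => ?_
    simp
  -- Second use of Fatou's lemma, now for the difference quotients with steps `1 / (n + 1)`.
  have hl : ∫⁻ x, ‖h x‖ₑ ^ p ∂torusMeasure = ∫⁻ x, liminf (fun n : ℕ =>
      ‖((n : ℝ) + 1) * (G (x + 1 / ((n : ℝ) + 1)) - G x)‖ₑ ^ p) atTop ∂torusMeasure := by
    refine lintegral_congr_ae ?_
    filter_upwards [hseq] with x hx using hx.liminf_eq.symm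
  rw [hl]
  refine (lintegral_liminf_le fun n => ?_).trans ?_
  · exact Measurable.pow_const (by fun_prop) p
  · refine liminf_le_of_le (by isBoundedDefault) fun b hb' => ?_
    obtain ⟨n, hn⟩ := hb'.exists
    refine hn.trans ?_
    simp_rw [enorm_mul, ENNReal.mul_rpow_of_nonneg _ _ hp0.le]
    rw [lintegral_const_mul' _ _ (ENNReal.rpow_ne_top_of_nonneg hp0.le (by simp))]
    refine (mul_le_mul_right (hstep _) _).trans (le_of_eq ?_)
    rw [← mul_assoc, ← ENNReal.mul_rpow_of_nonneg _ _ hp0.le, ← enorm_mul,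
      mul_one_div_cancel (by positivity)]
    simp

end LimitPrimitive

/-! ### Logarithmic potentials on the circle -/

section LogPotential

/-- From below, `log (1/s) ≤ s^{-β} / β`. From above, `log s ≤ |log L|`, and `(L/s)^β ≥ 1` supplies
the power. -/
theorem abs_log_le_rpow_neg {β L s : ℝ} (hβ : 0 < β) (hs : 0 < s) (hsL : s ≤ L) :
    |Real.log s| ≤ (|Real.log L| * L ^ β + 1 / β) * s ^ (-β) := by
  have hL : 0 < L := hs.trans_le hsL
  have h0 : 0 < s ^ (-β) := Real.rpow_pos_of_pos hs _
  have h1 : 1 ≤ L ^ β * s ^ (-β) := by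
    rw [Real.rpow_neg hs.le, ← div_eq_mul_inv, one_le_div (Real.rpow_pos_of_pos hs _)]
    exact Real.rpow_le_rpow hs.le hsL hβ.le
  rw [abs_le]
  constructor
  · have h2 := Real.log_le_rpow_div (inv_nonneg.2 hs.le) hβ
    rw [Real.log_inv, Real.inv_rpow hs.le, ← Real.rpow_neg hs.le] at h2
    have h3 : 0 ≤ |Real.log L| * L ^ β * s ^ (-β) := by positivity
    have h4 : 1 / β * s ^ (-β) = s ^ (-β) / β := by ring
    linarith
  · have h2 : Real.log s ≤ |Real.log L| := (Real.log_le_log hs hsL).trans (le_abs_self _)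
    have h3 : |Real.log L| ≤ |Real.log L| * (L ^ β * s ^ (-β)) :=
      le_mul_of_one_le_right (abs_nonneg _) h1
    have h4 : 0 ≤ 1 / β * s ^ (-β) := by positivity
    linarith

theorem torDist_le_abs_sin (x : ℝ) : torDist x ≤ π * |Real.sin (x / 2)| := by
  refine periodic_induction (P := fun x => torDist x ≤ π * |Real.sin (x / 2)|) (fun x => ?_)
    (fun x hx => ?_) x
  · rw [torDist_periodic x, show (x + 2 * π) / 2 = x / 2 + π by ring, Real.sin_add_pi, abs_neg]
  · rw [torDist_eq_abs hx]
    have h1 : |x / 2| ≤ π / 2 := by rw [abs_div, abs_two]; linarith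
    have h2 := Real.mul_abs_le_abs_sin h1
    rw [abs_div, abs_two] at h2
    have := Real.pi_pos
    field_simp at h2
    linarith

theorem torDist_pos_of_ne {x y : ℝ} (h : (x : AddCircle (2 * π)) ≠ y) : 0 < torDist (x - y) := by
  rw [torDist, norm_pos_iff]
  intro h0
  exact h (sub_eq_zero.1 (by rw [← h0]; simp))

theorem ae_torDist_pos (x : ℝ) : ∀ᵐ t ∂torusMeasure, 0 < torDist (x - t) := by
  have hc : {t : ℝ | ¬ 0 < torDist (x - t)} ⊆ range fun n : ℤ => x - n * (2 * π) := by
    intro t ht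
    have h0 : torDist (x - t) = 0 := le_antisymm (not_lt.1 ht) (torDist_nonneg _)
    rw [torDist, norm_eq_zero, AddCircle.coe_eq_zero_iff] at h0
    obtain ⟨n, hn⟩ := h0
    exact ⟨n, by simp only [zsmul_eq_mul] at hn; simp only; linarith⟩
  refine ae_torus_of_ae (ae_iff.2 (measure_mono_null hc ?_))
  exact (countable_range _).measure_zero _

/-- `log |1 - r e^{ix}|`. -/
noncomputable def logKer (r x : ℝ) : ℝ := Real.log (poissonDenom r x) / 2

theorem logKer_periodic (r : ℝ) : Function.Periodic (logKer r) (2 * π) := fun x => by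
  simp [logKer, poissonDenom_periodic r x]

theorem hasDerivAt_logKer {r : ℝ} {x : ℝ} (h : 0 < poissonDenom r x) :
    HasDerivAt (logKer r) (conjKer r x) x := by
  have h1 : HasDerivAt (poissonDenom r) (2 * r * Real.sin x) x := by
    have := (((Real.hasDerivAt_cos x).const_mul (2 * r)).const_sub 1).add_const (r ^ 2)
    exact this.congr_deriv (by ring)
  have h2 := (h1.log h.ne').div_const 2
  exact h2.congr_deriv (by unfold conjKer; field_simp)

theorem continuous_logKer {r : ℝ} (hr : 0 ≤ r) (hr1 : r < 1) : Continuous (logKer r) :=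
  ((continuous_poissonDenom r).log fun x => (poissonDenom_pos hr hr1 x).ne').div_const 2

theorem measurable_logKer (r : ℝ) : Measurable (logKer r) :=
  ((continuous_poissonDenom r).measurable.log).div_const 2

theorem poissonDenom_eq (r x : ℝ) :
    poissonDenom r x = (1 - r) ^ 2 + 4 * r * Real.sin (x / 2) ^ 2 := by
  have : Real.cos x = 1 - 2 * Real.sin (x / 2) ^ 2 := by
    have h := Real.cos_two_mul (x / 2)
    rw [mul_div_cancel₀ _ two_ne_zero] at h
    rw [h, Real.cos_sq']; ring
  rw [poissonDenom, this]; ring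

/-- The denominator equals `(1 - r)² + 4 r sin² (x/2)`, so for `r ≥ 1/2` it has a lower bound
independent of `r`. This gives a common majorant as `r → 1`. -/
theorem poissonDenom_ge_torDist {r : ℝ} (hr : 1 / 2 ≤ r) (x : ℝ) :
    2 * (torDist x / π) ^ 2 ≤ poissonDenom r x := by
  rw [poissonDenom_eq]
  have hpi := Real.pi_pos
  have h1 : torDist x / π ≤ |Real.sin (x / 2)| := by
    rw [div_le_iff₀ hpi, mul_comm]; exact torDist_le_abs_sin x
  have h2 : (torDist x / π) ^ 2 ≤ Real.sin (x / 2) ^ 2 := by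
    rw [← sq_abs (Real.sin (x / 2))]
    exact pow_le_pow_left₀ (div_nonneg (torDist_nonneg x) hpi.le) h1 2
  nlinarith [sq_nonneg (1 - r), sq_nonneg (Real.sin (x / 2))]

theorem abs_logKer_le {β : ℝ} (hβ : 0 < β) {r x : ℝ} (hr : 1 / 2 ≤ r) (hr1 : r ≤ 1)
    (hx : 0 < torDist x) :
    |logKer r x| ≤ (1 + 1 / β) * π ^ β * torDist x ^ (-β) := by
  have hpi := Real.pi_pos
  set s := torDist x / π with hs
  have hs0 : 0 < s := by positivity
  have hs1 : s ≤ 1 := (div_le_one hpi).2 (torDist_le_pi x)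
  have hD := poissonDenom_ge_torDist hr x
  have hD2 : poissonDenom r x ≤ 4 := by
    unfold poissonDenom; nlinarith [Real.neg_one_le_cos x]
  have hD0 : 0 < poissonDenom r x := lt_of_lt_of_le (by positivity) hD
  have h1 := abs_log_le_rpow_neg hβ hs0 hs1
  rw [Real.log_one, abs_zero, zero_mul, zero_add] at h1
  have h2 : (1 : ℝ) ≤ s ^ (-β) := Real.one_le_rpow_of_pos_of_le_one_of_nonpos hs0 hs1 (by linarith)
  have e : π ^ β * torDist x ^ (-β) = s ^ (-β) := by
    rw [hs, Real.div_rpow (torDist_nonneg x) hpi.le, Real.rpow_neg hpi.le, div_inv_eq_mul, mul_comm]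
  rw [mul_assoc, e]
  have h3 : Real.log (poissonDenom r x) ≤ 2 * Real.log 2 := by
    rw [← Real.log_rpow (by norm_num)]
    exact Real.log_le_log hD0 (hD2.trans (by norm_num))
  have h4 : Real.log 2 + 2 * Real.log s ≤ Real.log (poissonDenom r x) := by
    rw [← Real.log_rpow hs0, ← Real.log_mul (by norm_num) (by positivity)]
    exact Real.log_le_log (by positivity) (by simpa using hD)
  have h5 : Real.log 2 ≤ 1 := by
    have := Real.log_two_lt_d9; linarith
  have h6 : 0 < Real.log 2 := Real.log_pos (by norm_num)
  rw [abs_le] at h1 ⊢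
  rw [logKer]
  constructor <;> nlinarith [h1.1, h1.2]

variable {f : ℝ → ℝ} {p : ℝ}

theorem integrable_of_lintegral_rpow_lt_top {E : Type*} [NormedAddCommGroup E] {f : ℝ → E}
    {p : ℝ} (hp : 1 ≤ p) (hm : AEStronglyMeasurable f torusMeasure)
    (hf : ∫⁻ x, ‖f x‖ₑ ^ p ∂torusMeasure < ⊤) : Integrable f torusMeasure := by
  have h0 : 0 < p := by linarith
  have : MemLp f (ENNReal.ofReal p) torusMeasure := by
    refine ⟨hm, ?_⟩
    rw [eLpNorm_lt_top_iff_lintegral_rpow_enorm_lt_top (by simpa using h0) ENNReal.ofReal_ne_top,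
      ENNReal.toReal_ofReal h0.le]
    exact hf
  exact this.integrable (by simpa using hp)

/-- Hölder's inequality against a power of the distance. -/
theorem exists_lintegral_mul_torDist_le {p : ℝ} (hp : 1 < p) :
    ∃ β : ℝ, 0 < β ∧ β < 1 ∧ ∃ K : ℝ≥0, ∀ f : ℝ → ℝ≥0∞, Measurable f → ∀ x : ℝ,
      ∫⁻ t, f t * ENNReal.ofReal (torDist (x - t) ^ (-β)) ∂torusMeasure ≤
        (∫⁻ t, f t ^ p ∂torusMeasure) ^ (1 / p) * K := by
  set q := p.conjExponent with hq
  have hpq : p.HolderConjugate q := Real.HolderConjugate.conjExponent hp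
  have hq0 := hpq.symm.pos
  have hq1 := hpq.symm.lt
  have hfin := lintegral_torDist_rpow_lt_top (β := -(1 / 2)) (by norm_num)
  set W := ∫⁻ x, ENNReal.ofReal (torDist x ^ (-(1 / 2 : ℝ))) ∂torusMeasure with hW
  -- With this exponent `β q = 1/2 < 1`, so the weight lies in `L^q`.
  refine ⟨1 / (2 * q), by positivity, ?_, (W ^ (1 / q)).toNNReal, fun f hf x => ?_⟩
  · rw [div_lt_one (by positivity)]; linarith
  have hmt : Measurable fun t => ENNReal.ofReal (torDist (x - t) ^ (-(1 / (2 * q)))) :=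
    ((continuous_torDist.measurable.comp (measurable_const.sub measurable_id)).pow_const
      _).ennreal_ofReal
  refine (ENNReal.lintegral_mul_le_Lp_mul_Lq torusMeasure hpq hf.aemeasurable
    hmt.aemeasurable).trans (mul_le_mul_right ?_ _)
  rw [ENNReal.coe_toNNReal (ENNReal.rpow_ne_top_of_nonneg (by positivity) hfin.ne), hW]
  refine ENNReal.rpow_le_rpow ?_ (by positivity)
  rw [← lintegral_torus_sub_left (F := fun t => ENNReal.ofReal (torDist t ^ (-(1 / 2 : ℝ))))
    (fun t => by simp only [torDist_periodic t]) x]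
  refine lintegral_mono fun t => ?_
  simp only
  rw [ENNReal.ofReal_rpow_of_nonneg (Real.rpow_nonneg (torDist_nonneg _) _) hq0.le,
    ← Real.rpow_mul (torDist_nonneg _)]
  apply le_of_eq; congr 2
  field_simp

/-- The logarithmic potential of `f` on the circle of radius `r`. -/
noncomputable def logPotential (r : ℝ) (f : ℝ → ℝ) (x : ℝ) : ℝ :=
  ∫ t, f t * logKer r (x - t) ∂torusMeasure

theorem logPotential_periodic (r : ℝ) (f : ℝ → ℝ) :
    Function.Periodic (logPotential r f) (2 * π) := fun x => by
  simp only [logPotential]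
  congr 1; funext t
  rw [← logKer_periodic r (x - t)]; congr 2; ring

theorem isPrimitive_logPotential (hf : Function.Periodic f (2 * π))
    (hi : Integrable f torusMeasure) {r : ℝ} (hr : 0 ≤ r) (hr1 : r < 1) :
    IsPrimitive (logPotential r f) (conjPoisson r f) := by
  refine isPrimitive_of_hasDerivAt (fun x => ?_) (continuous_conjPoisson hf hi hr hr1)
  have hcl : ∀ y, Continuous fun t => logKer r (y - t) := fun y =>
    (continuous_logKer hr hr1).comp (by fun_prop)
  have hck : ∀ y, Continuous fun t => conjKer r (y - t) := fun y =>
    (continuous_conjKer hr hr1).comp (by fun_prop)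
  refine (hasDerivAt_integral_of_dominated_loc_of_deriv_le
    (F := fun y t => f t * logKer r (y - t)) (F' := fun y t => f t * conjKer r (y - t))
    (bound := fun t => ‖f t‖ * (1 / (1 - r) ^ 2)) (s := univ) univ_mem
    (Eventually.of_forall fun y => (integrable_mul_continuous_torus hi (hcl y)).aestronglyMeasurable)
    (integrable_mul_continuous_torus hi (hcl x))
    (integrable_mul_continuous_torus hi (hck x)).aestronglyMeasurable
    (Eventually.of_forall fun t y _ => ?_) (hi.norm.mul_const _)
    (Eventually.of_forall fun t y _ => ?_)).2
  · rw [norm_mul]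
    exact mul_le_mul_of_nonneg_left (conjKer_le hr hr1 _) (norm_nonneg _)
  · have h1 := hasDerivAt_logKer (poissonDenom_pos hr hr1 (y - t))
    have h2 := h1.comp y ((hasDerivAt_id y).sub_const t)
    simpa using h2.const_mul (f t)

/-- Radii increasing to `1`. -/
noncomputable def radii (n : ℕ) : ℝ := 1 - 1 / ((n : ℝ) + 2)

theorem radii_ge (n : ℕ) : 1 / 2 ≤ radii n := by
  unfold radii
  have : 1 / ((n : ℝ) + 2) ≤ 1 / 2 := by
    apply one_div_le_one_div_of_le <;> linarith [n.cast_nonneg (α := ℝ)]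
  linarith

theorem radii_lt (n : ℕ) : radii n < 1 := by
  unfold radii
  have : 0 < 1 / ((n : ℝ) + 2) := by positivity
  linarith

theorem tendsto_radii : Tendsto radii atTop (𝓝 1) := by
  have h : Tendsto (fun n : ℕ => 1 / ((n : ℝ) + 2)) atTop (𝓝 0) := by
    have := (tendsto_one_div_add_atTop_nhds_zero_nat (𝕜 := ℝ)).comp (tendsto_add_atTop_nat 1)
    refine this.congr fun n => ?_
    simp only [Function.comp_apply]; push_cast; congr 1; ring
  have := h.const_sub 1
  rw [sub_zero] at this
  exact this

theorem exists_logPotential_bound (hp : 1 < p) (hm : Measurable f)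
    (hfin : ∫⁻ x, ‖f x‖ₑ ^ p ∂torusMeasure < ⊤) :
    ∃ β : ℝ, 0 < β ∧ (∀ x, Integrable (fun t => |f t| * torDist (x - t) ^ (-β)) torusMeasure) ∧
      ∃ B : ℝ, ∀ r x, 1 / 2 ≤ r → r ≤ 1 → |logPotential r f x| ≤ B := by
  obtain ⟨β, hβ, -, K, hK⟩ := exists_lintegral_mul_torDist_le hp
  have hfin' : (∫⁻ t, ‖f t‖ₑ ^ p ∂torusMeasure) ^ (1 / p) * K < ⊤ :=
    ENNReal.mul_lt_top (ENNReal.rpow_lt_top_of_nonneg (by positivity) hfin.ne) ENNReal.coe_lt_top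
  have hmt : ∀ x, Measurable fun t => torDist (x - t) ^ (-β) := fun x =>
    (continuous_torDist.measurable.comp (measurable_const.sub measurable_id)).pow_const _
  have hen : ∀ x t, ‖|f t| * torDist (x - t) ^ (-β)‖ₑ =
      ‖f t‖ₑ * ENNReal.ofReal (torDist (x - t) ^ (-β)) := fun x t => by
    rw [enorm_mul, Real.enorm_eq_ofReal_abs |f t|, abs_abs, ← Real.enorm_eq_ofReal_abs, Real.enorm_eq_ofReal (Real.rpow_nonneg (torDist_nonneg _) _)]
  have hint : ∀ x, Integrable (fun t => |f t| * torDist (x - t) ^ (-β)) torusMeasure := by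
    intro x
    refine ⟨(hm.abs.mul (hmt x)).aestronglyMeasurable, ?_⟩
    rw [hasFiniteIntegral_iff_enorm]
    simp_rw [hen]
    exact (hK _ hm.enorm x).trans_lt hfin'
  refine ⟨β, hβ, hint, (1 + 1 / β) * π ^ β *
    ((∫⁻ t, ‖f t‖ₑ ^ p ∂torusMeasure) ^ (1 / p) * K).toReal, fun r x hr hr1 => ?_⟩
  have hc0 : 0 ≤ (1 + 1 / β) * π ^ β := by have := Real.pi_pos; positivity
  calc |logPotential r f x| ≤ ∫ t, (1 + 1 / β) * π ^ β * (|f t| * torDist (x - t) ^ (-β))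
        ∂torusMeasure := by
        rw [← Real.norm_eq_abs, logPotential]
        refine norm_integral_le_of_norm_le ((hint x).const_mul _) ?_
        filter_upwards [ae_torDist_pos x] with t ht
        rw [norm_mul, Real.norm_eq_abs, Real.norm_eq_abs]
        have := mul_le_mul_of_nonneg_left (abs_logKer_le hβ hr hr1 ht) (abs_nonneg (f t))
        linarith
    _ ≤ _ := by
        rw [integral_const_mul]
        refine mul_le_mul_of_nonneg_left ?_ hc0
        rw [integral_eq_lintegral_of_nonneg_ae (Eventually.of_forall fun t =>
          mul_nonneg (abs_nonneg _) (Real.rpow_nonneg (torDist_nonneg _) _))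
          (hint x).aestronglyMeasurable]
        refine ENNReal.toReal_mono hfin'.ne ?_
        refine le_trans (le_of_eq ?_) (hK _ hm.enorm x)
        refine lintegral_congr fun t => ?_
        rw [← hen, Real.enorm_eq_ofReal (mul_nonneg (abs_nonneg _)
          (Real.rpow_nonneg (torDist_nonneg _) _))]

theorem tendsto_logPotential (hp : 1 < p) (hm : Measurable f)
    (hfin : ∫⁻ x, ‖f x‖ₑ ^ p ∂torusMeasure < ⊤) (x : ℝ) :
    Tendsto (fun n => logPotential (radii n) f x) atTop (𝓝 (logPotential 1 f x)) := by
  obtain ⟨β, hβ, hint, -⟩ := exists_logPotential_bound hp hm hfin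
  refine tendsto_integral_of_dominated_convergence
    (fun t => (1 + 1 / β) * π ^ β * (|f t| * torDist (x - t) ^ (-β))) (fun n => ?_)
    ((hint x).const_mul _) (fun n => ?_) ?_
  · exact (hm.mul ((measurable_logKer _).comp
      (measurable_const.sub measurable_id))).aestronglyMeasurable
  · filter_upwards [ae_torDist_pos x] with t ht
    rw [norm_mul, Real.norm_eq_abs, Real.norm_eq_abs]
    have := mul_le_mul_of_nonneg_left (abs_logKer_le hβ (radii_ge n) (radii_lt n).le ht)
      (abs_nonneg (f t))
    linarith
  · filter_upwards [ae_torDist_pos x] with t ht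
    refine Tendsto.const_mul _ ?_
    have hD : 0 < poissonDenom 1 (x - t) :=
      lt_of_lt_of_le (by have := Real.pi_pos; positivity)
        (poissonDenom_ge_torDist (by norm_num) (x - t))
    have hc : Continuous fun r => poissonDenom r (x - t) := by unfold poissonDenom; fun_prop
    exact (((hc.tendsto 1).comp tendsto_radii).log hD.ne').div_const 2

/-- The logarithmic potential of an `L^p` density is an indefinite integral of an `L^p` function,
its conjugate function. -/
theorem exists_isPrimitive_logPotential (hp : 1 < p) :
    ∃ C : ℝ≥0, ∀ f : ℝ → ℝ, Measurable f → Function.Periodic f (2 * π) →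
      ∫⁻ x, ‖f x‖ₑ ^ p ∂torusMeasure < ⊤ →
      ∃ h : ℝ → ℝ, Measurable h ∧ Function.Periodic h (2 * π) ∧
        IsPrimitive (logPotential 1 f) h ∧
        ∫⁻ x, ‖h x‖ₑ ^ p ∂torusMeasure ≤ C * ∫⁻ x, ‖f x‖ₑ ^ p ∂torusMeasure := by
  obtain ⟨C, hC⟩ := exists_lintegral_conjPoisson_le hp
  refine ⟨C, fun f hm hf hfin => ?_⟩
  have hi := integrable_of_lintegral_rpow_lt_top hp.le hm.aestronglyMeasurable hfin
  have h0 : ∀ n, 0 ≤ radii n := fun n => by linarith [radii_ge n]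
  exact exists_isPrimitive_of_tendsto hp
    (F := fun n => logPotential (radii n) f) (V := fun n => conjPoisson (radii n) f)
    (fun n => isPrimitive_logPotential hf hi (h0 n) (radii_lt n))
    (fun n => (continuous_conjPoisson hf hi (h0 n) (radii_lt n)).measurable)
    (fun n => conjPoisson_periodic _ _) (logPotential_periodic _ _)
    (ENNReal.mul_lt_top ENNReal.coe_lt_top hfin).ne
    (fun n => hC f hm hf hi _ (h0 n) (radii_lt n)) (tendsto_logPotential hp hm hfin)

/-- The conjugate Poisson integral of `f` is the Poisson integral of the conjugate function. -/
theorem conjPoisson_eq_poissonInt (hp : 1 < p) (hm : Measurable f)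
    (hf : Function.Periodic f (2 * π)) (hfin : ∫⁻ x, ‖f x‖ₑ ^ p ∂torusMeasure < ⊤) {h : ℝ → ℝ}
    (H : IsPrimitive (logPotential 1 f) h) {r : ℝ} (hr : 0 ≤ r) (hr1 : r < 1) (x : ℝ) :
    conjPoisson r f x = poissonInt r h x := by
  have hi := integrable_of_lintegral_rpow_lt_top hp.le hm.aestronglyMeasurable hfin
  have h0 : ∀ n, 0 ≤ radii n := fun n => by linarith [radii_ge n]
  obtain ⟨β, hβ, hint, B, hB⟩ := exists_logPotential_bound hp hm hfin
  have hcd : ContDiff ℝ 1 (poissonKer r) := by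
    unfold poissonKer
    refine contDiff_const.div ?_ fun y => (poissonDenom_pos hr hr1 y).ne'
    unfold poissonDenom
    fun_prop
  set φ : ℝ → ℝ := fun t => poissonKer r (x - t) with hφ
  have hcφ : ContDiff ℝ 1 φ := hcd.comp (contDiff_const.sub contDiff_id)
  have hφp : IsPrimitive φ (deriv φ) := isPrimitive_of_hasDerivAt
    (fun t => (hcφ.differentiable one_ne_zero).differentiableAt.hasDerivAt)
    (hcφ.continuous_deriv le_rfl)
  have hφper : Function.Periodic φ (2 * π) := fun t => by
    simp only [hφ]
    rw [← poissonKer_periodic r (x - (t + 2 * π))]; congr 1; ring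
  -- After the semigroup law, integration by parts moves the derivative onto the smooth Poisson
  -- kernel. Only convergence of the potentials themselves is then needed as the radii tend to `1`.
  have e1 : ∀ n, conjPoisson (r * radii n) f x =
      -((2 * π)⁻¹ * ∫ t, deriv φ t * logPotential (radii n) f t ∂torusMeasure) := by
    intro n
    rw [conjPoisson_semigroup hf hi hr hr1 (h0 n) (radii_lt n), poissonInt]
    have := hφp.integral_torus_by_parts (isPrimitive_logPotential hf hi (h0 n) (radii_lt n)) hφper
      (logPotential_periodic _ _)
    simp only [smul_eq_mul] at this
    rw [this]
    simp only [hφ, mul_comm]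
    ring
  have e2 : poissonInt r h x =
      -((2 * π)⁻¹ * ∫ t, deriv φ t * logPotential 1 f t ∂torusMeasure) := by
    rw [poissonInt]
    have := hφp.integral_torus_by_parts H hφper (logPotential_periodic _ _)
    simp only [smul_eq_mul] at this
    rw [this]
    simp only [hφ, mul_comm]
    ring
  have l1 : Tendsto (fun n => conjPoisson (r * radii n) f x) atTop (𝓝 (poissonInt r h x)) := by
    simp_rw [e1]
    rw [e2]
    refine Tendsto.neg (Tendsto.const_mul _ ?_)
    have hcd' := hcφ.continuous_deriv le_rfl
    refine tendsto_integral_of_dominated_convergence (fun t => |deriv φ t| * B) (fun n => ?_)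
      (hcd'.abs.mul continuous_const).integrable_torus (fun n => ?_) ?_
    · exact (hcd'.mul (isPrimitive_logPotential hf hi (h0 n)
        (radii_lt n)).continuous).aestronglyMeasurable
    · refine Eventually.of_forall fun t => ?_
      rw [norm_mul, Real.norm_eq_abs, Real.norm_eq_abs]
      exact mul_le_mul_of_nonneg_left (hB _ _ (radii_ge n) (radii_lt n).le) (abs_nonneg _)
    · exact Eventually.of_forall fun t => (tendsto_logPotential hp hm hfin t).const_mul _
  have l2 : Tendsto (fun n => conjPoisson (r * radii n) f x) atTop (𝓝 (conjPoisson r f x)) := by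
    have hrn : ∀ n, 0 ≤ r * radii n ∧ r * radii n ≤ r := fun n =>
      ⟨mul_nonneg hr (h0 n), mul_le_of_le_one_right hr (radii_lt n).le⟩
    have h1r : 0 < 1 - r := by linarith
    refine tendsto_integral_of_dominated_convergence (fun t => |f t| * (1 / (1 - r) ^ 2))
      (fun n => ?_) (hi.abs.mul_const _) (fun n => ?_) ?_
    · exact (hm.mul (((continuous_conjKer (hrn n).1 ((hrn n).2.trans_lt hr1)).comp
        (by fun_prop : Continuous fun t => x - t)).measurable)).aestronglyMeasurable
    · refine Eventually.of_forall fun t => ?_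
      rw [norm_mul, Real.norm_eq_abs, Real.norm_eq_abs]
      refine mul_le_mul_of_nonneg_left ?_ (abs_nonneg _)
      refine (conjKer_le (hrn n).1 ((hrn n).2.trans_lt hr1) _).trans ?_
      refine one_div_le_one_div_of_le (by positivity) ?_
      have := (hrn n).2
      exact pow_le_pow_left₀ h1r.le (by linarith) 2
    · refine Eventually.of_forall fun t => Tendsto.const_mul _ ?_
      have l3 : Tendsto (fun n => r * radii n) atTop (𝓝 r) := by
        simpa using tendsto_radii.const_mul r
      have hc : Continuous fun s => poissonDenom s (x - t) := by unfold poissonDenom; fun_prop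
      exact (l3.mul_const _).div ((hc.tendsto r).comp l3) (poissonDenom_pos hr hr1 _).ne'
  exact tendsto_nhds_unique l2 l1

end LogPotential

/-! ### Principal values of the conjugate function -/

section PrincipalValue

/-- The kernel is dominated by dyadic averaging kernels with geometric weights. If `k` is least with
`|x| ≤ 2^k ε`, then either `k = 0` or `|x| > 2^{k-1} ε`, and the `k`-th summand alone suffices. -/
theorem ofReal_cauchy_le_tsum {ε : ℝ} (hε : 0 < ε) (x : ℝ) :
    ENNReal.ofReal (ε / (ε ^ 2 + x ^ 2)) ≤ ∑' k : ℕ, ENNReal.ofReal (4 * (1 / 2) ^ k) *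
      (if |x| ≤ 2 ^ k * ε then (ENNReal.ofReal (2 ^ k * ε))⁻¹ else 0) := by
  have hex : ∃ k : ℕ, |x| ≤ 2 ^ k * ε := by
    obtain ⟨k, hk⟩ := pow_unbounded_of_one_lt (|x| / ε) (one_lt_two (α := ℝ))
    exact ⟨k, ((div_lt_iff₀ hε).1 hk).le⟩
  classical
  set k := Nat.find hex with hk
  have hkx := Nat.find_spec hex
  refine le_trans ?_ (ENNReal.le_tsum k)
  rw [if_pos hkx, ← ENNReal.ofReal_inv_of_pos (by positivity), ← ENNReal.ofReal_mul (by positivity)]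
  refine ENNReal.ofReal_le_ofReal ?_
  have e : 4 * (1 / 2) ^ k * (2 ^ k * ε)⁻¹ = 4 / ((2 ^ k) ^ 2 * ε) := by
    rw [one_div, inv_pow]; field_simp
  rw [e, div_le_div_iff₀ (by positivity) (by positivity)]
  have hlow : (2 ^ k * ε) ^ 2 ≤ 4 * (ε ^ 2 + x ^ 2) := by
    rcases Nat.eq_zero_or_pos k with h0 | h0
    · rw [h0]; nlinarith [sq_nonneg x, sq_nonneg ε]
    · have h1 := Nat.find_min hex (m := k - 1) (by omega)
      rw [not_le] at h1
      have h2 : (2 : ℝ) ^ k = 2 * 2 ^ (k - 1) := by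
        rw [← pow_succ']; congr 1; omega
      have h3 : 2 ^ k * ε ≤ 2 * |x| := by rw [h2]; nlinarith
      calc (2 ^ k * ε) ^ 2 ≤ (2 * |x|) ^ 2 := pow_le_pow_left₀ (by positivity) h3 2
        _ = 4 * x ^ 2 := by rw [mul_pow, sq_abs]; norm_num
        _ ≤ _ := by nlinarith [sq_nonneg ε]
  nlinarith

/-- Averages of the oscillation against the Cauchy kernel tend to zero at Lebesgue points. -/
theorem ae_tendsto_lintegral_sub_mul_cauchy {f : ℝ → ℝ} (hf : LocallyIntegrable f volume)
    (hm : Measurable f) :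
    ∀ᵐ ξ, Tendsto (fun ε => ∫⁻ η in Ioc (ξ - π) (ξ + π),
      ‖f η - f ξ‖ₑ * ENNReal.ofReal (ε / (ε ^ 2 + (ξ - η) ^ 2))) (𝓝[>] 0) (𝓝 0) := by
  filter_upwards [(Besicovitch.vitaliFamily (volume : Measure ℝ)).ae_tendsto_lintegral_enorm_sub_div
    hf] with ξ hξ
  replace hξ := hξ.comp (Besicovitch.tendsto_filterAt volume ξ)
  set w : ℝ → ℝ≥0∞ := fun η => ‖f η - f ξ‖ₑ with hw
  have hwm : Measurable w := (hm.sub measurable_const).enorm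
  set I := Ioc (ξ - π) (ξ + π) with hI
  set A : ℝ → ℝ≥0∞ := fun r =>
    ∫⁻ η in I, w η * (if |ξ - η| ≤ r then (ENNReal.ofReal r)⁻¹ else 0) with hA
  have hAle : ∀ r, A r ≤ (∫⁻ η in Metric.closedBall ξ r, w η) * (ENNReal.ofReal r)⁻¹ := by
    intro r
    classical
    have e : ∀ η, w η * (if |ξ - η| ≤ r then (ENNReal.ofReal r)⁻¹ else 0) =
        (Metric.closedBall ξ r).indicator (fun η => w η * (ENNReal.ofReal r)⁻¹) η := by
      intro η
      rw [indicator_apply, Metric.mem_closedBall, Real.dist_eq, abs_sub_comm η ξ]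
      split_ifs <;> simp
    simp only [hA, e]
    refine (setLIntegral_le_lintegral _ _).trans ?_
    rw [lintegral_indicator measurableSet_closedBall, lintegral_mul_const _ hwm]
  have hA0 : Tendsto A (𝓝[>] 0) (𝓝 0) := by
    have h2 : Tendsto (fun r => 2 * ((∫⁻ η in Metric.closedBall ξ r, w η) /
        volume (Metric.closedBall ξ r))) (𝓝[>] 0) (𝓝 0) := by
      have := ENNReal.Tendsto.const_mul hξ (a := 2) (Or.inr (by simp))
      simpa using this
    refine tendsto_of_tendsto_of_tendsto_of_le_of_le' tendsto_const_nhds h2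
      (Eventually.of_forall fun _ => zero_le) ?_
    filter_upwards [self_mem_nhdsWithin] with r hr
    refine (hAle r).trans (le_of_eq ?_)
    rw [Real.volume_closedBall, ENNReal.ofReal_mul zero_le_two, ENNReal.div_eq_inv_mul,
      ENNReal.mul_inv (by simp) (by simp), ← mul_assoc, ← mul_assoc]
    norm_num
    rw [ENNReal.mul_inv_cancel (by simp) (by simp), one_mul, mul_comm]
  obtain ⟨ρ, hρ, hρA⟩ : ∃ ρ > 0, ∀ r, 0 < r → r < ρ → A r ≤ 1 := by
    have := hA0.eventually (Iio_mem_nhds one_pos)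
    rw [eventually_nhdsWithin_iff, Metric.eventually_nhds_iff] at this
    obtain ⟨ρ, hρ, h⟩ := this
    refine ⟨ρ, hρ, fun r h0 h1 => (h (y := r) ?_ h0).le⟩
    rwa [Real.dist_eq, sub_zero, abs_of_pos h0]
  have hwI : ∫⁻ η in I, w η < ⊤ := by
    have h1 : IntegrableOn f I volume := (hf.integrableOn_isCompact isCompact_Icc).mono_set
      Ioc_subset_Icc_self
    have h2 : IntegrableOn (fun η => f η - f ξ) I volume := h1.sub (by simp [hI])
    exact h2.2
  -- The Lebesgue point controls averages at radii below `ρ`. At larger radii they are bounded by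
  -- the integral over the period divided by `ρ`.
  set B : ℝ≥0∞ := 1 + (∫⁻ η in I, w η) * (ENNReal.ofReal ρ)⁻¹ with hB
  have hBt : B ≠ ⊤ := by
    rw [hB]
    exact ENNReal.add_ne_top.2 ⟨by simp, ENNReal.mul_ne_top hwI.ne (by simpa using hρ)⟩
  have hAB : ∀ r, 0 < r → A r ≤ B := by
    intro r hr
    rcases lt_or_ge r ρ with h | h
    · exact (hρA r hr h).trans le_self_add
    · refine le_trans ?_ (le_add_self : _ ≤ B)
      rw [← lintegral_mul_const _ hwm]
      refine lintegral_mono fun η => ?_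
      simp only
      split_ifs
      · gcongr
      · simp
  have hle : ∀ ε, 0 < ε → ∫⁻ η in I, w η * ENNReal.ofReal (ε / (ε ^ 2 + (ξ - η) ^ 2)) ≤
      ∑' k : ℕ, ENNReal.ofReal (4 * (1 / 2) ^ k) * A (2 ^ k * ε) := by
    intro ε hε
    have hms : ∀ k : ℕ, Measurable fun η : ℝ =>
        (if |ξ - η| ≤ 2 ^ k * ε then (ENNReal.ofReal (2 ^ k * ε))⁻¹ else 0) := fun k =>
      Measurable.ite (measurableSet_le (measurable_const.sub measurable_id).abs measurable_const)
        measurable_const measurable_const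
    calc _ ≤ ∫⁻ η in I, ∑' k : ℕ, ENNReal.ofReal (4 * (1 / 2) ^ k) * (w η *
          (if |ξ - η| ≤ 2 ^ k * ε then (ENNReal.ofReal (2 ^ k * ε))⁻¹ else 0)) := by
          refine lintegral_mono fun η => ?_
          refine (mul_le_mul_right (ofReal_cauchy_le_tsum hε (ξ - η)) _).trans (le_of_eq ?_)
          rw [← ENNReal.tsum_mul_left]
          exact tsum_congr fun k => by ring
      _ = _ := by
          rw [lintegral_tsum fun k => (Measurable.const_mul (f := fun η => w η *
            (if |ξ - η| ≤ 2 ^ k * ε then (ENNReal.ofReal (2 ^ k * ε))⁻¹ else 0))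
            (hwm.mul (hms k)) _).aemeasurable]
          exact tsum_congr fun k => lintegral_const_mul _ (hwm.mul (hms k))
  have hlim : Tendsto (fun ε => ∑' k : ℕ, ENNReal.ofReal (4 * (1 / 2) ^ k) * A (2 ^ k * ε))
      (𝓝[>] 0) (𝓝 0) := by
    have hsum : ∑' k : ℕ, ENNReal.ofReal (4 * (1 / 2) ^ k) ≠ ⊤ :=
      (summable_geometric_two.mul_left 4).tsum_ofReal_ne_top
    -- The series is an integral for counting measure. Each dyadic average tends to zero, and `B`
    -- times the geometric weights is a summable majorant.
    have h := tendsto_lintegral_filter_of_dominated_convergence (μ := Measure.count)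
      (l := 𝓝[>] (0 : ℝ))
      (F := fun ε (k : ℕ) => ENNReal.ofReal (4 * (1 / 2) ^ k) * A (2 ^ k * ε)) (f := fun _ => 0)
      (fun k => ENNReal.ofReal (4 * (1 / 2) ^ k) * B) (Eventually.of_forall fun _ => by fun_prop)
      ?_ ?_ ?_
    · simpa only [lintegral_count, lintegral_zero] using h
    · filter_upwards [self_mem_nhdsWithin] with ε hε
      refine Eventually.of_forall fun k => ?_
      have : (0 : ℝ) < ε := hε
      exact mul_le_mul_right (hAB _ (by positivity)) _
    · rw [lintegral_count, ENNReal.tsum_mul_right]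
      exact ENNReal.mul_ne_top hsum hBt
    · refine Eventually.of_forall fun k => ?_
      have h1 : Tendsto (fun ε : ℝ => 2 ^ k * ε) (𝓝[>] 0) (𝓝[>] 0) := by
        refine tendsto_nhdsWithin_iff.2 ⟨?_, ?_⟩
        · have : Tendsto (fun ε : ℝ => 2 ^ k * ε) (𝓝 0) (𝓝 (2 ^ k * 0)) :=
            (continuous_const.mul continuous_id).tendsto 0
          rw [mul_zero] at this
          exact this.mono_left nhdsWithin_le_nhds
        · filter_upwards [self_mem_nhdsWithin] with ε hε
          have : (0 : ℝ) < ε := hε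
          exact mem_Ioi.2 (by positivity)
      have := ENNReal.Tendsto.const_mul (hA0.comp h1) (a := ENNReal.ofReal (4 * (1 / 2) ^ k))
        (Or.inr ENNReal.ofReal_ne_top)
      rw [mul_zero] at this
      exact this
  exact tendsto_of_tendsto_of_tendsto_of_le_of_le' tendsto_const_nhds hlim
    (Eventually.of_forall fun _ => zero_le)
    (by filter_upwards [self_mem_nhdsWithin] with ε hε using hle ε hε)

/-- The denominator is `ε² + 4 (1 - ε) sin² (x/2)`. Here `4 (1 - ε) ≥ 2` and `sin² (x/2) ≥ x²/π² ≥
x²/10`, which gives the constant `5`. -/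
theorem poissonDenom_ge_cauchy {ε x : ℝ} (hε1 : ε ≤ 1 / 2) (hx : |x| ≤ π) :
    (ε ^ 2 + x ^ 2) / 5 ≤ poissonDenom (1 - ε) x := by
  have h1 := torDist_le_abs_sin x
  rw [torDist_eq_abs hx] at h1
  have hpi := Real.pi_lt_d2
  have hpi0 := Real.pi_pos
  have h2 : x ^ 2 ≤ 10 * Real.sin (x / 2) ^ 2 := by
    have := pow_le_pow_left₀ (abs_nonneg x) h1 2
    rw [sq_abs, mul_pow, sq_abs] at this
    have : π ^ 2 ≤ 10 := by nlinarith
    nlinarith [sq_nonneg (Real.sin (x / 2))]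
  rw [poissonDenom_eq]
  nlinarith [sq_nonneg (Real.sin (x / 2)), sq_nonneg ε]

theorem poissonKer_le_cauchy {ε x : ℝ} (hε : 0 < ε) (hε1 : ε ≤ 1 / 2) (hx : |x| ≤ π) :
    poissonKer (1 - ε) x ≤ 10 * (ε / (ε ^ 2 + x ^ 2)) := by
  have h1 := poissonDenom_ge_cauchy hε1 hx
  have h0 : 0 < ε ^ 2 + x ^ 2 := by positivity
  rw [poissonKer, ← mul_div_assoc, div_le_div_iff₀ (by linarith [div_pos h0 (by norm_num : (0:ℝ) < 5)]) h0]
  nlinarith [sq_nonneg ε, mul_pos hε h0]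

/-- The difference between the conjugate Poisson kernel and the truncated cotangent kernel. -/
noncomputable def conjKerError (ε x : ℝ) : ℝ :=
  conjKer (1 - ε) x - if ε ≤ |x| then conjKer 1 x else 0

theorem conjKerError_neg (ε x : ℝ) : conjKerError ε (-x) = -conjKerError ε x := by
  unfold conjKerError
  rw [abs_neg, conjKer_neg, conjKer_neg]
  split_ifs <;> ring

theorem measurable_conjKer (r : ℝ) : Measurable (conjKer r) := by
  unfold conjKer poissonDenom; fun_prop

theorem measurable_conjKerError (ε : ℝ) : Measurable (conjKerError ε) :=
  (measurable_conjKer _).sub (Measurable.ite (measurableSet_le measurable_const measurable_id.abs)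
    (measurable_conjKer 1) measurable_const)

/-- For `|x| ≥ ε` the two kernels differ by a fraction with numerator exactly `-ε² sin x`, because
the terms of first order in `ε` cancel. For `|x| < ε` only the conjugate Poisson kernel remains, and
`|sin x| ≤ ε`. The constant `13` rounds up `25/2`. -/
theorem abs_conjKerError_le {ε x : ℝ} (hε : 0 < ε) (hε1 : ε ≤ 1 / 2) (hx : |x| ≤ π) :
    |conjKerError ε x| ≤ 13 * (ε / (ε ^ 2 + x ^ 2)) := by
  have h1 := poissonDenom_ge_cauchy hε1 hx
  have h0 : 0 < ε ^ 2 + x ^ 2 := by positivity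
  have hD : 0 < poissonDenom (1 - ε) x := by linarith [div_pos h0 (by norm_num : (0:ℝ) < 5)]
  have hs : |Real.sin x| ≤ |x| := Real.abs_sin_le_abs
  have hinv : (poissonDenom (1 - ε) x)⁻¹ ≤ 5 / (ε ^ 2 + x ^ 2) := by
    rw [← one_div, div_le_div_iff₀ hD h0]; linarith
  unfold conjKerError
  split_ifs with h
  · have hx0 : 0 < |x| := hε.trans_le h
    have hD1' : 2 * x ^ 2 / 5 ≤ poissonDenom 1 x := by
      have h1 := torDist_le_abs_sin x
      rw [torDist_eq_abs hx] at h1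
      have hpi := Real.pi_lt_d2
      have hpi0 := Real.pi_pos
      have h2 : x ^ 2 ≤ 10 * Real.sin (x / 2) ^ 2 := by
        have := pow_le_pow_left₀ (abs_nonneg x) h1 2
        rw [sq_abs, mul_pow, sq_abs] at this
        have : π ^ 2 ≤ 10 := by nlinarith
        nlinarith [sq_nonneg (Real.sin (x / 2))]
      rw [poissonDenom_eq]; nlinarith
    have hx2 : 0 < x ^ 2 := by rw [← sq_abs]; positivity
    have hD1 : 0 < poissonDenom 1 x := by linarith
    have e : conjKer (1 - ε) x - conjKer 1 x =
        -(Real.sin x * ε ^ 2) * ((poissonDenom (1 - ε) x)⁻¹ * (poissonDenom 1 x)⁻¹) := by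
      have : (1 - ε) * poissonDenom 1 x - poissonDenom (1 - ε) x = -ε ^ 2 := by
        unfold poissonDenom; ring
      rw [conjKer, conjKer, div_sub_div _ _ hD.ne' hD1.ne', ← mul_inv, div_eq_mul_inv]
      congr 1
      linear_combination Real.sin x * this
    rw [e, abs_mul, abs_neg, abs_mul, abs_of_nonneg (sq_nonneg ε), abs_of_pos
      (mul_pos (inv_pos.2 hD) (inv_pos.2 hD1))]
    have hinv1 : (poissonDenom 1 x)⁻¹ ≤ 5 / (2 * |x| * ε) := by
      rw [← one_div, div_le_div_iff₀ hD1 (by positivity)]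
      have : |x| * ε ≤ x ^ 2 := by rw [← sq_abs x]; nlinarith
      nlinarith
    calc |Real.sin x| * ε ^ 2 * ((poissonDenom (1 - ε) x)⁻¹ * (poissonDenom 1 x)⁻¹)
        ≤ |x| * ε ^ 2 * (5 / (ε ^ 2 + x ^ 2) * (5 / (2 * |x| * ε))) := by gcongr
      _ = 25 / 2 * (ε / (ε ^ 2 + x ^ 2)) := by field_simp; norm_num
      _ ≤ _ := by gcongr; norm_num
  · rw [not_le] at h
    rw [sub_zero, conjKer, abs_div, abs_mul, abs_of_pos hD, div_eq_mul_inv]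
    calc |1 - ε| * |Real.sin x| * (poissonDenom (1 - ε) x)⁻¹
        ≤ 1 * ε * (5 / (ε ^ 2 + x ^ 2)) := by
          gcongr
          · rw [abs_le]; constructor <;> linarith
          · exact hs.trans h.le
      _ = 5 * (ε / (ε ^ 2 + x ^ 2)) := by ring
      _ ≤ _ := by gcongr; norm_num

/-- The part of the period around `ξ` at distance at least `ε` from `ξ`. -/
abbrev pvDomain (ξ ε : ℝ) : Set ℝ := {η | η ∈ Ioc (ξ - π) (ξ + π) ∧ ε ≤ |ξ - η|}

theorem measurableSet_pvDomain (ξ ε : ℝ) : MeasurableSet (pvDomain ξ ε) :=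
  measurableSet_Ioc.inter (measurableSet_le measurable_const (measurable_const.sub measurable_id).abs)

theorem abs_sub_le_pi_of_mem {ξ η : ℝ} (h : η ∈ Ioc (ξ - π) (ξ + π)) : |ξ - η| ≤ π :=
  abs_le.2 ⟨by linarith [h.2], by linarith [h.1]⟩

theorem integral_torus_eq_Ioc_centered {E : Type*} [NormedAddCommGroup E] [NormedSpace ℝ E]
    {F : ℝ → E} (hF : Function.Periodic F (2 * π)) (ξ : ℝ) :
    ∫ x, F x ∂torusMeasure = ∫ x in Ioc (ξ - π) (ξ + π), F x := by
  rw [integral_torus_eq_Ioc hF (ξ - π)]; congr 3; ring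

theorem integrable_torus_iff_Ioc_centered {E : Type*} [NormedAddCommGroup E]
    {F : ℝ → E} (hF : Function.Periodic F (2 * π)) (ξ : ℝ) :
    Integrable F torusMeasure ↔ IntegrableOn F (Ioc (ξ - π) (ξ + π)) := by
  rw [integrable_torus_iff_Ioc hF (ξ - π)]; ring_nf

theorem tendsto_integral_sub_mul_of_le_cauchy {f : ℝ → ℝ} {ξ C : ℝ} {k : ℝ → ℝ → ℝ} (hC : 0 ≤ C)
    (hk : ∀ ε x, 0 < ε → ε ≤ 1 / 2 → |x| ≤ π → |k ε x| ≤ C * (ε / (ε ^ 2 + x ^ 2)))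
    (h : Tendsto (fun ε => ∫⁻ η in Ioc (ξ - π) (ξ + π),
      ‖f η - f ξ‖ₑ * ENNReal.ofReal (ε / (ε ^ 2 + (ξ - η) ^ 2))) (𝓝[>] 0) (𝓝 0)) :
    Tendsto (fun ε => ∫ η in Ioc (ξ - π) (ξ + π), (f η - f ξ) * k ε (ξ - η)) (𝓝[>] 0) (𝓝 0) := by
  rw [tendsto_iff_edist_tendsto_0]
  have h2 := ENNReal.Tendsto.const_mul h (a := ENNReal.ofReal C) (Or.inr (by simp))
  rw [mul_zero] at h2
  refine tendsto_of_tendsto_of_tendsto_of_le_of_le' tendsto_const_nhds h2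
    (Eventually.of_forall fun _ => zero_le) ?_
  have hhalf : Iic (1 / 2 : ℝ) ∈ 𝓝[>] (0 : ℝ) := mem_nhdsWithin_of_mem_nhds (Iic_mem_nhds (by norm_num))
  filter_upwards [self_mem_nhdsWithin, hhalf] with ε hε hε1
  rw [edist_zero_right]
  refine (enorm_integral_le_lintegral_enorm _).trans ?_
  rw [← lintegral_const_mul' _ _ (by simp)]
  refine setLIntegral_mono' measurableSet_Ioc fun η hη => ?_
  rw [enorm_mul, mul_left_comm, ← ENNReal.ofReal_mul hC]
  gcongr
  rw [← ofReal_norm]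
  exact ENNReal.ofReal_le_ofReal (hk ε _ hε hε1 (abs_sub_le_pi_of_mem hη))

theorem integral_odd_centered {k : ℝ → ℝ} (hk : ∀ x, k (-x) = -k x) (ξ : ℝ) :
    ∫ η in Ioc (ξ - π) (ξ + π), k (ξ - η) = 0 := by
  rw [← intervalIntegral.integral_of_le (by linarith [Real.pi_pos]),
    intervalIntegral.integral_comp_sub_left (fun x => k x)]
  have h2 := intervalIntegral.integral_comp_neg (a := -π) (b := π) (f := k)
  simp only [hk, intervalIntegral.integral_neg, neg_neg] at h2
  rw [show ξ - (ξ + π) = -π by ring, show ξ - (ξ - π) = π by ring]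
  linarith

/-- The principal value of the cotangent kernel is the conjugate function. -/
theorem ae_tendsto_integral_pvDomain_conjKer {f h : ℝ → ℝ} {p : ℝ} (hp : 1 < p)
    (hm : Measurable f) (hf : Function.Periodic f (2 * π))
    (hfin : ∫⁻ x, ‖f x‖ₑ ^ p ∂torusMeasure < ⊤) (H : IsPrimitive (logPotential 1 f) h)
    (hhm : Measurable h) (hh : Function.Periodic h (2 * π)) :
    ∀ᵐ ξ, Tendsto (fun ε => ∫ η in pvDomain ξ ε, f η * conjKer 1 (ξ - η)) (𝓝[>] 0) (𝓝 (h ξ)) := by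
  have hi := integrable_of_lintegral_rpow_lt_top hp.le hm.aestronglyMeasurable hfin
  have hfl : LocallyIntegrable f volume := by
    have : IsPrimitive (fun x => ∫ t in (0 : ℝ)..x, f t) f :=
      ⟨(integrable_torus_iff_intervalIntegrable hf).1 hi, fun x => by simp⟩
    exact this.locallyIntegrable
  filter_upwards [ae_tendsto_lintegral_sub_mul_cauchy hfl hm,
    ae_tendsto_lintegral_sub_mul_cauchy H.locallyIntegrable hhm] with ξ h1 h2
  have t1 := tendsto_integral_sub_mul_of_le_cauchy (k := conjKerError) (C := 13) (by norm_num)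
    (fun ε x => abs_conjKerError_le) h1
  have t2 := tendsto_integral_sub_mul_of_le_cauchy (k := fun ε x => poissonKer (1 - ε) x) (C := 10)
    (by norm_num) (fun ε x h0 h1 hx => by
      rw [abs_of_nonneg (poissonKer_nonneg (by linarith) (by linarith) x)]
      exact poissonKer_le_cauchy h0 h1 hx) h2
  have hfI : IntegrableOn f (Ioc (ξ - π) (ξ + π)) := (integrable_torus_iff_Ioc_centered hf ξ).1 hi
  have hfin' : IsFiniteMeasure (volume.restrict (Ioc (ξ - π) (ξ + π))) := ⟨by simp⟩
  have hhI : IntegrableOn h (Ioc (ξ - π) (ξ + π)) :=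
    (integrable_torus_iff_Ioc_centered hh ξ).1 H.integrable_torus
  have hhalf : Iic (1 / 2 : ℝ) ∈ 𝓝[>] (0 : ℝ) := mem_nhdsWithin_of_mem_nhds (Iic_mem_nhds (by norm_num))
  -- The truncated integral is the conjugate Poisson integral at radius `1 - ε` minus an error, and
  -- the conjugate Poisson integral is the Poisson integral of `h`. Since the Poisson kernel has
  -- mass `2π` and the error kernel is odd, `h ξ` and `f ξ` may be subtracted, leaving oscillations
  -- that vanish at Lebesgue points.
  have key : (fun ε => h ξ + (2 * π)⁻¹ * (∫ η in Ioc (ξ - π) (ξ + π),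
        (h η - h ξ) * poissonKer (1 - ε) (ξ - η)) -
      ∫ η in Ioc (ξ - π) (ξ + π), (f η - f ξ) * conjKerError ε (ξ - η)) =ᶠ[𝓝[>] 0]
      (fun ε => ∫ η in pvDomain ξ ε, f η * conjKer 1 (ξ - η)) := by
    filter_upwards [self_mem_nhdsWithin, hhalf] with ε hε hε1
    have hε0 : 0 < ε := hε
    have hε1' : ε ≤ 1 / 2 := hε1
    have hr : 0 ≤ 1 - ε := by linarith
    have hr1 : 1 - ε < 1 := by linarith
    have hcb := conjPoisson_eq_poissonInt hp hm hf hfin H hr hr1 ξ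
    rw [conjPoisson, poissonInt, integral_torus_eq_Ioc_centered (fun t => by
      rw [hf t, ← conjKer_periodic (1 - ε) (ξ - (t + 2 * π)), sub_add_eq_sub_sub, sub_add_cancel]) ξ,
      integral_torus_eq_Ioc_centered (fun t => by
      rw [hh t, ← poissonKer_periodic (1 - ε) (ξ - (t + 2 * π)), sub_add_eq_sub_sub,
        sub_add_cancel]) ξ] at hcb
    have hbE : ∀ x, |x| ≤ π → |conjKerError ε x| ≤ 13 * (1 / ε) := fun x hx => by
      refine (abs_conjKerError_le hε0 hε1' hx).trans ?_
      refine mul_le_mul_of_nonneg_left ?_ (by norm_num)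
      rw [div_le_div_iff₀ (by positivity) hε0]; nlinarith [sq_nonneg x]
    have hmE : AEStronglyMeasurable (fun η => conjKerError ε (ξ - η))
        (volume.restrict (Ioc (ξ - π) (ξ + π))) :=
      ((measurable_conjKerError ε).comp (measurable_const.sub measurable_id)).aestronglyMeasurable
    have hbE' : ∀ᵐ η ∂volume.restrict (Ioc (ξ - π) (ξ + π)),
        ‖conjKerError ε (ξ - η)‖ ≤ 13 * (1 / ε) :=
      (ae_restrict_iff' measurableSet_Ioc).2
        (Eventually.of_forall fun η hη => hbE _ (abs_sub_le_pi_of_mem hη))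
    have iE : IntegrableOn (fun η => conjKerError ε (ξ - η)) (Ioc (ξ - π) (ξ + π)) :=
      Integrable.of_bound hmE _ hbE'
    have ifE : IntegrableOn (fun η => f η * conjKerError ε (ξ - η)) (Ioc (ξ - π) (ξ + π)) :=
      hfI.mul_bdd hmE hbE'
    have hcP := (continuous_poissonKer hr hr1).comp (by fun_prop : Continuous fun η => ξ - η)
    have hcC := (continuous_conjKer hr hr1).comp (by fun_prop : Continuous fun η => ξ - η)
    have iP : IntegrableOn (fun η => poissonKer (1 - ε) (ξ - η)) (Ioc (ξ - π) (ξ + π)) :=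
      (hcP.integrableOn_Icc).mono_set Ioc_subset_Icc_self
    have ihP : IntegrableOn (fun η => h η * poissonKer (1 - ε) (ξ - η)) (Ioc (ξ - π) (ξ + π)) := by
      refine hhI.mul_bdd (c := (1 - (1 - ε) ^ 2) / (1 - (1 - ε)) ^ 2) hcP.aestronglyMeasurable
        (Eventually.of_forall fun η => ?_)
      rw [Real.norm_eq_abs, abs_of_nonneg (poissonKer_nonneg hr hr1 _)]
      rw [poissonKer]
      have := poissonDenom_ge hr (ξ - η)
      have h3 : 0 < (1 - (1 - ε)) ^ 2 := by
        rw [sub_sub_cancel]; positivity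
      exact div_le_div_of_nonneg_left (by nlinarith) h3 this
    have ifC : IntegrableOn (fun η => f η * conjKer (1 - ε) (ξ - η)) (Ioc (ξ - π) (ξ + π)) := by
      refine hfI.mul_bdd (c := 1 / (1 - (1 - ε)) ^ 2) hcC.aestronglyMeasurable
        (Eventually.of_forall fun η => ?_)
      exact conjKer_le hr hr1 _
    have hP : ∫ η in Ioc (ξ - π) (ξ + π), poissonKer (1 - ε) (ξ - η) = 2 * π := by
      rw [← integral_torus_eq_Ioc_centered (F := fun η => poissonKer (1 - ε) (ξ - η)) (fun t => by
        simp only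
        rw [← poissonKer_periodic (1 - ε) (ξ - (t + 2 * π)), sub_add_eq_sub_sub,
        sub_add_cancel]) ξ, integral_torus_sub_left (poissonKer_periodic _) ξ,
        integral_poissonKer hr hr1]
    have hE0 := integral_odd_centered (conjKerError_neg ε) ξ
    have e1 : ∫ η in Ioc (ξ - π) (ξ + π), (f η - f ξ) * conjKerError ε (ξ - η) =
        ∫ η in Ioc (ξ - π) (ξ + π), f η * conjKerError ε (ξ - η) := by
      simp_rw [sub_mul]
      rw [integral_sub ifE (iE.const_mul _), integral_const_mul, hE0, mul_zero, sub_zero]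
    have e2 : ∫ η in Ioc (ξ - π) (ξ + π), (h η - h ξ) * poissonKer (1 - ε) (ξ - η) =
        (∫ η in Ioc (ξ - π) (ξ + π), h η * poissonKer (1 - ε) (ξ - η)) - h ξ * (2 * π) := by
      simp_rw [sub_mul]
      rw [integral_sub ihP (iP.const_mul _), integral_const_mul, hP]
    have e3 : ∫ η in pvDomain ξ ε, f η * conjKer 1 (ξ - η) =
        ∫ η in Ioc (ξ - π) (ξ + π), (f η * conjKer (1 - ε) (ξ - η) -
          f η * conjKerError ε (ξ - η)) := by
      have : pvDomain ξ ε = Ioc (ξ - π) (ξ + π) ∩ {η | ε ≤ |ξ - η|} := rfl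
      rw [this, ← setIntegral_indicator
        (measurableSet_le measurable_const (by fun_prop : Measurable fun η => |ξ - η|))]
      refine integral_congr_ae (Eventually.of_forall fun η => ?_)
      simp only [indicator_apply, mem_ofPred_eq, conjKerError]
      split_ifs <;> ring
    rw [e1, e2, e3, integral_sub ifC ifE, hcb]
    have := Real.pi_pos
    field_simp
    ring
  refine Tendsto.congr' key ?_
  simpa using (tendsto_const_nhds.add (t2.const_mul (2 * π)⁻¹)).sub t1

end PrincipalValue

/-! ### Indefinite integrals of parametric integrals -/

section Parametric

variable {E : Type*} [NormedAddCommGroup E] [NormedSpace ℝ E]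

/-- The hypothesis at `x = 2π` forces the density to have integral zero, so the identity propagates
from one period to the whole line. -/
theorem IsPrimitive.of_periodic {f h : ℝ → E} (hf : Function.Periodic f (2 * π))
    (hh : Function.Periodic h (2 * π)) (hi : Integrable h torusMeasure)
    (H : ∀ x ∈ Icc 0 (2 * π), f x - f 0 = ∫ t in (0 : ℝ)..x, h t) : IsPrimitive f h := by
  have hint := (integrable_torus_iff_intervalIntegrable hh).1 hi
  refine ⟨hint, fun x => ?_⟩
  have h0 : ∫ x, h x ∂torusMeasure = 0 := by
    rw [integral_torus_eq_interval hh 0, zero_add, ← H _ ⟨Real.two_pi_pos.le, le_rfl⟩,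
      ← zero_add (2 * π), hf 0, sub_self]
  have hp : Function.Periodic (fun x => f x - ∫ t in (0 : ℝ)..x, h t) (2 * π) := fun x => by
    simp only
    rw [hf x, ← intervalIntegral.integral_add_adjacent_intervals (hint 0 x) (hint x _),
      ← integral_torus_eq_interval hh x, h0, add_zero]
  obtain ⟨y, hy, hxy⟩ := hp.exists_mem_Ico₀ Real.two_pi_pos x
  simp only [← H y ⟨hy.1, hy.2.le⟩, sub_sub_cancel] at hxy
  rw [← hxy]; abel

theorem restrict_Ioc_eq_torus {x : ℝ} (hx : x ∈ Icc 0 (2 * π)) :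
    (volume.restrict (Ioc 0 x) : Measure ℝ) = torusMeasure.restrict (Ioc 0 x) := by
  rw [torusMeasure, Measure.restrict_restrict measurableSet_Ioc,
    inter_eq_self_of_subset_left (Ioc_subset_Ioc_right hx.2)]

theorem integrable_restrict_prod {E : Type*} [NormedAddCommGroup E] {F : ℝ → ℝ → E}
    (hF : Integrable (Function.uncurry F) (torusMeasure.prod torusMeasure)) {x : ℝ}
    (hx : x ∈ Icc 0 (2 * π)) :
    Integrable (Function.uncurry F) ((volume.restrict (Ioc 0 x)).prod torusMeasure) := by
  rw [restrict_Ioc_eq_torus hx]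
  conv => arg 2; arg 2; rw [← Measure.restrict_univ (μ := torusMeasure)]
  rw [Measure.prod_restrict]
  exact hF.restrict

/-- Fubini's theorem for the increment of a parametric integral. -/
theorem integral_sub_integral_eq {Φ F : ℝ → ℝ → E}
    (h : ∀ x ∈ Icc 0 (2 * π), ∀ᵐ η ∂torusMeasure, Φ x η - Φ 0 η = ∫ t in (0 : ℝ)..x, F t η)
    (hF : Integrable (Function.uncurry F) (torusMeasure.prod torusMeasure))
    (hΦ : ∀ x, Integrable (Φ x) torusMeasure) {x : ℝ} (hx : x ∈ Icc 0 (2 * π)) :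
    (∫ η, Φ x η ∂torusMeasure) - ∫ η, Φ 0 η ∂torusMeasure =
      ∫ t in (0 : ℝ)..x, ∫ η, F t η ∂torusMeasure := by
  rw [intervalIntegral.integral_of_le hx.1, integral_integral_swap (integrable_restrict_prod hF hx),
    ← integral_sub (hΦ x) (hΦ 0)]
  refine integral_congr_ae ?_
  filter_upwards [h x hx] with η hη
  rw [hη, intervalIntegral.integral_of_le hx.1]

theorem isPrimitive_integral {Φ F : ℝ → ℝ → E}
    (h : ∀ x ∈ Icc 0 (2 * π), ∀ᵐ η ∂torusMeasure, Φ x η - Φ 0 η = ∫ t in (0 : ℝ)..x, F t η)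
    (hF : Integrable (Function.uncurry F) (torusMeasure.prod torusMeasure))
    (hΦ : ∀ x, Integrable (Φ x) torusMeasure)
    (hpΦ : ∀ x η, Φ (x + 2 * π) η = Φ x η) (hpF : ∀ x η, F (x + 2 * π) η = F x η) :
    IsPrimitive (fun x => ∫ η, Φ x η ∂torusMeasure) (fun x => ∫ η, F x η ∂torusMeasure) := by
  refine .of_periodic (fun x => by simp only [hpΦ]) (fun x => by simp only [hpF])
    hF.integral_prod_left fun x hx => ?_
  exact integral_sub_integral_eq h hF hΦ hx

/-- The integrated identity passes to the limit by dominated convergence on the product measure, so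
convergence of the inner integrals at individual points is not needed. -/
theorem isPrimitive_of_tendsto_integral {F : ℕ → ℝ → ℝ → E} {F' : ℝ → ℝ → E} {G : ℕ → ℝ → E}
    {G' : ℝ → E} {B : ℝ → ℝ → ℝ}
    (hG : ∀ n, ∀ x ∈ Icc 0 (2 * π), G n x - G n 0 = ∫ t in (0 : ℝ)..x, ∫ η, F n t η ∂torusMeasure)
    (hm : ∀ n, AEStronglyMeasurable (Function.uncurry (F n)) (torusMeasure.prod torusMeasure))
    (hB : Integrable (Function.uncurry B) (torusMeasure.prod torusMeasure))
    (hFB : ∀ n, ∀ᵐ z ∂torusMeasure.prod torusMeasure, ‖F n z.1 z.2‖ ≤ B z.1 z.2)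
    (hF : ∀ᵐ z ∂torusMeasure.prod torusMeasure,
      Tendsto (fun n => F n z.1 z.2) atTop (𝓝 (F' z.1 z.2)))
    (hGl : ∀ x, Tendsto (fun n => G n x) atTop (𝓝 (G' x)))
    (hpG : Function.Periodic G' (2 * π)) (hpF : ∀ x η, F' (x + 2 * π) η = F' x η) :
    IsPrimitive G' (fun x => ∫ η, F' x η ∂torusMeasure) ∧
      Integrable (Function.uncurry F') (torusMeasure.prod torusMeasure) := by
  have hF'm : AEStronglyMeasurable (Function.uncurry F') (torusMeasure.prod torusMeasure) :=
    aestronglyMeasurable_of_tendsto_ae atTop hm hF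
  have hF'B : ∀ᵐ z ∂torusMeasure.prod torusMeasure, ‖F' z.1 z.2‖ ≤ B z.1 z.2 := by
    filter_upwards [ae_all_iff.2 hFB, hF] with z h1 h2
    exact le_of_tendsto h2.norm (Eventually.of_forall h1)
  have hF'i : Integrable (Function.uncurry F') (torusMeasure.prod torusMeasure) :=
    hB.mono' hF'm hF'B
  refine ⟨.of_periodic hpG (fun x => by simp only [hpF]) hF'i.integral_prod_left fun x hx => ?_, hF'i⟩
  have hac : (volume.restrict (Ioc 0 x)).prod torusMeasure ≪ torusMeasure.prod torusMeasure := by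
    rw [restrict_Ioc_eq_torus hx]
    exact Measure.AbsolutelyContinuous.prod (Measure.absolutelyContinuous_of_le
      Measure.restrict_le_self) Measure.AbsolutelyContinuous.rfl
  have e : ∀ F : ℝ → ℝ → E, Integrable (Function.uncurry F) (torusMeasure.prod torusMeasure) →
      ∫ t in (0 : ℝ)..x, ∫ η, F t η ∂torusMeasure =
        ∫ z, Function.uncurry F z ∂(volume.restrict (Ioc 0 x)).prod torusMeasure := fun F hF => by
    rw [intervalIntegral.integral_of_le hx.1, integral_prod _ (integrable_restrict_prod hF hx)]
    rfl
  have h1 : Tendsto (fun n => G n x - G n 0) atTop (𝓝 (G' x - G' 0)) := (hGl x).sub (hGl 0)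
  have h2 : Tendsto (fun n => G n x - G n 0) atTop
      (𝓝 (∫ t in (0 : ℝ)..x, ∫ η, F' t η ∂torusMeasure)) := by
    simp_rw [fun n => hG n x hx, fun n => e (F n) (hB.mono' (hm n) (hFB n)), e F' hF'i]
    exact tendsto_integral_of_dominated_convergence (Function.uncurry B)
      (fun n => (integrable_restrict_prod (hB.mono' (hm n) (hFB n)) hx).aestronglyMeasurable)
      (integrable_restrict_prod hB hx) (fun n => hac.ae_le (hFB n)) (hac.ae_le hF)
  exact tendsto_nhds_unique h1 h2

end Parametric

/-! ### Geometry of `W^{2,p}` curves -/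

section Geometry

/-- Hölder's inequality produces the exponent `1/q = 1 - 1/p`. A segment of length at most `π` fits
in one period, so the `L^p` norm over a period suffices. -/
theorem IsPrimitive.norm_sub_le_torDist {E : Type*} [NormedAddCommGroup E] [NormedSpace ℝ E]
    [MeasurableSpace E] [BorelSpace E] {p M : ℝ} (hp : 1 < p) (hM : 0 ≤ M) {f h : ℝ → E}
    (H : IsPrimitive f h) (hm : Measurable h) (hf : Function.Periodic f (2 * π))
    (hh : Function.Periodic h (2 * π))
    (hM' : ∫⁻ x, ‖h x‖ₑ ^ p ∂torusMeasure ≤ ENNReal.ofReal M ^ p) (ξ η : ℝ) :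
    ‖f ξ - f η‖ ≤ M * torDist (ξ - η) ^ (1 - 1 / p) := by
  have key : ∀ x, ‖f (η + x) - f η‖ ≤ M * torDist x ^ (1 - 1 / p) := by
    refine periodic_induction (fun x => by rw [← add_assoc, hf, torDist_periodic]) fun x hx => ?_
    rw [torDist_eq_abs hx, H.sub_eq]
    set q := p.conjExponent with hq
    have hpq : p.HolderConjugate q := Real.HolderConjugate.conjExponent hp
    have hp0 : 0 < p := by linarith
    have h1 : ‖∫ t in η..(η + x), h t‖ₑ ≤ ∫⁻ t in uIoc η (η + x), ‖h t‖ₑ := by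
      have : ‖∫ t in η..(η + x), h t‖ₑ = ‖∫ t in uIoc η (η + x), h t‖ₑ := by
        rw [← ofReal_norm, ← ofReal_norm, intervalIntegral.norm_intervalIntegral_eq]
      rw [this]
      exact enorm_integral_le_lintegral_enorm _
    have h2 := ENNReal.lintegral_mul_le_Lp_mul_Lq (volume.restrict (uIoc η (η + x))) hpq
      (f := fun t => ‖h t‖ₑ) (g := fun _ => 1) hm.enorm.aemeasurable aemeasurable_const
    have hsub : uIoc η (η + x) ⊆ Ioc (η - π) (η - π + 2 * π) := by
      intro t ht
      rw [mem_uIoc] at ht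
      rw [abs_le] at hx
      rcases ht with h | h <;> exact ⟨by linarith [h.1], by linarith [h.2]⟩
    have h3 : ∫⁻ t in uIoc η (η + x), ‖h t‖ₑ ^ p ≤ ENNReal.ofReal M ^ p := by
      refine (lintegral_mono_set hsub).trans ?_
      rw [← lintegral_torus_eq_Ioc (F := fun t => ‖h t‖ₑ ^ p) (fun t => by simp only [hh t])]
      exact hM'
    have h4 : ‖∫ t in η..(η + x), h t‖ₑ ≤ ENNReal.ofReal (M * |x| ^ (1 - 1 / p)) := by
      refine h1.trans (le_trans (by simpa using h2) ?_)
      rw [ENNReal.ofReal_mul hM]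
      refine mul_le_mul' ?_ (le_of_eq ?_)
      · have := ENNReal.rpow_le_rpow h3 (by positivity : 0 ≤ p⁻¹)
        rwa [← ENNReal.rpow_mul, mul_inv_cancel₀ hp0.ne', ENNReal.rpow_one] at this
      ·
        rw [ENNReal.ofReal_rpow_of_nonneg (abs_nonneg x) (inv_nonneg.2 hpq.symm.nonneg)]
        congr 2
        have := hpq.inv_add_inv_eq_one
        rw [one_div]; linarith
    rw [← ofReal_norm] at h4
    exact (ENNReal.ofReal_le_ofReal_iff (by positivity)).1 h4
  have := key (ξ - η)
  rwa [add_sub_cancel] at this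

/-- A regular closed curve with `L^p` second derivative and quantitative bounds. -/
structure RegularCurve (p M : ℝ) (γ : ℝ → Plane) : Prop where
  one_lt : 1 < p
  one_lt' : 1 < M
  periodic : Function.Periodic γ (2 * π)
  hasDerivAt : ∀ x, HasDerivAt γ (deriv γ x) x
  isPrimitive : IsPrimitive (deriv γ) (deriv (deriv γ))
  lintegral_le : ∫⁻ x, ‖deriv (deriv γ) x‖ₑ ^ p ∂torusMeasure ≤ ENNReal.ofReal M ^ p
  le_speed : ∀ x, M⁻¹ ≤ speed γ x
  speed_le : ∀ x, speed γ x ≤ M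
  torDist_le : ∀ ξ η, torDist (ξ - η) ≤ M * ‖γ ξ - γ η‖

theorem Function.Periodic.deriv_periodic {E : Type*} [NormedAddCommGroup E] [NormedSpace ℝ E]
    {f : ℝ → E} {c : ℝ} (hf : Function.Periodic f c) : Function.Periodic (deriv f) c := fun x => by
  rw [← deriv_comp_add_const]
  congr 1
  exact funext hf

theorem forall_of_ae_of_isClosed {P : ℝ → Prop} (hP : ∀ᵐ x : ℝ, P x) (hc : IsClosed {x | P x})
    (x : ℝ) : P x := by
  have h1 : Dense {x | P x} := Measure.dense_of_ae hP
  have h2 := h1.closure_eq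
  rw [hc.closure_eq] at h2
  have : x ∈ {x | P x} := by rw [h2]; exact mem_univ x
  exact this

set_option maxHeartbeats 400000 in
-- The weak derivative has a continuous representative `D`, and the continuous `γ` is its primitive,
-- hence `C¹` with derivative `D`. The essential bounds on the speed then hold everywhere by
-- continuity.
theorem regularCurve_of_mem_curveBall {p : ℝ≥0∞} (hp : 1 < p) (hp' : p < ⊤) {M : ℝ} (hM : 1 < M)
    {γ : ℝ → Plane} (hγ : γ ∈ curveBall p M) : RegularCurve p.toReal M γ := by
  obtain ⟨⟨hcont, hsob, -⟩, hnorm, hstar, harc⟩ := hγ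
  have hM0 : 0 < M := by linarith
  have hp1 : 1 < p.toReal := by
    rw [← ENNReal.toReal_one]
    exact (ENNReal.toReal_lt_toReal (by simp) hp'.ne).2 hp
  have w1 : HasWeakDeriv γ (weakDeriv γ) := hsob.hasWeakDeriv 0 (by norm_num)
  have w2 : HasWeakDeriv (weakDeriv γ) (weakDeriv (weakDeriv γ)) := hsob.hasWeakDeriv 1 (by norm_num)
  obtain ⟨D, hD, hDp, hDe⟩ := w2.exists_isPrimitive
  have hγD : IsPrimitive γ D := (w1.isPrimitive hcont).congr_ae hDe
  have hder : ∀ x, HasDerivAt γ (D x) x := fun x => by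
    have : γ = fun x => γ 0 + ∫ t in (0 : ℝ)..x, D t := funext hγD.eq
    rw [this]
    exact (intervalIntegral.integral_hasDerivAt_right (hD.continuous.intervalIntegrable _ _)
      (hD.continuous.stronglyMeasurableAtFilter _ _) hD.continuous.continuousAt).const_add _
  have hDd : deriv γ = D := funext fun x => (hder x).deriv
  have hg : Continuous (speed γ) := by
    unfold speed; rw [hDd]; exact hD.continuous.norm
  have hgp : Function.Periodic (speed γ) (2 * π) := fun x => by
    unfold speed; rw [hDd, hDp x]
  refine ⟨hp1, hM, hsob.periodic, fun x => by rw [hDd]; exact hder x, ?_, ?_, ?_, ?_, ?_⟩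
  · rw [hDd]; exact hD.congr_ae hD.deriv_ae_eq.symm
  · rw [hDd]
    have e : ∫⁻ x, ‖deriv D x‖ₑ ^ p.toReal ∂torusMeasure =
        ∫⁻ x, ‖weakDeriv (weakDeriv γ) x‖ₑ ^ p.toReal ∂torusMeasure := by
      refine lintegral_congr_ae ?_
      filter_upwards [ae_torus_of_ae hD.deriv_ae_eq] with x hx
      rw [hx]
    have h2 : eLpNorm (weakDeriv (weakDeriv γ)) p torusMeasure ≤ ENNReal.ofReal M := by
      refine le_trans ?_ hnorm
      rw [sobolevNorm, Finset.sum_range_succ]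
      exact le_add_self
    rw [eLpNorm_eq_lintegral_rpow_enorm_toReal (by positivity) hp'.ne] at h2
    have h3 := ENNReal.rpow_le_rpow h2 (by linarith : 0 ≤ p.toReal)
    rw [← ENNReal.rpow_mul, one_div, inv_mul_cancel₀ (by linarith), ENNReal.rpow_one] at h3
    rw [e]; exact h3
  · refine forall_of_ae_of_isClosed (ae_of_ae_torus (fun x => by rw [hgp x]) ?_)
      (isClosed_le continuous_const hg)
    filter_upwards [ENNReal.ae_le_essSup (μ := torusMeasure) fun ξ => ‖speed γ ξ‖ₑ⁻¹] with x hx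
    have h1 := hx.trans ((le_max_left _ _).trans hstar)
    have h0 : 0 ≤ speed γ x := norm_nonneg _
    rw [Real.enorm_eq_ofReal h0, ENNReal.inv_le_iff_inv_le, ← ENNReal.ofReal_inv_of_pos hM0] at h1
    exact (ENNReal.ofReal_le_ofReal_iff h0).1 h1
  · refine forall_of_ae_of_isClosed (ae_of_ae_torus (fun x => by rw [hgp x]) ?_)
      (isClosed_le hg continuous_const)
    filter_upwards [ENNReal.ae_le_essSup (μ := torusMeasure) fun ξ => ‖speed γ ξ‖ₑ] with x hx
    have h1 := hx.trans ((le_max_right _ _).trans hstar)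
    have h0 : 0 ≤ speed γ x := norm_nonneg _
    rw [Real.enorm_eq_ofReal h0] at h1
    exact (ENNReal.ofReal_le_ofReal_iff hM0.le).1 h1
  · intro ξ η
    -- The supremum in `arcChord` runs over distinct torus points only; equal ones have distance
    -- zero.
    by_cases h : (ξ : AddCircle (2 * π)) = η
    · rw [torDist, AddCircle.coe_sub, h, sub_self, norm_zero]; positivity
    · have h1 : ‖(ξ : AddCircle (2 * π)) - η‖ₑ / ‖γ ξ - γ η‖ₑ ≤ ENNReal.ofReal M :=
        (le_iSup₂_of_le (f := fun ξ η : ℝ => ⨆ (_ : (ξ : AddCircle (2 * π)) ≠ η),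
          ‖(ξ : AddCircle (2 * π)) - η‖ₑ / ‖γ ξ - γ η‖ₑ) ξ η (le_iSup (fun _ :
          (ξ : AddCircle (2 * π)) ≠ η => ‖(ξ : AddCircle (2 * π)) - η‖ₑ / ‖γ ξ - γ η‖ₑ) h)).trans harc
      -- At a self-intersection the quotient would be infinite, contradicting the bound by `M`.
      have h2 : ‖γ ξ - γ η‖ₑ ≠ 0 := by
        intro h0
        rw [h0, ENNReal.div_zero] at h1
        · simp at h1
        · rw [enorm_ne_zero]; exact sub_ne_zero.2 h
      rw [ENNReal.div_le_iff h2 (by simp), ← ofReal_norm, ← ofReal_norm,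
        ← ENNReal.ofReal_mul hM0.le] at h1
      rw [torDist, AddCircle.coe_sub]
      exact (ENNReal.ofReal_le_ofReal_iff (by positivity)).1 h1

namespace RegularCurve

variable {p M : ℝ} {γ : ℝ → Plane} (hγ : RegularCurve p M γ)

end RegularCurve

end Geometry

/-! ### Elementary estimates for regular curves. -/

namespace RegularCurve

variable {p M : ℝ} {γ : ℝ → Plane}

theorem M_pos (hγ : RegularCurve p M γ) : 0 < M := by linarith [hγ.one_lt']

theorem exponent_pos (hγ : RegularCurve p M γ) : 0 < 1 - 1 / p := by
  have := hγ.one_lt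
  rw [sub_pos, div_lt_one (by linarith)]; exact this

theorem exponent_lt (hγ : RegularCurve p M γ) : 1 - 1 / p < 1 := by
  have := hγ.one_lt
  have : 0 < 1 / p := by positivity
  linarith

theorem continuous (hγ : RegularCurve p M γ) : Continuous γ :=
  continuous_iff_continuousAt.2 fun x => (hγ.hasDerivAt x).continuousAt

theorem continuous_deriv (hγ : RegularCurve p M γ) : Continuous (deriv γ) := hγ.isPrimitive.continuous

theorem deriv_periodic (hγ : RegularCurve p M γ) : Function.Periodic (deriv γ) (2 * π) :=
  hγ.periodic.deriv_periodic

theorem speed_pos (hγ : RegularCurve p M γ) (x : ℝ) : 0 < speed γ x :=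
  (inv_pos.2 hγ.M_pos).trans_le (hγ.le_speed x)

theorem inv_speed_le (hγ : RegularCurve p M γ) (x : ℝ) : (speed γ x)⁻¹ ≤ M :=
  inv_le_of_inv_le₀ hγ.M_pos (hγ.le_speed x)

theorem continuous_speed (hγ : RegularCurve p M γ) : Continuous (speed γ) := hγ.continuous_deriv.norm

theorem speed_periodic (hγ : RegularCurve p M γ) : Function.Periodic (speed γ) (2 * π) := fun x => by
  rw [speed, hγ.deriv_periodic]; rfl

theorem continuous_tangent (hγ : RegularCurve p M γ) : Continuous (tangent γ) :=
  (hγ.continuous_speed.inv₀ fun x => (hγ.speed_pos x).ne').smul hγ.continuous_deriv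

theorem tangent_periodic (hγ : RegularCurve p M γ) : Function.Periodic (tangent γ) (2 * π) :=
  fun x => by rw [tangent, hγ.deriv_periodic, hγ.speed_periodic]; rfl

theorem speed_smul_tangent (hγ : RegularCurve p M γ) (x : ℝ) :
    speed γ x • tangent γ x = deriv γ x := by
  rw [tangent, smul_smul, mul_inv_cancel₀ (hγ.speed_pos x).ne', one_smul]

theorem norm_tangent (hγ : RegularCurve p M γ) (x : ℝ) : ‖tangent γ x‖ = 1 := by
  rw [tangent, norm_smul, norm_inv, Real.norm_of_nonneg (hγ.speed_pos x).le]
  exact inv_mul_cancel₀ (hγ.speed_pos x).ne'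

theorem abs_speed_sub_le (γ : ℝ → Plane) (ξ η : ℝ) :
    |speed γ ξ - speed γ η| ≤ ‖deriv γ ξ - deriv γ η‖ := abs_norm_sub_norm_le _ _

theorem norm_tangent_sub_le (hγ : RegularCurve p M γ) (ξ η : ℝ) :
    ‖tangent γ ξ - tangent γ η‖ ≤ 2 * M * ‖deriv γ ξ - deriv γ η‖ := by
  have h1 := hγ.speed_pos ξ
  have h2 := hγ.speed_pos η
  have e : tangent γ ξ - tangent γ η = (speed γ ξ)⁻¹ • (deriv γ ξ - deriv γ η) +
      ((speed γ ξ)⁻¹ * (speed γ η - speed γ ξ)) • tangent γ η := by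
    rw [mul_sub, inv_mul_cancel₀ h1.ne', sub_smul, one_smul, mul_smul, hγ.speed_smul_tangent,
      smul_sub]
    simp only [tangent]; abel
  have h3 := abs_speed_sub_le γ η ξ
  rw [norm_sub_rev] at h3
  rw [e]
  refine (norm_add_le _ _).trans ?_
  rw [norm_smul, norm_smul, hγ.norm_tangent, mul_one, norm_mul, norm_inv,
    Real.norm_of_nonneg h1.le, Real.norm_eq_abs]
  have := hγ.inv_speed_le ξ
  have h0 : 0 ≤ (speed γ ξ)⁻¹ := by positivity
  nlinarith [norm_nonneg (deriv γ ξ - deriv γ η), mul_le_mul this h3 (abs_nonneg _) hγ.M_pos.le,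
    mul_le_mul_of_nonneg_right this (norm_nonneg (deriv γ ξ - deriv γ η))]

theorem norm_deriv_sub_le (hγ : RegularCurve p M γ) (ξ η : ℝ) :
    ‖deriv γ ξ - deriv γ η‖ ≤ M * torDist (ξ - η) ^ (1 - 1 / p) :=
  hγ.isPrimitive.norm_sub_le_torDist hγ.one_lt hγ.M_pos.le (measurable_deriv _) hγ.deriv_periodic
    hγ.deriv_periodic.deriv_periodic hγ.lintegral_le ξ η

theorem hasDerivAt_speed (hγ : RegularCurve p M γ) {b : Plane} {x : ℝ}
    (hb : HasDerivAt (deriv γ) b x) :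
    HasDerivAt (speed γ) (inner ℝ (deriv γ x) b / speed γ x) x := by
  have h1 := (hb.norm_sq).sqrt (pow_pos (hγ.speed_pos x) 2).ne'
  have h2 : (fun y => √(‖deriv γ y‖ ^ 2)) = speed γ := funext fun y => Real.sqrt_sq (norm_nonneg _)
  rw [h2, Real.sqrt_sq (norm_nonneg _)] at h1
  refine h1.congr_deriv ?_
  rw [mul_div_mul_left _ _ two_ne_zero]; rfl

theorem abs_deriv_speed_le (hγ : RegularCurve p M γ) {b : Plane} {x : ℝ} :
    |inner ℝ (deriv γ x) b / speed γ x| ≤ ‖b‖ := by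
  rw [abs_div, abs_of_pos (hγ.speed_pos x), div_le_iff₀ (hγ.speed_pos x), mul_comm]
  exact abs_real_inner_le_norm _ _

theorem isPrimitive_speed (hγ : RegularCurve p M γ) :
    IsPrimitive (speed γ) (deriv (speed γ)) ∧
      ∀ᵐ x, ‖deriv (speed γ) x‖ ≤ ‖deriv (deriv γ) x‖ := by
  have hb : ∀ᵐ x, ‖deriv (speed γ) x‖ ≤ ‖deriv (deriv γ) x‖ := by
    filter_upwards [hγ.isPrimitive.ae_hasDerivAt] with x hx
    rw [(hγ.hasDerivAt_speed hx).deriv, Real.norm_eq_abs]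
    exact hγ.abs_deriv_speed_le
  refine ⟨.of_absolutelyContinuous (fun a b => ?_) (fun a b => ?_) ?_, hb⟩
  · refine .of_dist_le 1 (hγ.isPrimitive.absolutelyContinuous a b) fun x _ y _ => ?_
    rw [one_mul, Real.dist_eq, dist_eq_norm]
    exact abs_speed_sub_le γ x y
  · exact (hγ.isPrimitive.integrable a b).norm.mono_fun (measurable_deriv _).aestronglyMeasurable
      (ae_restrict_of_ae (by filter_upwards [hb] with x hx; simpa using hx))
  · filter_upwards [hγ.isPrimitive.ae_hasDerivAt] with x hx
    exact (hγ.hasDerivAt_speed hx).differentiableAt.hasDerivAt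

theorem isPrimitive_tangent (hγ : RegularCurve p M γ) :
    IsPrimitive (tangent γ) (deriv (tangent γ)) ∧
      ∀ᵐ x, ‖deriv (tangent γ) x‖ ≤ 2 * M * ‖deriv (deriv γ) x‖ := by
  have hM := hγ.M_pos
  have hd : ∀ {x : ℝ} {b : Plane}, HasDerivAt (deriv γ) b x → HasDerivAt (tangent γ)
      ((speed γ x)⁻¹ • b + (-(inner ℝ (deriv γ x) b / speed γ x) / speed γ x ^ 2) • deriv γ x) x :=
    fun {x b} hx => ((hγ.hasDerivAt_speed hx).inv (hγ.speed_pos x).ne').smul hx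
  have hb : ∀ᵐ x, ‖deriv (tangent γ) x‖ ≤ 2 * M * ‖deriv (deriv γ) x‖ := by
    filter_upwards [hγ.isPrimitive.ae_hasDerivAt] with x hx
    rw [(hd hx).deriv]
    refine (norm_add_le _ _).trans ?_
    have h1 := hγ.speed_pos x
    have h2 := hγ.inv_speed_le x
    have h3 := hγ.abs_deriv_speed_le (b := deriv (deriv γ) x) (x := x)
    rw [norm_smul, norm_smul, norm_div, norm_neg, norm_pow, norm_inv, Real.norm_of_nonneg h1.le,
      Real.norm_eq_abs]
    change _ + _ * speed γ x ≤ _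
    have e : ∀ a : ℝ, a / speed γ x ^ 2 * speed γ x = a * (speed γ x)⁻¹ := fun a => by field_simp
    rw [e]
    nlinarith [norm_nonneg (deriv (deriv γ) x), mul_le_mul h3 h2 (by positivity) (norm_nonneg _),
      mul_le_mul_of_nonneg_right h2 (norm_nonneg (deriv (deriv γ) x))]
  refine ⟨.of_absolutelyContinuous (fun a b => ?_) (fun a b => ?_) ?_, hb⟩
  · refine .of_dist_le (2 * M) (hγ.isPrimitive.absolutelyContinuous a b) fun x _ y _ => ?_
    rw [dist_eq_norm, dist_eq_norm]
    exact hγ.norm_tangent_sub_le x y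
  · exact ((hγ.isPrimitive.integrable a b).norm.const_mul (2 * M)).mono_fun
      (measurable_deriv _).aestronglyMeasurable
      (ae_restrict_of_ae (by
        filter_upwards [hb] with x hx
        rwa [Real.norm_of_nonneg (by positivity)]))
  · filter_upwards [hγ.isPrimitive.ae_hasDerivAt] with x hx
    exact (hd hx).differentiableAt.hasDerivAt

/-- Differentiate `|T|² = 1`. Where `T` is not differentiable, `deriv` is `0` by convention, so the
identity holds at every point. -/
theorem inner_deriv_tangent (hγ : RegularCurve p M γ) (x : ℝ) :
    inner ℝ (deriv (tangent γ) x) (tangent γ x) = 0 := by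
  by_cases h : DifferentiableAt ℝ (tangent γ) x
  · have h1 := h.hasDerivAt.norm_sq
    have h2 : (fun y => ‖tangent γ y‖ ^ 2) = fun _ => 1 := funext fun y => by
      rw [hγ.norm_tangent, one_pow]
    rw [h2] at h1
    have := h1.unique (hasDerivAt_const x (1 : ℝ))
    rw [real_inner_comm]; linarith
  · rw [deriv_zero_of_not_differentiableAt h, inner_zero_left]

/-- `T` and `N` form an orthonormal basis and `∂_ξ T` is orthogonal to `T`, so it equals its normal
component. This removes curvature from the kernels in favour of `deriv (tangent γ)`. -/
theorem curvature_smul_normal (hγ : RegularCurve p M γ) (x : ℝ) :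
    (curvature γ x * speed γ x) • normal γ x = -deriv (tangent γ) x := by
  have h1 := hγ.inner_deriv_tangent x
  have h2 : ‖tangent γ x‖ ^ 2 = 1 := by rw [hγ.norm_tangent, one_pow]
  have hs := (hγ.speed_pos x).ne'
  rw [EuclideanSpace.norm_sq_eq, Fin.sum_univ_two] at h2
  simp only [PiLp.inner_apply, Fin.sum_univ_two, RCLike.inner_apply, conj_trivial] at h1
  simp only [Real.norm_eq_abs, sq_abs] at h2
  have hc : curvature γ x * speed γ x =
      -(deriv (tangent γ) x 0 * tangent γ x 1 - deriv (tangent γ) x 1 * tangent γ x 0) := by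
    rw [curvature, inner_smul_left, normal, Plane.perp]
    simp only [PiLp.inner_apply, Fin.sum_univ_two, RCLike.inner_apply, conj_trivial, PiLp.neg_apply,
      Matrix.cons_val_zero, Matrix.cons_val_one, Matrix.cons_val_fin_one]
    field_simp
    ring
  rw [hc, normal, Plane.perp]
  ext i
  fin_cases i
  · simp
    linear_combination (-deriv (tangent γ) x 0) * h2 + tangent γ x 0 * h1
  · simp
    linear_combination deriv (tangent γ) x 1 * h2 - tangent γ x 1 * h1

/-- Taylor's formula of first order. -/
theorem norm_taylor_le (hγ : RegularCurve p M γ) (ξ x : ℝ) :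
    ‖γ ξ - γ (ξ - x) - x • deriv γ ξ‖ ≤ M * |x| ^ (1 - 1 / p) * |x| := by
  have hα := hγ.exponent_pos
  have hd : ∀ s ∈ uIcc ξ (ξ - x), HasDerivWithinAt (fun s => γ s - s • deriv γ ξ)
      (deriv γ s - deriv γ ξ) (uIcc ξ (ξ - x)) s := fun s _ => by
    have := (hγ.hasDerivAt s).sub ((hasDerivAt_id s).smul_const (deriv γ ξ))
    rw [one_smul] at this
    exact this.hasDerivWithinAt
  have hb : ∀ s ∈ uIcc ξ (ξ - x), ‖deriv γ s - deriv γ ξ‖ ≤ M * |x| ^ (1 - 1 / p) := fun s hs => by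
    refine (hγ.norm_deriv_sub_le s ξ).trans ?_
    have h1 : |s - ξ| ≤ |x| := by
      have := abs_sub_left_of_mem_uIcc hs
      rwa [sub_sub_cancel_left, abs_neg] at this
    have := (torDist_le_abs (s - ξ)).trans h1
    have hM := hγ.M_pos
    gcongr
    exact torDist_nonneg _
  have := (convex_uIcc ξ (ξ - x)).norm_image_sub_le_of_norm_hasDerivWithin_le hd hb
    (right_mem_uIcc) (left_mem_uIcc)
  rw [sub_sub_cancel, Real.norm_eq_abs] at this
  refine le_trans (le_of_eq ?_) this
  congr 1
  rw [sub_smul]; abel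

theorem norm_sub_le_torDist (hγ : RegularCurve p M γ) (ξ η : ℝ) :
    ‖γ ξ - γ η‖ ≤ M * torDist (ξ - η) := by
  have key : ∀ x, ‖γ (η + x) - γ η‖ ≤ M * torDist x := by
    refine periodic_induction (fun x => by rw [← add_assoc, hγ.periodic, torDist_periodic])
      fun x hx => ?_
    rw [torDist_eq_abs hx]
    have := convex_univ.norm_image_sub_le_of_norm_hasDerivWithin_le (f := γ) (f' := deriv γ)
      (fun s _ => (hγ.hasDerivAt s).hasDerivWithinAt) (fun s _ => hγ.speed_le s)
      (mem_univ η) (mem_univ (η + x))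
    rwa [add_sub_cancel_left, Real.norm_eq_abs] at this
  have := key (ξ - η)
  rwa [add_sub_cancel] at this

end RegularCurve

/-! ### Regularized logarithmic potentials along a curve -/

/-- The squared chord, regularized by `s`. -/
noncomputable def regDenom (γ : ℝ → Plane) (s ξ η : ℝ) : ℝ := ‖γ ξ - γ η‖ ^ 2 + s

/-- The logarithmic potential of the density `f`, regularized by `s`. -/
noncomputable def logInt (γ : ℝ → Plane) (s : ℝ) (f : ℝ → Plane) (ξ : ℝ) : Plane :=
  ∫ η, (Real.log (regDenom γ s ξ η) / 2) • f η ∂torusMeasure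

/-- The antisymmetrized kernel of the derivative of the velocity. -/
noncomputable def crossKer (γ : ℝ → Plane) (s ξ η : ℝ) : Plane :=
  (regDenom γ s ξ η)⁻¹ • (inner ℝ (γ ξ - γ η) (deriv γ ξ) • deriv γ η -
    inner ℝ (γ ξ - γ η) (deriv γ η) • deriv γ ξ)

/-- A sequence of positive numbers tending to zero. -/
noncomputable def regSeq (n : ℕ) : ℝ := 1 / ((n : ℝ) + 1)

theorem regSeq_pos (n : ℕ) : 0 < regSeq n := Nat.one_div_pos_of_nat

theorem regSeq_le_one (n : ℕ) : regSeq n ≤ 1 := by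
  rw [regSeq, div_le_one (by positivity)]; linarith [(Nat.cast_nonneg n : (0 : ℝ) ≤ n)]

theorem tendsto_regSeq : Tendsto regSeq atTop (𝓝 0) := tendsto_one_div_add_atTop_nhds_zero_nat

theorem ae_prod_torDist_pos :
    ∀ᵐ z ∂torusMeasure.prod torusMeasure, 0 < torDist (z.1 - z.2) := by
  have hm : MeasurableSet {z : ℝ × ℝ | 0 < torDist (z.1 - z.2)} :=
    measurableSet_lt measurable_const
      (continuous_torDist.comp (continuous_fst.sub continuous_snd)).measurable
  exact (Measure.ae_prod_mem_iff_ae_ae_mem hm).2 (Eventually.of_forall fun x => ae_torDist_pos x)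

theorem integrable_torDist_prod {β : ℝ} (hβ : -1 < β) :
    Integrable (fun z : ℝ × ℝ => torDist (z.1 - z.2) ^ β) (torusMeasure.prod torusMeasure) := by
  have hper : Function.Periodic (fun x => torDist x ^ β) (2 * π) := fun x => by
    simp only [torDist_periodic x]
  have hm : Measurable fun z : ℝ × ℝ => torDist (z.1 - z.2) ^ β :=
    (continuous_torDist.comp (continuous_fst.sub continuous_snd)).measurable.pow_const _
  rw [integrable_prod_iff hm.aestronglyMeasurable]
  refine ⟨Eventually.of_forall fun x =>
    integrable_torus_sub_left hper (integrable_torDist_rpow hβ) x, ?_⟩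
  have : ∀ x, ∫ y, ‖torDist (x - y) ^ β‖ ∂torusMeasure = ∫ y, ‖torDist y ^ β‖ ∂torusMeasure :=
    fun x => integral_torus_sub_left (F := fun x => ‖torDist x ^ β‖)
      (fun x => by simp only [torDist_periodic x]) x
  simp_rw [this]
  exact integrable_const _

theorem tendsto_regDenom {γ : ℝ → Plane} {ξ η : ℝ} :
    Tendsto (fun n => regDenom γ (regSeq n) ξ η) atTop (𝓝 (regDenom γ 0 ξ η)) :=
  tendsto_const_nhds.add tendsto_regSeq

namespace RegularCurve

variable {p M : ℝ} {γ : ℝ → Plane} {f : ℝ → Plane}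

theorem chord_pos (hγ : RegularCurve p M γ) {ξ η : ℝ} (h : 0 < torDist (ξ - η)) :
    0 < ‖γ ξ - γ η‖ := by
  have h1 := hγ.torDist_le ξ η
  have := hγ.M_pos
  by_contra h0
  nlinarith [norm_nonneg (γ ξ - γ η)]

theorem regDenom_pos_of_pos (γ : ℝ → Plane) {s : ℝ} (hs : 0 < s) (ξ η : ℝ) :
    0 < regDenom γ s ξ η := by unfold regDenom; positivity

theorem regDenom_pos (hγ : RegularCurve p M γ) {s ξ η : ℝ} (hs : 0 ≤ s) (h : 0 < torDist (ξ - η)) :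
    0 < regDenom γ s ξ η := by
  have := hγ.chord_pos h
  unfold regDenom; positivity

theorem continuous_regDenom (hγ : RegularCurve p M γ) (s : ℝ) :
    Continuous fun z : ℝ × ℝ => regDenom γ s z.1 z.2 := by
  have := hγ.continuous
  unfold regDenom; fun_prop

/-- A uniform bound for the regularized logarithm. -/
theorem exists_abs_log_regDenom_le (p M : ℝ) {β : ℝ} (hβ : 0 < β) :
    ∃ C : ℝ, 0 ≤ C ∧ ∀ γ : ℝ → Plane, RegularCurve p M γ → ∀ s ξ η : ℝ, 0 ≤ s → s ≤ 1 →
      0 < torDist (ξ - η) →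
      |Real.log (regDenom γ s ξ η) / 2| ≤ C * torDist (ξ - η) ^ (-β) := by
  -- An upper bound for the regularized squared chord, since chords are at most `M π` and `s ≤ 1`.
  set L := M ^ 2 * π ^ 2 + 1 with hL
  set A := |Real.log L| * L ^ (β / 2) + 1 / (β / 2) with hA
  have hA0 : 0 ≤ A := by
    have : 0 ≤ L := by positivity
    positivity
  -- The absolute value makes the constant nonnegative before any curve is given; `M > 0` is known
  -- only from a curve.
  refine ⟨A * |M| ^ β, by positivity, fun γ hγ s ξ η hs hs1 ht => ?_⟩
  have hM := hγ.M_pos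
  rw [abs_of_pos hM]
  have hQ := hγ.regDenom_pos hs ht
  have hd := hγ.chord_pos ht
  have h1 := hγ.norm_sub_le_torDist ξ η
  have h2 := torDist_le_pi (ξ - η)
  have hQL : regDenom γ s ξ η ≤ L := by
    have : ‖γ ξ - γ η‖ ≤ M * π := h1.trans (by gcongr)
    have := pow_le_pow_left₀ hd.le this 2
    rw [mul_pow] at this
    rw [regDenom, hL]; linarith
  have h3 : |Real.log (regDenom γ s ξ η)| ≤ A * regDenom γ s ξ η ^ (-(β / 2)) :=
    abs_log_le_rpow_neg (half_pos hβ) hQ hQL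
  have h4 : (torDist (ξ - η) / M) ^ 2 ≤ regDenom γ s ξ η := by
    have h5 : torDist (ξ - η) / M ≤ ‖γ ξ - γ η‖ := by
      rw [div_le_iff₀ hM, mul_comm]; exact hγ.torDist_le ξ η
    have := pow_le_pow_left₀ (by positivity) h5 2
    rw [regDenom]; linarith
  have h5 : regDenom γ s ξ η ^ (-(β / 2)) ≤ M ^ β * torDist (ξ - η) ^ (-β) := by
    refine (Real.rpow_le_rpow_of_nonpos (by positivity) h4 (by linarith)).trans (le_of_eq ?_)
    rw [← Real.rpow_natCast, ← Real.rpow_mul (by positivity), Real.div_rpow ht.le hM.le]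
    have : ((2 : ℕ) : ℝ) * -(β / 2) = -β := by push_cast; ring
    rw [this, Real.rpow_neg hM.le, div_inv_eq_mul, mul_comm]
  rw [abs_div, abs_two]
  have h6 : A * regDenom γ s ξ η ^ (-(β / 2)) ≤ A * (M ^ β * torDist (ξ - η) ^ (-β)) := by gcongr
  rw [mul_assoc]
  have := abs_nonneg (Real.log (regDenom γ s ξ η))
  linarith

theorem measurable_log_regDenom (hγ : RegularCurve p M γ) (s ξ : ℝ) :
    Measurable fun η => Real.log (regDenom γ s ξ η) / 2 :=
  (((hγ.continuous_regDenom s).comp (by fun_prop : Continuous fun η : ℝ => (ξ, η))).measurable.log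
    ).div_const 2

theorem integrable_mul_torDist {p : ℝ} (hp : 1 < p) (hm : Measurable f)
    (hfin : ∫⁻ x, ‖f x‖ₑ ^ p ∂torusMeasure < ⊤) :
    ∃ β : ℝ, 0 < β ∧ β < 1 ∧
      ∀ x, Integrable (fun t => torDist (x - t) ^ (-β) * ‖f t‖) torusMeasure := by
  obtain ⟨β, hβ, hβ1, K, hK⟩ := exists_lintegral_mul_torDist_le hp
  refine ⟨β, hβ, hβ1, fun x => ⟨?_, ?_⟩⟩
  · exact (((continuous_torDist.measurable.comp
      (measurable_const.sub measurable_id)).pow_const _).mul hm.norm).aestronglyMeasurable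
  · rw [hasFiniteIntegral_iff_enorm]
    have e : ∀ t, ‖torDist (x - t) ^ (-β) * ‖f t‖‖ₑ =
        ‖f t‖ₑ * ENNReal.ofReal (torDist (x - t) ^ (-β)) := fun t => by
      rw [enorm_mul, enorm_norm, mul_comm, Real.enorm_eq_ofReal (Real.rpow_nonneg (torDist_nonneg _) _)]
    simp_rw [e]
    exact (hK _ hm.enorm x).trans_lt (ENNReal.mul_lt_top
      (ENNReal.rpow_lt_top_of_nonneg (by positivity) hfin.ne) ENNReal.coe_lt_top)

theorem integrable_logInt (hγ : RegularCurve p M γ) (hm : Measurable f)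
    (hfin : ∫⁻ x, ‖f x‖ₑ ^ p ∂torusMeasure < ⊤) {s : ℝ} (hs : 0 ≤ s) (hs1 : s ≤ 1) (ξ : ℝ) :
    Integrable (fun η => (Real.log (regDenom γ s ξ η) / 2) • f η) torusMeasure := by
  obtain ⟨β, hβ, -, hint⟩ := integrable_mul_torDist hγ.one_lt hm hfin
  obtain ⟨C, -, hCb⟩ := exists_abs_log_regDenom_le p M hβ
  refine ((hint ξ).const_mul C).mono'
    ((hγ.measurable_log_regDenom s ξ).smul hm).aestronglyMeasurable ?_
  filter_upwards [ae_torDist_pos ξ] with η hη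
  rw [norm_smul, Real.norm_eq_abs, ← mul_assoc]
  exact mul_le_mul_of_nonneg_right (hCb γ hγ s ξ η hs hs1 hη) (norm_nonneg _)

theorem tendsto_logInt (hγ : RegularCurve p M γ) (hm : Measurable f)
    (hfin : ∫⁻ x, ‖f x‖ₑ ^ p ∂torusMeasure < ⊤) (ξ : ℝ) :
    Tendsto (fun n => logInt γ (regSeq n) f ξ) atTop (𝓝 (logInt γ 0 f ξ)) := by
  obtain ⟨β, hβ, -, hint⟩ := integrable_mul_torDist hγ.one_lt hm hfin
  obtain ⟨C, -, hCb⟩ := exists_abs_log_regDenom_le p M hβ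
  refine tendsto_integral_of_dominated_convergence _ (fun n =>
    ((hγ.measurable_log_regDenom _ ξ).smul hm).aestronglyMeasurable) ((hint ξ).const_mul C)
    (fun n => ?_) ?_
  · filter_upwards [ae_torDist_pos ξ] with η hη
    rw [norm_smul, Real.norm_eq_abs, ← mul_assoc]
    exact mul_le_mul_of_nonneg_right
      (hCb γ hγ _ ξ η (regSeq_pos n).le (regSeq_le_one n) hη) (norm_nonneg _)
  · filter_upwards [ae_torDist_pos ξ] with η hη
    exact ((tendsto_regDenom.log
      (hγ.regDenom_pos le_rfl hη).ne').div_const 2).smul_const _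

theorem logInt_periodic (hγ : RegularCurve p M γ) (s : ℝ) (f : ℝ → Plane) :
    Function.Periodic (logInt γ s f) (2 * π) := fun ξ => by
  simp only [logInt, regDenom, hγ.periodic ξ]

theorem hasDerivAt_regDenom (hγ : RegularCurve p M γ) (s ξ η : ℝ) :
    HasDerivAt (fun ξ => regDenom γ s ξ η) (2 * inner ℝ (γ ξ - γ η) (deriv γ ξ)) ξ :=
  (((hγ.hasDerivAt ξ).sub_const (γ η)).norm_sq).add_const s

theorem hasDerivAt_regDenom_right (hγ : RegularCurve p M γ) (s ξ η : ℝ) :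
    HasDerivAt (fun η => regDenom γ s ξ η) (-(2 * inner ℝ (γ ξ - γ η) (deriv γ η))) η := by
  have := (((hγ.hasDerivAt η).const_sub (γ ξ)).norm_sq).add_const s
  refine this.congr_deriv ?_
  rw [inner_neg_right]; ring

theorem norm_chord_le (hγ : RegularCurve p M γ) (ξ η : ℝ) : ‖γ ξ - γ η‖ ≤ M * π :=
  (hγ.norm_sub_le_torDist ξ η).trans
    (mul_le_mul_of_nonneg_left (torDist_le_pi _) hγ.M_pos.le)

theorem norm_deriv_le (hγ : RegularCurve p M γ) (ξ : ℝ) : ‖deriv γ ξ‖ ≤ M := hγ.speed_le ξ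

theorem abs_inner_div_regDenom_le (hγ : RegularCurve p M γ) {s : ℝ} (hs : 0 < s) (ξ η : ℝ) {u : Plane}
    {K : ℝ} (hu : ‖u‖ ≤ K) : |inner ℝ (γ ξ - γ η) u / regDenom γ s ξ η| ≤ M * π * K / s := by
  have hQ := regDenom_pos_of_pos γ hs ξ η
  have hM := hγ.M_pos
  have hK : 0 ≤ K := (norm_nonneg u).trans hu
  rw [abs_div, abs_of_pos hQ]
  have h1 : |inner ℝ (γ ξ - γ η) u| ≤ M * π * K :=
    (abs_real_inner_le_norm _ _).trans (mul_le_mul (hγ.norm_chord_le ξ η) hu (norm_nonneg _)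
      (by positivity))
  refine div_le_div₀ (by positivity) h1 hs ?_
  rw [regDenom]; linarith [sq_nonneg ‖γ ξ - γ η‖]

/-- The increment of a regularized logarithmic potential. -/
theorem logInt_sub_eq (hγ : RegularCurve p M γ) (hm : Measurable f) (hi : Integrable f torusMeasure)
    (hfin : ∫⁻ x, ‖f x‖ₑ ^ p ∂torusMeasure < ⊤) {s : ℝ} (hs : 0 < s) (hs1 : s ≤ 1) {x : ℝ}
    (hx : x ∈ Icc 0 (2 * π)) :
    logInt γ s f x - logInt γ s f 0 = ∫ t in (0 : ℝ)..x,
      ∫ η, (inner ℝ (γ t - γ η) (deriv γ t) / regDenom γ s t η) • f η ∂torusMeasure := by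
  have hc1 := hγ.continuous
  have hc2 := hγ.continuous_deriv
  have hck : Continuous fun z : ℝ × ℝ =>
      inner ℝ (γ z.1 - γ z.2) (deriv γ z.1) / regDenom γ s z.1 z.2 :=
    Continuous.div (by fun_prop) (hγ.continuous_regDenom s)
      fun z => (regDenom_pos_of_pos γ hs _ _).ne'
  refine integral_sub_integral_eq (F := fun t η =>
    (inner ℝ (γ t - γ η) (deriv γ t) / regDenom γ s t η) • f η)
    (fun x _ => Eventually.of_forall fun η => ?_) ?_
    (fun x => hγ.integrable_logInt hm hfin hs.le hs1 x) hx
  · have hd : ∀ t, HasDerivAt (fun t => Real.log (regDenom γ s t η) / 2)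
        (inner ℝ (γ t - γ η) (deriv γ t) / regDenom γ s t η) t := fun t => by
      have := ((hγ.hasDerivAt_regDenom s t η).log (regDenom_pos_of_pos γ hs t η).ne').div_const 2
      refine this.congr_deriv ?_
      ring
    rw [← sub_smul, intervalIntegral.integral_smul_const,
      intervalIntegral.integral_eq_sub_of_hasDerivAt (fun t _ => hd t)]
    exact (hck.comp (by fun_prop : Continuous fun t : ℝ => (t, η))).intervalIntegrable _ _
  · have := (hi.comp_snd torusMeasure).bdd_smul (M * π * M / s) hck.aestronglyMeasurable
      (Eventually.of_forall fun z => hγ.abs_inner_div_regDenom_le hs z.1 z.2 (hγ.norm_deriv_le z.1))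
    exact this

/-- The numerator vanishes when both derivatives agree, so it is bounded by the chord times `|γ̇(ξ)
- γ̇(η)|`. The Hölder bound on `γ̇` and the chord-arc bound leave the power `t^{α-1}`, uniformly in
`s`. -/
theorem norm_crossKer_le (hγ : RegularCurve p M γ) {s : ℝ} (hs : 0 ≤ s) (ξ η : ℝ) :
    ‖crossKer γ s ξ η‖ ≤ 2 * M ^ 3 * torDist (ξ - η) ^ (1 - 1 / p - 1) := by
  have hM := hγ.M_pos
  have ht0 := torDist_nonneg (ξ - η)
  have hr : 0 ≤ torDist (ξ - η) ^ (1 - 1 / p - 1) := Real.rpow_nonneg ht0 _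
  rcases ht0.eq_or_lt with h0 | h0
  · have h1 := hγ.norm_sub_le_torDist ξ η
    rw [← h0, mul_zero, norm_le_zero_iff] at h1
    simp only [crossKer, h1, inner_zero_left, zero_smul, sub_zero, smul_zero, norm_zero]
    positivity
  have hd := hγ.chord_pos h0
  have hQ := hγ.regDenom_pos hs h0
  have hQd : ‖γ ξ - γ η‖ ^ 2 ≤ regDenom γ s ξ η := by rw [regDenom]; linarith
  have e : inner ℝ (γ ξ - γ η) (deriv γ ξ) • deriv γ η - inner ℝ (γ ξ - γ η) (deriv γ η) • deriv γ ξ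
      = inner ℝ (γ ξ - γ η) (deriv γ ξ - deriv γ η) • deriv γ η -
        inner ℝ (γ ξ - γ η) (deriv γ η) • (deriv γ ξ - deriv γ η) := by
    rw [inner_sub_right, sub_smul, smul_sub]; abel
  have hn : ‖inner ℝ (γ ξ - γ η) (deriv γ ξ) • deriv γ η -
      inner ℝ (γ ξ - γ η) (deriv γ η) • deriv γ ξ‖ ≤
      2 * M * ‖γ ξ - γ η‖ * ‖deriv γ ξ - deriv γ η‖ := by
    rw [e]
    refine (norm_sub_le _ _).trans ?_
    rw [norm_smul, norm_smul]
    have h1 := mul_le_mul (abs_real_inner_le_norm (γ ξ - γ η) (deriv γ ξ - deriv γ η))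
      (hγ.norm_deriv_le η) (norm_nonneg _) (by positivity)
    have h2 := mul_le_mul_of_nonneg_right ((abs_real_inner_le_norm (γ ξ - γ η) (deriv γ η)).trans
      (mul_le_mul_of_nonneg_left (hγ.norm_deriv_le η) hd.le)) (norm_nonneg (deriv γ ξ - deriv γ η))
    simp only [Real.norm_eq_abs]
    nlinarith
  rw [crossKer, norm_smul, norm_inv, Real.norm_of_nonneg hQ.le]
  have h3 : (regDenom γ s ξ η)⁻¹ ≤ (‖γ ξ - γ η‖ ^ 2)⁻¹ := inv_anti₀ (by positivity) hQd
  have h4 : ‖γ ξ - γ η‖⁻¹ ≤ M * (torDist (ξ - η))⁻¹ := by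
    rw [inv_le_comm₀ hd (by positivity), mul_inv, inv_inv, inv_mul_le_iff₀ hM]
    exact hγ.torDist_le ξ η
  calc (regDenom γ s ξ η)⁻¹ * _
      ≤ (‖γ ξ - γ η‖ ^ 2)⁻¹ * (2 * M * ‖γ ξ - γ η‖ * ‖deriv γ ξ - deriv γ η‖) :=
        mul_le_mul h3 hn (norm_nonneg _) (by positivity)
    _ = 2 * M * ‖γ ξ - γ η‖⁻¹ * ‖deriv γ ξ - deriv γ η‖ := by field_simp
    _ ≤ 2 * M * (M * (torDist (ξ - η))⁻¹) * (M * torDist (ξ - η) ^ (1 - 1 / p)) := by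
        gcongr
        exact hγ.norm_deriv_sub_le ξ η
    _ = 2 * M ^ 3 * torDist (ξ - η) ^ (1 - 1 / p - 1) := by
        rw [Real.rpow_sub_one h0.ne']; field_simp

theorem measurable_crossKer (hγ : RegularCurve p M γ) (s : ℝ) :
    Measurable fun z : ℝ × ℝ => crossKer γ s z.1 z.2 := by
  have hc1 := hγ.continuous
  have hc2 := hγ.continuous_deriv
  have h1 : Continuous fun z : ℝ × ℝ => inner ℝ (γ z.1 - γ z.2) (deriv γ z.1) • deriv γ z.2 -
    inner ℝ (γ z.1 - γ z.2) (deriv γ z.2) • deriv γ z.1 := by fun_prop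
  exact ((hγ.continuous_regDenom s).measurable.inv).smul h1.measurable

/-- The integrand is the `η`-derivative of the periodic function `-(log Q_s) / 2`. -/
theorem integral_inner_deriv_div_regDenom (hγ : RegularCurve p M γ) {s : ℝ} (hs : 0 < s) (ξ : ℝ) :
    ∫ η, inner ℝ (γ ξ - γ η) (deriv γ η) / regDenom γ s ξ η ∂torusMeasure = 0 := by
  have hc1 := hγ.continuous
  have hc2 := hγ.continuous_deriv
  have hq := (hγ.continuous_regDenom s).comp (by fun_prop : Continuous fun η : ℝ => (ξ, η))
  have hd : ∀ t, HasDerivAt (fun t => -(Real.log (regDenom γ s ξ t) / 2))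
      (inner ℝ (γ ξ - γ t) (deriv γ t) / regDenom γ s ξ t) t := fun t => by
    have := (((hγ.hasDerivAt_regDenom_right s ξ t).log
      (regDenom_pos_of_pos γ hs ξ t).ne').div_const 2).neg
    refine this.congr_deriv ?_
    ring
  refine (isPrimitive_of_hasDerivAt hd (Continuous.div (by fun_prop) hq
    fun t => (regDenom_pos_of_pos γ hs _ _).ne')).integral_torus_eq_zero fun x => ?_
  simp only [regDenom, hγ.periodic x]

/-- The term that makes `crossKer` weakly singular is a constant vector times an integral that
vanishes. Adding it therefore costs nothing as long as `s > 0`. -/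
theorem integral_crossKer_eq (hγ : RegularCurve p M γ) {s : ℝ} (hs : 0 < s) (ξ : ℝ) :
    ∫ η, crossKer γ s ξ η ∂torusMeasure =
      ∫ η, (inner ℝ (γ ξ - γ η) (deriv γ ξ) / regDenom γ s ξ η) • deriv γ η ∂torusMeasure := by
  have hc1 := hγ.continuous
  have hc2 := hγ.continuous_deriv
  have hq := (hγ.continuous_regDenom s).comp (by fun_prop : Continuous fun η : ℝ => (ξ, η))
  have i1 : Continuous fun η => (inner ℝ (γ ξ - γ η) (deriv γ ξ) / regDenom γ s ξ η) • deriv γ η :=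
    (Continuous.div (by fun_prop) hq fun t => (regDenom_pos_of_pos γ hs _ _).ne').smul hc2
  have i2 : Continuous fun η => (inner ℝ (γ ξ - γ η) (deriv γ η) / regDenom γ s ξ η) • deriv γ ξ :=
    (Continuous.div (by fun_prop) hq fun t => (regDenom_pos_of_pos γ hs _ _).ne').smul
      continuous_const
  have e : ∀ η, crossKer γ s ξ η =
      (inner ℝ (γ ξ - γ η) (deriv γ ξ) / regDenom γ s ξ η) • deriv γ η -
      (inner ℝ (γ ξ - γ η) (deriv γ η) / regDenom γ s ξ η) • deriv γ ξ := fun η => by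
    rw [crossKer, smul_sub, smul_smul, smul_smul, div_eq_inv_mul, div_eq_inv_mul]
  simp_rw [e]
  rw [integral_sub i1.integrable_torus i2.integrable_torus, integral_smul_const,
    hγ.integral_inner_deriv_div_regDenom hs, zero_smul, sub_zero]

theorem lintegral_deriv_lt_top (hγ : RegularCurve p M γ) :
    ∫⁻ x, ‖deriv γ x‖ₑ ^ p ∂torusMeasure < ⊤ := by
  have hp : 0 ≤ p := by linarith [hγ.one_lt]
  have h : ∀ x, ‖deriv γ x‖ₑ ^ p ≤ ENNReal.ofReal M ^ p := fun x => by
    refine ENNReal.rpow_le_rpow ?_ hp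
    rw [← ofReal_norm]
    exact ENNReal.ofReal_le_ofReal (hγ.norm_deriv_le x)
  refine (lintegral_mono h).trans_lt ?_
  rw [lintegral_const]
  exact ENNReal.mul_lt_top (ENNReal.rpow_lt_top_of_nonneg hp (by simp)) (measure_lt_top _ _)

theorem velocity_eq (γ : ℝ → Plane) : velocity γ = logInt γ 0 (deriv γ) := by
  ext1 ξ
  simp only [velocity, velocityKernel, logInt, regDenom, add_zero, Real.log_pow]
  congr 1 with η
  push_cast
  rw [mul_div_cancel_left₀ _ two_ne_zero]

theorem exponent_gt (hγ : RegularCurve p M γ) : -1 < 1 - 1 / p - 1 := by linarith [hγ.exponent_pos]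

theorem tendsto_crossKer (hγ : RegularCurve p M γ) {ξ η : ℝ} (h : 0 < torDist (ξ - η)) :
    Tendsto (fun n => crossKer γ (regSeq n) ξ η) atTop (𝓝 (crossKer γ 0 ξ η)) :=
  (tendsto_regDenom.inv₀ (hγ.regDenom_pos le_rfl h).ne').smul_const _

/-- The derivative of the velocity. -/
theorem isPrimitive_velocity (hγ : RegularCurve p M γ) :
    IsPrimitive (velocity γ) (fun ξ => ∫ η, crossKer γ 0 ξ η ∂torusMeasure) := by
  rw [velocity_eq]
  have hm : Measurable (deriv γ) := hγ.continuous_deriv.measurable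
  have hfin := hγ.lintegral_deriv_lt_top
  -- The majorant comes from the bound on `crossKer`, which is uniform in the regularization.
  refine (isPrimitive_of_tendsto_integral (F := fun n ξ η => crossKer γ (regSeq n) ξ η)
    (G := fun n => logInt γ (regSeq n) (deriv γ))
    (B := fun ξ η => 2 * M ^ 3 * torDist (ξ - η) ^ (1 - 1 / p - 1)) (fun n x hx => ?_)
    (fun n => (hγ.measurable_crossKer _).aestronglyMeasurable)
    ((integrable_torDist_prod hγ.exponent_gt).const_mul _)
    (fun n => Eventually.of_forall fun z => hγ.norm_crossKer_le (regSeq_pos n).le _ _) ?_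
    (fun x => hγ.tendsto_logInt hm hfin x) (hγ.logInt_periodic _ _) ?_).1
  · rw [hγ.logInt_sub_eq hm hγ.continuous_deriv.integrable_torus hfin (regSeq_pos n)
      (regSeq_le_one n) hx]
    simp_rw [hγ.integral_crossKer_eq (regSeq_pos n)]
  · filter_upwards [ae_prod_torDist_pos] with z hz using hγ.tendsto_crossKer hz
  · intro x η
    simp only [crossKer, regDenom, hγ.periodic x, hγ.deriv_periodic x]

theorem integrable_torDist_sub {β : ℝ} (hβ : -1 < β) (ξ : ℝ) :
    Integrable (fun η => torDist (ξ - η) ^ β) torusMeasure :=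
  integrable_torus_sub_left (F := fun x => torDist x ^ β)
    (fun x => by simp only [torDist_periodic x]) (integrable_torDist_rpow hβ) ξ

theorem integrable_crossKer (hγ : RegularCurve p M γ) {s : ℝ} (hs : 0 ≤ s) (ξ : ℝ) :
    Integrable (crossKer γ s ξ) torusMeasure :=
  ((integrable_torDist_sub hγ.exponent_gt ξ).const_mul _).mono'
    ((hγ.measurable_crossKer s).comp measurable_prodMk_left).aestronglyMeasurable
    (Eventually.of_forall fun η => hγ.norm_crossKer_le hs ξ η)

theorem norm_integral_crossKer_le (hγ : RegularCurve p M γ) (ξ : ℝ) :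
    ‖∫ η, crossKer γ 0 ξ η ∂torusMeasure‖ ≤
      2 * M ^ 3 * ∫ x, torDist x ^ (1 - 1 / p - 1) ∂torusMeasure := by
  refine (norm_integral_le_of_norm_le ((integrable_torDist_sub hγ.exponent_gt ξ).const_mul _)
    (Eventually.of_forall fun η => hγ.norm_crossKer_le le_rfl ξ η)).trans (le_of_eq ?_)
  rw [integral_const_mul, integral_torus_sub_left (F := fun x => torDist x ^ (1 - 1 / p - 1))
    (fun x => by simp only [torDist_periodic x])]

theorem tendsto_integral_crossKer (hγ : RegularCurve p M γ) (ξ : ℝ) :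
    Tendsto (fun n => ∫ η, crossKer γ (regSeq n) ξ η ∂torusMeasure) atTop
      (𝓝 (∫ η, crossKer γ 0 ξ η ∂torusMeasure)) :=
  tendsto_integral_of_dominated_convergence _
    (fun n => (hγ.integrable_crossKer (regSeq_pos n).le ξ).aestronglyMeasurable)
    ((integrable_torDist_sub hγ.exponent_gt ξ).const_mul (2 * M ^ 3))
    (fun n => Eventually.of_forall fun η => hγ.norm_crossKer_le (regSeq_pos n).le ξ η)
    (by filter_upwards [ae_torDist_pos ξ] with η hη using hγ.tendsto_crossKer hη)

end RegularCurve

/-! ### Principal values along a curve -/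

section PVDomain

variable {E : Type*} [NormedAddCommGroup E]

theorem pvDomain_subset (ξ ε : ℝ) : pvDomain ξ ε ⊆ Ioc (ξ - π) (ξ + π) := fun _ h => h.1

theorem le_torDist_of_mem_pvDomain {ξ ε η : ℝ} (h : η ∈ pvDomain ξ ε) : ε ≤ torDist (ξ - η) := by
  rw [torDist_eq_abs (abs_sub_le_pi_of_mem h.1)]; exact h.2

theorem integrableOn_pvDomain_smul [NormedSpace ℝ E] {f : ℝ → E} {k : ℝ → ℝ} {ξ ε C : ℝ}
    (hf : IntegrableOn f (Ioc (ξ - π) (ξ + π))) (hk : Measurable k)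
    (hC : ∀ η ∈ pvDomain ξ ε, |k η| ≤ C) : IntegrableOn (fun η => k η • f η) (pvDomain ξ ε) :=
  (hf.mono_set (pvDomain_subset ξ ε)).bdd_smul C hk.aestronglyMeasurable
    ((ae_restrict_iff' (measurableSet_pvDomain ξ ε)).2 (Eventually.of_forall hC))

theorem integral_pvDomain_eq [NormedSpace ℝ E] {F : ℝ → E} {ξ ε : ℝ} (hε : 0 < ε) (hεπ : ε ≤ π)
    (hF : IntegrableOn F (pvDomain ξ ε)) :
    ∫ η in pvDomain ξ ε, F η = (∫ η in (ξ - π)..(ξ - ε), F η) + ∫ η in (ξ + ε)..(ξ + π), F η := by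
  have e : pvDomain ξ ε = Ioc (ξ - π) (ξ - ε) ∪ Icc (ξ + ε) (ξ + π) := by
    ext η
    simp only [pvDomain, mem_ofPred_eq, mem_union, mem_Ioc, mem_Icc, le_abs]
    constructor
    · rintro ⟨⟨h1, h2⟩, h3 | h3⟩
      · left; constructor <;> linarith
      · right; constructor <;> linarith
    · rintro (⟨h1, h2⟩ | ⟨h1, h2⟩)
      · refine ⟨⟨?_, ?_⟩, Or.inl ?_⟩ <;> linarith
      · refine ⟨⟨?_, ?_⟩, Or.inr ?_⟩ <;> linarith
  rw [e] at hF ⊢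
  rw [setIntegral_union _ measurableSet_Icc (hF.mono_set subset_union_left)
    (hF.mono_set subset_union_right), integral_Icc_eq_integral_Ioc,
    intervalIntegral.integral_of_le (by linarith), intervalIntegral.integral_of_le (by linarith)]
  rw [Set.disjoint_left]
  intro η h1 h2
  linarith [h1.2, h2.1]

theorem tendsto_integral_pvDomain [NormedSpace ℝ E] {F : ℝ → E} {ξ : ℝ}
    (hF : IntegrableOn F (Ioc (ξ - π) (ξ + π))) :
    Tendsto (fun ε => ∫ η in pvDomain ξ ε, F η) (𝓝[>] 0) (𝓝 (∫ η in Ioc (ξ - π) (ξ + π), F η)) := by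
  have hm : ∀ ε : ℝ, MeasurableSet {η : ℝ | ε ≤ |ξ - η|} := fun ε =>
    measurableSet_le measurable_const (by fun_prop : Measurable fun η => |ξ - η|)
  have e : ∀ ε, ∫ η in pvDomain ξ ε, F η =
      ∫ η in Ioc (ξ - π) (ξ + π), {η : ℝ | ε ≤ |ξ - η|}.indicator F η := fun ε => by
    have : pvDomain ξ ε = Ioc (ξ - π) (ξ + π) ∩ {η | ε ≤ |ξ - η|} := rfl
    rw [this, ← setIntegral_indicator (hm ε)]
  simp_rw [e]
  refine tendsto_integral_filter_of_dominated_convergence (fun η => ‖F η‖)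
    (Eventually.of_forall fun ε => hF.aestronglyMeasurable.indicator (hm ε))
    (Eventually.of_forall fun ε => Eventually.of_forall fun η => norm_indicator_le_norm_self _ _)
    hF.norm ?_
  have hne : ∀ᵐ η ∂volume.restrict (Ioc (ξ - π) (ξ + π)), η ≠ ξ :=
    ae_restrict_of_ae (by simp [ae_iff])
  filter_upwards [hne] with η hη
  refine tendsto_const_nhds.congr' ?_
  have h0 : 0 < |ξ - η| := abs_pos.2 (sub_ne_zero.2 hη.symm)
  filter_upwards [mem_nhdsWithin_of_mem_nhds (Iic_mem_nhds h0)] with ε hε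
  rw [indicator_of_mem]
  exact hε

end PVDomain

namespace RegularCurve

variable {p M : ℝ} {γ : ℝ → Plane} {f : ℝ → Plane}

theorem inv_norm_sub_le (hγ : RegularCurve p M γ) {ξ η : ℝ} (h : 0 < torDist (ξ - η)) :
    ‖γ ξ - γ η‖⁻¹ ≤ M * (torDist (ξ - η))⁻¹ := by
  have hM := hγ.M_pos
  rw [inv_le_comm₀ (hγ.chord_pos h) (by positivity), mul_inv, inv_inv, inv_mul_le_iff₀ hM]
  exact hγ.torDist_le ξ η

theorem abs_inner_div_sq_le (hγ : RegularCurve p M γ) {ξ η : ℝ} (h : 0 < torDist (ξ - η)) (u : Plane) :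
    |inner ℝ (γ ξ - γ η) u / ‖γ ξ - γ η‖ ^ 2| ≤ M * (torDist (ξ - η))⁻¹ * ‖u‖ := by
  have hd := hγ.chord_pos h
  rw [abs_div, abs_of_pos (pow_pos hd 2)]
  calc _ ≤ ‖γ ξ - γ η‖ * ‖u‖ / ‖γ ξ - γ η‖ ^ 2 := by gcongr; exact abs_real_inner_le_norm _ _
    _ = ‖γ ξ - γ η‖⁻¹ * ‖u‖ := by field_simp
    _ ≤ _ := by gcongr; exact hγ.inv_norm_sub_le h

theorem abs_inner_div_sq_le_of_mem (hγ : RegularCurve p M γ) {ξ η ε : ℝ} (hε : 0 < ε)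
    (h : η ∈ pvDomain ξ ε) (u : Plane) :
    |inner ℝ (γ ξ - γ η) u / ‖γ ξ - γ η‖ ^ 2| ≤ M * ε⁻¹ * ‖u‖ := by
  have h1 := le_torDist_of_mem_pvDomain h
  have hM := hγ.M_pos
  refine (hγ.abs_inner_div_sq_le (hε.trans_le h1) u).trans ?_
  gcongr

theorem measurable_inner_div_sq (hγ : RegularCurve p M γ) (ξ : ℝ) (u : Plane) :
    Measurable fun η => inner ℝ (γ ξ - γ η) u / ‖γ ξ - γ η‖ ^ 2 := by
  have h := hγ.continuous.measurable
  exact (Measurable.inner (measurable_const.sub h) measurable_const).div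
    ((measurable_const.sub h).norm.pow_const 2)

/-- The difference quotient of `γ` at `ξ` has limiting norm equal to the speed from either side.
Hence the logarithms of the two opposite chords at label distance `ε` have the same asymptotics. -/
theorem tendsto_log_chord (hγ : RegularCurve p M γ) (ξ : ℝ) {σ : ℝ} (hσ : |σ| = 1) :
    Tendsto (fun ε => Real.log ‖γ ξ - γ (ξ + σ * ε)‖ - Real.log ε) (𝓝[>] 0)
      (𝓝 (Real.log (speed γ ξ))) := by
  have h0 : HasDerivAt (fun ε => γ (ξ + σ * ε)) (σ • deriv γ ξ) 0 := by
    have h1 : HasDerivAt (fun ε : ℝ => ξ + σ * ε) σ 0 := by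
      simpa using ((hasDerivAt_id (0 : ℝ)).const_mul σ).const_add ξ
    have h2 : HasDerivAt γ (deriv γ ξ) (ξ + σ * 0) := by
      rw [mul_zero, add_zero]; exact hγ.hasDerivAt ξ
    exact h2.scomp 0 h1
  have h1 := (hasDerivAt_iff_tendsto_slope_zero.1 h0).mono_left
    (nhdsWithin_mono 0 (fun x (hx : 0 < x) => hx.ne') : 𝓝[>] (0 : ℝ) ≤ 𝓝[≠] 0)
  have h2 : ‖σ • deriv γ ξ‖ = speed γ ξ := by
    rw [norm_smul, Real.norm_eq_abs, hσ, one_mul]; rfl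
  have h3 := h1.norm.log (by rw [h2]; exact (hγ.speed_pos ξ).ne')
  rw [h2] at h3
  refine h3.congr' ?_
  have hlt : Iio π ∈ 𝓝[>] (0 : ℝ) := mem_nhdsWithin_of_mem_nhds (Iio_mem_nhds Real.pi_pos)
  filter_upwards [self_mem_nhdsWithin, hlt] with ε hε hεπ
  have hε0 : 0 < ε := hε
  have ht : 0 < torDist (ξ - (ξ + σ * ε)) := by
    have : |ξ - (ξ + σ * ε)| = ε := by
      rw [sub_add_cancel_left, abs_neg, abs_mul, hσ, one_mul, abs_of_pos hε0]
    rw [torDist_eq_abs (by rw [this]; exact le_of_lt hεπ), this]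
    exact hε0
  have hd := hγ.chord_pos ht
  simp only [zero_add, mul_zero, add_zero]
  rw [norm_smul, norm_inv, Real.norm_of_nonneg hε0.le, norm_sub_rev,
    Real.log_mul (inv_pos.2 hε0).ne' hd.ne', Real.log_inv]
  ring

theorem hasDerivAt_log_chord_right (hγ : RegularCurve p M γ) {ξ η : ℝ} (h : 0 < torDist (ξ - η)) :
    HasDerivAt (fun η => -Real.log ‖γ ξ - γ η‖)
      (inner ℝ (γ ξ - γ η) (deriv γ η) / ‖γ ξ - γ η‖ ^ 2) η := by
  have hd := hγ.chord_pos h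
  have hQ := hγ.regDenom_pos (s := 0) le_rfl h
  have h1 := (((hγ.hasDerivAt_regDenom_right 0 ξ η).log hQ.ne').div_const 2).neg
  have e : (fun η => -(Real.log (regDenom γ 0 ξ η) / 2)) = fun η => -Real.log ‖γ ξ - γ η‖ := by
    funext η
    rw [regDenom, add_zero, Real.log_pow]; push_cast; ring
  have h2 : HasDerivAt (fun η => -(Real.log (regDenom γ 0 ξ η) / 2)) _ η := h1
  rw [e] at h2
  refine h2.congr_deriv ?_
  rw [regDenom, add_zero]; ring

/-- By the fundamental theorem on both sides of `ξ`, the truncated integral is the logarithm of the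
quotient of the chords to `ξ + ε` and `ξ - ε`. The contributions at `ξ ± π` cancel by periodicity.
-/
theorem tendsto_integral_inner_deriv (hγ : RegularCurve p M γ) (ξ : ℝ) :
    Tendsto (fun ε => ∫ η in pvDomain ξ ε, inner ℝ (γ ξ - γ η) (deriv γ η) / ‖γ ξ - γ η‖ ^ 2)
      (𝓝[>] 0) (𝓝 0) := by
  have h1 := (hγ.tendsto_log_chord ξ (σ := 1) (by simp)).sub
    (hγ.tendsto_log_chord ξ (σ := -1) (by simp))
  rw [sub_self] at h1
  refine h1.congr' ?_
  have hlt : Iio π ∈ 𝓝[>] (0 : ℝ) := mem_nhdsWithin_of_mem_nhds (Iio_mem_nhds Real.pi_pos)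
  filter_upwards [self_mem_nhdsWithin, hlt] with ε hε hεπ
  have hε0 : 0 < ε := hε
  have hεπ' : ε < π := hεπ
  have hc1 := hγ.continuous
  have hc2 := hγ.continuous_deriv
  have hpos : ∀ η, ε ≤ |ξ - η| → |ξ - η| ≤ π → 0 < torDist (ξ - η) := fun η h1 h2 => by
    rw [torDist_eq_abs h2]; exact hε0.trans_le h1
  have hpv : IntegrableOn (fun η => inner ℝ (γ ξ - γ η) (deriv γ η) / ‖γ ξ - γ η‖ ^ 2)
      (pvDomain ξ ε) := by
    have hm : Measurable fun η => inner ℝ (γ ξ - γ η) (deriv γ η) / ‖γ ξ - γ η‖ ^ 2 :=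
      (Measurable.inner (measurable_const.sub hc1.measurable) hc2.measurable).div
        ((measurable_const.sub hc1.measurable).norm.pow_const 2)
    have hfin : IsFiniteMeasure (volume.restrict (pvDomain ξ ε)) :=
      ⟨by rw [Measure.restrict_apply_univ]; exact (measure_mono (pvDomain_subset ξ ε)).trans_lt
            (by simp)⟩
    refine Integrable.of_bound hm.aestronglyMeasurable (M * ε⁻¹ * M)
      ((ae_restrict_iff' (measurableSet_pvDomain ξ ε)).2 (Eventually.of_forall fun η hη => ?_))
    have hM := hγ.M_pos
    refine (hγ.abs_inner_div_sq_le_of_mem hε0 hη _).trans ?_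
    gcongr
    exact hγ.norm_deriv_le η
  have hftc : ∀ a b : ℝ, a ≤ b → (∀ η ∈ Icc a b, ε ≤ |ξ - η| ∧ |ξ - η| ≤ π) →
      ∫ η in a..b, inner ℝ (γ ξ - γ η) (deriv γ η) / ‖γ ξ - γ η‖ ^ 2 =
        -Real.log ‖γ ξ - γ b‖ - -Real.log ‖γ ξ - γ a‖ := by
    intro a b hab h
    rw [← uIcc_of_le hab] at h
    refine intervalIntegral.integral_eq_sub_of_hasDerivAt (f := fun η => -Real.log ‖γ ξ - γ η‖)
      (fun η hη => hγ.hasDerivAt_log_chord_right (hpos η (h η hη).1 (h η hη).2)) ?_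
    refine ContinuousOn.intervalIntegrable (ContinuousOn.div (by fun_prop) (by fun_prop)
      fun η hη => ?_)
    exact (pow_pos (hγ.chord_pos (hpos η (h η hη).1 (h η hη).2)) 2).ne'
  have hper : γ (ξ + π) = γ (ξ - π) := by
    rw [← hγ.periodic (ξ - π)]; congr 1; ring
  rw [integral_pvDomain_eq hε0 hεπ'.le hpv, hftc _ _ (by linarith) fun η hη => ?_,
    hftc _ _ (by linarith) fun η hη => ?_, hper]
  · rw [one_mul, neg_one_mul, ← sub_eq_add_neg]; ring
  · have : ξ - η ≤ 0 := by linarith [hη.1]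
    rw [abs_of_nonpos this]; constructor <;> linarith [hη.1, hη.2]
  · have : 0 ≤ ξ - η := by linarith [hη.2]
    rw [abs_of_nonneg this]; constructor <;> linarith [hη.1, hη.2]

theorem firstKernel_eq (hγ : RegularCurve p M γ) (ξ η : ℝ) : firstKernel γ ξ η =
    (inner ℝ (γ ξ - γ η) (tangent γ ξ) / ‖γ ξ - γ η‖ ^ 2) • deriv γ η := by
  rw [firstKernel, mul_smul, hγ.speed_smul_tangent]

theorem crossKer_periodic_right (hγ : RegularCurve p M γ) (s ξ : ℝ) :
    Function.Periodic (crossKer γ s ξ) (2 * π) := fun η => by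
  simp only [crossKer, regDenom, hγ.periodic η, hγ.deriv_periodic η]

/-- The kernel is `g(ξ)⁻¹` times `crossKer`, which is integrable, plus the `η`-derivative kernel
times `T(ξ)`, whose principal value is zero. Both facts hold at every `ξ`. -/
theorem hasPVIntegral_firstKernel (hγ : RegularCurve p M γ) (ξ : ℝ) :
    HasPVIntegral (firstKernel γ ξ) ξ ((speed γ ξ)⁻¹ • ∫ η, crossKer γ 0 ξ η ∂torusMeasure) := by
  have hM := hγ.M_pos
  have hDI : ∀ ξ, IntegrableOn (deriv γ) (Ioc (ξ - π) (ξ + π)) := fun ξ =>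
    hγ.continuous_deriv.integrableOn_Icc.mono_set Ioc_subset_Icc_self
  have hF : ∀ ε : ℝ, 0 < ε → IntegrableOn (firstKernel γ ξ) (pvDomain ξ ε) := fun ε hε => by
    have : firstKernel γ ξ = fun η =>
        (inner ℝ (γ ξ - γ η) (tangent γ ξ) / ‖γ ξ - γ η‖ ^ 2) • deriv γ η :=
      funext (hγ.firstKernel_eq ξ)
    rw [this]
    exact integrableOn_pvDomain_smul (hDI ξ) (hγ.measurable_inner_div_sq ξ _)
      fun η hη => hγ.abs_inner_div_sq_le_of_mem hε hη _
  refine ⟨hF, ?_⟩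
  have hC : IntegrableOn (crossKer γ 0 ξ) (Ioc (ξ - π) (ξ + π)) :=
    (integrable_torus_iff_Ioc_centered (hγ.crossKer_periodic_right 0 ξ) ξ).1
      (hγ.integrable_crossKer le_rfl ξ)
  have t1 := (tendsto_integral_pvDomain hC).const_smul (speed γ ξ)⁻¹
  rw [← integral_torus_eq_Ioc_centered (hγ.crossKer_periodic_right 0 ξ)] at t1
  have t2 := (hγ.tendsto_integral_inner_deriv ξ).smul_const (tangent γ ξ)
  have t3 := t1.add t2
  rw [zero_smul, add_zero] at t3
  refine t3.congr' ?_
  filter_upwards [self_mem_nhdsWithin] with ε hε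
  have e : ∀ η, (inner ℝ (γ ξ - γ η) (deriv γ η) / ‖γ ξ - γ η‖ ^ 2) • tangent γ ξ =
      firstKernel γ ξ η - (speed γ ξ)⁻¹ • crossKer γ 0 ξ η := fun η => by
    rw [hγ.firstKernel_eq, crossKer, regDenom, add_zero, smul_comm (speed γ ξ)⁻¹, smul_sub,
      smul_comm (speed γ ξ)⁻¹ (inner ℝ (γ ξ - γ η) (deriv γ η))]
    simp only [tangent, inner_smul_right, smul_smul, smul_sub]
    module
  have hCe : IntegrableOn (fun η => (speed γ ξ)⁻¹ • crossKer γ 0 ξ η) (pvDomain ξ ε) :=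
    Integrable.smul (speed γ ξ)⁻¹ (hC.mono_set (pvDomain_subset ξ ε))
  rw [← integral_smul_const]
  simp_rw [e]
  rw [integral_sub (hF ε hε) hCe, integral_smul]
  abel

end RegularCurve

/-! ### Comparison of a curve with the circle -/

section Circle

/-- The kernel is `cot (x/2) / 2` and odd, so `x > 0` may be assumed. With `y = x/2` the estimate
reduces to `y cos y ≤ sin y ≤ y` and `1 - cos y ≤ sin y`. -/
theorem abs_conjKer_one_sub_inv_le {x : ℝ} (hx0 : x ≠ 0) (hx : |x| ≤ π) :
    |conjKer 1 x - x⁻¹| ≤ 1 := by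
  wlog h : 0 < x generalizing x
  · have h1 := this (x := -x) (neg_ne_zero.2 hx0) (by rwa [abs_neg])
      (by rcases lt_or_gt_of_ne hx0 with h' | h' <;> [linarith; exact absurd h' h])
    rw [conjKer_neg, inv_neg, ← neg_sub', abs_neg] at h1
    exact h1
  rw [abs_of_pos h] at hx
  set y := x / 2 with hy
  have hxy : x = 2 * y := by rw [hy]; ring
  have hy0 : 0 < y := by positivity
  have hy1 : y ≤ π / 2 := by rw [hy]; linarith
  have hs : 0 < Real.sin y := Real.sin_pos_of_pos_of_lt_pi hy0 (by linarith [Real.pi_pos])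
  have hc : 0 ≤ Real.cos y := Real.cos_nonneg_of_mem_Icc ⟨by linarith [Real.pi_pos], hy1⟩
  have e : conjKer 1 x = Real.cos y / (2 * Real.sin y) := by
    have h2 := Real.sin_sq_add_cos_sq y
    have hd : poissonDenom 1 x = 4 * Real.sin y ^ 2 := by rw [poissonDenom_eq, ← hy]; ring
    rw [conjKer, hd, hxy, Real.sin_two_mul, div_eq_div_iff (by positivity) (by positivity)]
    ring
  have h1 : y * Real.cos y ≤ Real.sin y := by
    rcases hy1.eq_or_lt with h' | h'
    · rw [h', Real.cos_pi_div_two]; linarith [Real.sin_pi_div_two]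
    · have := Real.le_tan hy0.le h'
      rw [Real.tan_eq_sin_div_cos] at this
      exact (le_div_iff₀ (Real.cos_pos_of_mem_Ioo ⟨by linarith [Real.pi_pos], h'⟩)).1 this
  have h2 : Real.sin y ≤ y := Real.sin_le hy0.le
  have h3 : 1 - Real.cos y ≤ Real.sin y := by
    nlinarith [Real.sin_sq_add_cos_sq y, Real.cos_le_one y]
  have e2 : conjKer 1 x - x⁻¹ = -((Real.sin y - y * Real.cos y) / (2 * (y * Real.sin y))) := by
    rw [e, hxy]; field_simp; ring
  rw [e2, abs_neg, abs_of_nonneg (div_nonneg (by linarith) (by positivity)),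
    div_le_one (by positivity)]
  nlinarith [mul_le_mul_of_nonneg_left h3 hy0.le]

theorem poissonDenom_one_pos {x : ℝ} (h : 0 < torDist x) : 0 < poissonDenom 1 x :=
  lt_of_lt_of_le (by have := Real.pi_pos; positivity) (poissonDenom_ge_torDist (by norm_num) x)

theorem abs_conjKer_one_le {x ε : ℝ} (hε : 0 < ε) (h : ε ≤ torDist x) :
    |conjKer 1 x| ≤ 1 / (2 * (ε / π) ^ 2) := by
  have hpi := Real.pi_pos
  have h0 := poissonDenom_one_pos (hε.trans_le h)
  rw [conjKer, one_mul, abs_div, abs_of_pos h0]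
  refine div_le_div₀ zero_le_one (Real.abs_sin_le_one x) (by positivity) ?_
  refine le_trans ?_ (poissonDenom_ge_torDist (by norm_num) x)
  gcongr

variable {p : ℝ}

theorem integrable_logKer_smul {E : Type*} [NormedAddCommGroup E] [NormedSpace ℝ E] {f : ℝ → E}
    {β : ℝ} (hβ : 0 < β) (hf : AEStronglyMeasurable f torusMeasure) {x : ℝ}
    (h : Integrable (fun t => torDist (x - t) ^ (-β) * ‖f t‖) torusMeasure) :
    Integrable (fun t => logKer 1 (x - t) • f t) torusMeasure := by
  refine (h.const_mul ((1 + 1 / β) * π ^ β)).mono' (AEStronglyMeasurable.smul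
    ((measurable_logKer 1).comp (measurable_const.sub measurable_id)).aestronglyMeasurable hf) ?_
  filter_upwards [ae_torDist_pos x] with t ht
  rw [norm_smul, Real.norm_eq_abs, ← mul_assoc]
  exact mul_le_mul_of_nonneg_right (abs_logKer_le hβ (by norm_num) le_rfl ht) (norm_nonneg _)

/-- The conjugate function of a plane-valued function: existence, the `L^p` bound, and its
representation as a principal value. -/
theorem exists_conjugate_plane (hp : 1 < p) :
    ∃ C : ℝ≥0, ∀ f : ℝ → Plane, Measurable f → Function.Periodic f (2 * π) →
      ∫⁻ x, ‖f x‖ₑ ^ p ∂torusMeasure < ⊤ →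
      ∃ h : ℝ → Plane, Measurable h ∧ Function.Periodic h (2 * π) ∧
        IsPrimitive (fun x => ∫ t, logKer 1 (x - t) • f t ∂torusMeasure) h ∧
        ∫⁻ x, ‖h x‖ₑ ^ p ∂torusMeasure ≤ C * ∫⁻ x, ‖f x‖ₑ ^ p ∂torusMeasure ∧
        ∀ᵐ ξ, Tendsto (fun ε => ∫ η in pvDomain ξ ε, conjKer 1 (ξ - η) • f η) (𝓝[>] 0)
          (𝓝 (h ξ)) := by
  obtain ⟨C, hC⟩ := exists_isPrimitive_logPotential hp
  have hp0 : 0 < p := by linarith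
  refine ⟨2 ^ (p - 1) * (C + C), fun f hm hf hfin => ?_⟩
  have hmi : ∀ i, Measurable fun x => f x i := fun i => by fun_prop
  have hpi : ∀ i, Function.Periodic (fun x => f x i) (2 * π) := fun i x => by simp only [hf x]
  have hle : ∀ i, ∫⁻ x, ‖f x i‖ₑ ^ p ∂torusMeasure ≤ ∫⁻ x, ‖f x‖ₑ ^ p ∂torusMeasure := fun i => by
    refine lintegral_mono fun x => ENNReal.rpow_le_rpow ?_ hp0.le
    rw [← ofReal_norm, ← ofReal_norm]
    exact ENNReal.ofReal_le_ofReal (PiLp.norm_apply_le (f x) i)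
  have hfi : ∀ i, ∫⁻ x, ‖f x i‖ₑ ^ p ∂torusMeasure < ⊤ := fun i => (hle i).trans_lt hfin
  choose H hHm hHp hHprim hHb using fun i => hC (fun x => f x i) (hmi i) (hpi i) (hfi i)
  set e : Fin 2 → Plane := fun i => EuclideanSpace.single i 1 with he
  have hen : ∀ i, ‖e i‖ = 1 := fun i => by simp [he]
  have hdec : ∀ u : Plane, u = u 0 • e 0 + u 1 • e 1 := fun u => by
    ext i; fin_cases i <;> simp [he]
  have hi := integrable_of_lintegral_rpow_lt_top hp.le hm.aestronglyMeasurable hfin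
  refine ⟨fun x => H 0 x • e 0 + H 1 x • e 1,
    ((hHm 0).smul_const _).add ((hHm 1).smul_const _),
    fun x => by simp only [hHp 0 x, hHp 1 x], ?_, ?_, ?_⟩
  · have hP := ((hHprim 0).clm (ContinuousLinearMap.toSpanSingleton ℝ (e 0))).add
      ((hHprim 1).clm (ContinuousLinearMap.toSpanSingleton ℝ (e 1)))
    simp only [ContinuousLinearMap.toSpanSingleton_apply] at hP
    convert hP using 2 with x
    obtain ⟨β, hβ, -, hint⟩ := RegularCurve.integrable_mul_torDist hp hm hfin
    have hint' : ∀ i, Integrable (fun t => f t i * logKer 1 (x - t)) torusMeasure := fun i => by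
      have h1 : Integrable (fun t => torDist (x - t) ^ (-β) * ‖f t i‖) torusMeasure := by
        refine (hint x).mono' ((((continuous_torDist.measurable.comp
          (measurable_const.sub measurable_id)).pow_const _).mul (hmi i).norm).aestronglyMeasurable)
          (Eventually.of_forall fun t => ?_)
        have h0 := Real.rpow_nonneg (torDist_nonneg (x - t)) (-β)
        rw [Real.norm_of_nonneg (by positivity)]
        gcongr
        exact PiLp.norm_apply_le (f t) i
      refine (integrable_logKer_smul hβ (hmi i).aestronglyMeasurable h1).congr
        (Eventually.of_forall fun t => ?_)
      simp only [smul_eq_mul]; ring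
    rw [logPotential, logPotential, ← integral_smul_const, ← integral_smul_const,
      ← integral_add ((hint' 0).smul_const _) ((hint' 1).smul_const _)]
    refine integral_congr_ae (Eventually.of_forall fun t => ?_)
    simp only
    conv_lhs => rw [hdec (f t)]
    rw [smul_add, smul_smul, smul_smul, mul_comm, mul_comm (logKer 1 (x - t))]
  · have h1 : ∀ x, ‖H 0 x • e 0 + H 1 x • e 1‖ₑ ^ p ≤
        2 ^ (p - 1) * (‖H 0 x‖ₑ ^ p + ‖H 1 x‖ₑ ^ p) := fun x => by
      refine le_trans (ENNReal.rpow_le_rpow (enorm_add_le _ _) hp0.le) ?_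
      have e1 : ∀ i, ‖H i x • e i‖ₑ = ‖H i x‖ₑ := fun i => by
        rw [enorm_smul, ← ofReal_norm (e i), hen, ENNReal.ofReal_one, mul_one]
      rw [e1, e1]
      exact ENNReal.rpow_add_le_mul_rpow_add_rpow _ _ hp.le
    refine (lintegral_mono h1).trans ?_
    rw [lintegral_const_mul' _ _ (ENNReal.rpow_ne_top_of_nonneg (by linarith) (by simp)),
      lintegral_add_left ((hHm 0).enorm.pow_const p)]
    have h2 := (hHb 0).trans (mul_le_mul_right (hle 0) _)
    have h3 := (hHb 1).trans (mul_le_mul_right (hle 1) _)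
    rw [ENNReal.coe_mul, ENNReal.coe_rpow_of_nonneg _ (by linarith), ENNReal.coe_add, mul_assoc,
      add_mul]
    exact mul_le_mul_right (add_le_add h2 h3) _
  · filter_upwards [ae_tendsto_integral_pvDomain_conjKer hp (hmi 0) (hpi 0) (hfi 0) (hHprim 0)
      (hHm 0) (hHp 0), ae_tendsto_integral_pvDomain_conjKer hp (hmi 1) (hpi 1) (hfi 1) (hHprim 1)
      (hHm 1) (hHp 1)] with ξ h0 h1
    refine ((h0.smul_const (e 0)).add (h1.smul_const (e 1))).congr' ?_
    filter_upwards [self_mem_nhdsWithin] with ε hε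
    have hε0 : 0 < ε := hε
    have hint' : ∀ i, IntegrableOn (fun η => f η i * conjKer 1 (ξ - η)) (pvDomain ξ ε) := fun i => by
      have h1 : IntegrableOn (fun η => f η i) (Ioc (ξ - π) (ξ + π)) :=
        (integrable_torus_iff_Ioc_centered (hpi i) ξ).1 (integrable_of_lintegral_rpow_lt_top hp.le
          (hmi i).aestronglyMeasurable (hfi i))
      have := integrableOn_pvDomain_smul (ε := ε) (k := fun η => conjKer 1 (ξ - η)) h1
        ((measurable_conjKer 1).comp (measurable_const.sub measurable_id))
        fun η hη => abs_conjKer_one_le hε0 (le_torDist_of_mem_pvDomain hη)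
      simpa only [smul_eq_mul, mul_comm] using this
    rw [← integral_smul_const, ← integral_smul_const,
      ← integral_add ((hint' 0).smul_const _) ((hint' 1).smul_const _)]
    refine integral_congr_ae (Eventually.of_forall fun t => ?_)
    simp only
    conv_rhs => rw [hdec (f t)]
    rw [smul_add, smul_smul, smul_smul, mul_comm (conjKer 1 (ξ - t)) (f t 0),
      mul_comm (conjKer 1 (ξ - t)) (f t 1)]

theorem integrable_torDist_smul_prod {β : ℝ} (hβ : -1 < β) {f : ℝ → ℝ}
    (hm : Measurable f) (hf : Integrable f torusMeasure) :
    Integrable (fun z : ℝ × ℝ => torDist (z.1 - z.2) ^ β * f z.2)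
      (torusMeasure.prod torusMeasure) := by
  have hper : Function.Periodic (fun x => torDist x ^ β) (2 * π) := fun x => by
    simp only [torDist_periodic x]
  have hmeas : Measurable fun z : ℝ × ℝ => torDist (z.1 - z.2) ^ β * f z.2 :=
    ((continuous_torDist.comp (continuous_fst.sub continuous_snd)).measurable.pow_const _).mul
      (hm.comp measurable_snd)
  rw [integrable_prod_iff' hmeas.aestronglyMeasurable]
  refine ⟨Eventually.of_forall fun y => ?_, ?_⟩
  · exact (integrable_torus_add_right hper (integrable_torDist_rpow hβ) (-y)).mul_const (f y)
  · have : ∀ y, ∫ x, ‖torDist (x - y) ^ β * f y‖ ∂torusMeasure =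
        (∫ x, ‖torDist x ^ β‖ ∂torusMeasure) * ‖f y‖ := fun y => by
      simp_rw [norm_mul]
      rw [integral_mul_const]
      congr 1
      exact integral_torus_add_right (F := fun x => ‖torDist x ^ β‖)
        (fun x => by simp only [torDist_periodic x]) (-y)
    simp_rw [this]
    exact hf.norm.const_mul _

end Circle

/-- The regular part of the logarithmic kernel along a curve, compared with the circle. -/
noncomputable def regularLog (γ : ℝ → Plane) (ξ η : ℝ) : ℝ :=
  Real.log (regDenom γ 0 ξ η) / 2 - logKer 1 (ξ - η)

/-- The regular part of the derivative of the logarithmic kernel. -/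
noncomputable def regularKer (γ : ℝ → Plane) (ξ η : ℝ) : ℝ :=
  inner ℝ (γ ξ - γ η) (deriv γ ξ) / ‖γ ξ - γ η‖ ^ 2 - conjKer 1 (ξ - η)

/-! ### The difference between the kernels of the curve and of the circle. -/

namespace RegularCurve

variable {p M : ℝ} {γ : ℝ → Plane} {f : ℝ → Plane}

/-- Both kernels have the leading singularity `1/x` with `x = ξ - η`. For the curve, the first-order
Taylor remainder leaves an error of order `|x|^{α-1}`; for the circle the error is bounded. -/
theorem abs_regularKer_le (hγ : RegularCurve p M γ) (ξ η : ℝ) :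
    |regularKer γ ξ η| ≤ (M ^ 2 + π) * torDist (ξ - η) ^ (1 - 1 / p - 1) := by
  have hM := hγ.M_pos
  have hpi := Real.pi_pos
  have hα := hγ.exponent_pos
  have hα1 := hγ.exponent_lt
  have key : ∀ x, |regularKer γ ξ (ξ - x)| ≤ (M ^ 2 + π) * torDist x ^ (1 - 1 / p - 1) := by
    refine periodic_induction (fun x => ?_) fun x hx => ?_
    · have : γ (ξ - (x + 2 * π)) = γ (ξ - x) := by
        rw [← hγ.periodic (ξ - (x + 2 * π)), sub_add_eq_sub_sub, sub_add_cancel]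
      rw [regularKer, regularKer, this, torDist_periodic, sub_sub_cancel, sub_sub_cancel,
        conjKer_periodic]
    · rcases eq_or_ne x 0 with rfl | hx0
      · have h0 : 0 ≤ torDist 0 ^ (1 - 1 / p - 1) := Real.rpow_nonneg (torDist_nonneg 0) _
        simp only [regularKer, sub_zero, sub_self, inner_zero_left, zero_div, conjKer,
          Real.sin_zero, mul_zero, abs_zero]
        positivity
      have hxp : 0 < |x| := abs_pos.2 hx0
      have ht : torDist x = |x| := torDist_eq_abs hx
      have ht' : 0 < torDist (ξ - (ξ - x)) := by rw [sub_sub_cancel, ht]; exact hxp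
      have hd := hγ.chord_pos ht'
      have hinv := hγ.inv_norm_sub_le ht'
      rw [sub_sub_cancel, ht] at hinv
      rw [ht]
      have h1 := abs_conjKer_one_sub_inv_le hx0 hx
      have h2 : |inner ℝ (γ ξ - γ (ξ - x)) (deriv γ ξ) / ‖γ ξ - γ (ξ - x)‖ ^ 2 - x⁻¹| ≤
          M ^ 2 * |x| ^ (1 - 1 / p - 1) := by
        have e : inner ℝ (γ ξ - γ (ξ - x)) (deriv γ ξ) / ‖γ ξ - γ (ξ - x)‖ ^ 2 - x⁻¹ =
            -(inner ℝ (γ ξ - γ (ξ - x)) (γ ξ - γ (ξ - x) - x • deriv γ ξ) /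
              (x * ‖γ ξ - γ (ξ - x)‖ ^ 2)) := by
          rw [inner_sub_right (γ ξ - γ (ξ - x)) (γ ξ - γ (ξ - x)), real_inner_self_eq_norm_sq,
            inner_smul_right]
          field_simp
          ring
        rw [e, abs_neg, abs_div, abs_mul, abs_of_pos (pow_pos hd 2)]
        calc _ ≤ ‖γ ξ - γ (ξ - x)‖ * (M * |x| ^ (1 - 1 / p) * |x|) /
              (|x| * ‖γ ξ - γ (ξ - x)‖ ^ 2) := by
              gcongr
              refine (abs_real_inner_le_norm _ _).trans ?_
              gcongr
              exact hγ.norm_taylor_le ξ x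
          _ = M * |x| ^ (1 - 1 / p) * ‖γ ξ - γ (ξ - x)‖⁻¹ := by field_simp
          _ ≤ M * |x| ^ (1 - 1 / p) * (M * |x|⁻¹) := by gcongr
          _ = _ := by rw [Real.rpow_sub_one hxp.ne']; field_simp
      -- The bounded error is absorbed into the negative power, using `|x| ≤ π` and `π^α ≥ 1`.
      have h3 : 1 ≤ π * |x| ^ (1 - 1 / p - 1) := by
        have h4 : π ^ (1 - 1 / p - 1) ≤ |x| ^ (1 - 1 / p - 1) :=
          Real.rpow_le_rpow_of_nonpos hxp hx (by linarith)
        calc (1 : ℝ) ≤ π ^ (1 - 1 / p) := Real.one_le_rpow (by linarith [Real.pi_gt_three]) hα.le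
          _ = π * π ^ (1 - 1 / p - 1) := by rw [Real.rpow_sub_one hpi.ne']; field_simp
          _ ≤ _ := by gcongr
      rw [regularKer, sub_sub_cancel, add_mul]
      calc _ ≤ |inner ℝ (γ ξ - γ (ξ - x)) (deriv γ ξ) / ‖γ ξ - γ (ξ - x)‖ ^ 2 - x⁻¹| +
            |x⁻¹ - conjKer 1 x| := abs_sub_le _ _ _
        _ ≤ _ := by rw [abs_sub_comm x⁻¹]; linarith
  have := key (ξ - η)
  rwa [sub_sub_cancel] at this

theorem measurable_regularKer (hγ : RegularCurve p M γ) :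
    Measurable fun z : ℝ × ℝ => regularKer γ z.1 z.2 := by
  have hc1 := hγ.continuous
  have hc2 := hγ.continuous_deriv
  have h1 : Continuous fun z : ℝ × ℝ => inner ℝ (γ z.1 - γ z.2) (deriv γ z.1) := by fun_prop
  have h2 : Continuous fun z : ℝ × ℝ => ‖γ z.1 - γ z.2‖ ^ 2 := by fun_prop
  exact (h1.measurable.div h2.measurable).sub
    ((measurable_conjKer 1).comp (measurable_fst.sub measurable_snd))

theorem hasDerivAt_regularLog (hγ : RegularCurve p M γ) {ξ η : ℝ} (h : 0 < torDist (ξ - η)) :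
    HasDerivAt (fun ξ => regularLog γ ξ η) (regularKer γ ξ η) ξ := by
  have h1 := ((hγ.hasDerivAt_regDenom 0 ξ η).log (hγ.regDenom_pos le_rfl h).ne').div_const 2
  have h2 := (hasDerivAt_logKer (poissonDenom_one_pos h)).comp ξ ((hasDerivAt_id ξ).sub_const η)
  refine (h1.sub h2).congr_deriv ?_
  rw [regularKer, regDenom, add_zero]; ring

/-- At the diagonal the regular part tends to the logarithm of the speed. -/
theorem tendsto_regularLog (hγ : RegularCurve p M γ) (η : ℝ) :
    Tendsto (fun ξ => regularLog γ ξ η) (𝓝[≠] η) (𝓝 (Real.log (speed γ η))) := by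
  have h1 := (hasDerivAt_iff_tendsto_slope.1 (hγ.hasDerivAt η)).norm.log (hγ.speed_pos η).ne'
  have hσ : HasDerivAt (fun ξ => 2 * Real.sin ((ξ - η) / 2)) 1 η := by
    have := ((((hasDerivAt_id η).sub_const η).div_const 2).sin).const_mul 2
    refine this.congr_deriv ?_
    simp
  have h2 := (hasDerivAt_iff_tendsto_slope.1 hσ).norm.log (by simp)
  have h3 := h1.sub h2
  rw [norm_one, Real.log_one, sub_zero] at h3
  refine h3.congr' ?_
  have hball : Metric.ball η π ∈ 𝓝[≠] η :=
    mem_nhdsWithin_of_mem_nhds (Metric.ball_mem_nhds η Real.pi_pos)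
  filter_upwards [self_mem_nhdsWithin, hball] with ξ hξ hξb
  rw [Metric.mem_ball, Real.dist_eq] at hξb
  have hne : ξ - η ≠ 0 := sub_ne_zero.2 hξ
  have ht : 0 < torDist (ξ - η) := by
    rw [torDist_eq_abs hξb.le]; exact abs_pos.2 hne
  have hd := hγ.chord_pos ht
  have hP := poissonDenom_one_pos ht
  have hPe : poissonDenom 1 (ξ - η) = (2 * Real.sin ((ξ - η) / 2)) ^ 2 := by
    rw [poissonDenom_eq]; ring
  rw [hPe] at hP
  have hs : 2 * Real.sin ((ξ - η) / 2) ≠ 0 := fun h0 => by rw [h0] at hP; norm_num at hP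
  rw [regularLog, logKer, hPe, regDenom, add_zero, slope_def_module, slope_def_module, norm_smul,
    norm_smul, Real.log_mul (norm_ne_zero_iff.2 (inv_ne_zero hne)) hd.ne', sub_self η, zero_div,
    Real.sin_zero, mul_zero, sub_zero,
    Real.log_mul (norm_ne_zero_iff.2 (inv_ne_zero hne)) (norm_ne_zero_iff.2 hs),
    Real.norm_eq_abs (2 * Real.sin ((ξ - η) / 2)), Real.log_abs, Real.log_pow, Real.log_pow]
  push_cast; ring

/-- The singularity at `ξ = η` is removable and the derivative is integrable, so the fundamental
theorem applies with one exceptional point. -/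
theorem regularLog_sub_eq (hγ : RegularCurve p M γ) {η : ℝ} (hη : η ∈ Ioo 0 (2 * π)) {x : ℝ}
    (hx : x ∈ Icc 0 (2 * π)) (hxη : x ≠ η) :
    regularLog γ x η - regularLog γ 0 η = ∫ t in (0 : ℝ)..x, regularKer γ t η := by
  classical
  -- For `η` in the open period, no other point of the closed period is congruent to `η`.
  have hpos : ∀ t ∈ Icc 0 (2 * π), t ≠ η → 0 < torDist (t - η) := by
    intro t ht hne
    refine torDist_pos_of_ne fun h => hne ?_
    have h1 : ((t - η : ℝ) : AddCircle (2 * π)) = 0 := by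
      rw [AddCircle.coe_sub, h, sub_self]
    rw [AddCircle.coe_eq_zero_iff] at h1
    obtain ⟨n, hn⟩ := h1
    rw [zsmul_eq_mul] at hn
    have hpi := Real.two_pi_pos
    have h2 : (n : ℝ) < 1 := by
      have : (n : ℝ) * (2 * π) < 1 * (2 * π) := by rw [hn]; linarith [ht.2, hη.1]
      exact lt_of_mul_lt_mul_right this hpi.le
    have h3 : (-1 : ℝ) < n := by
      have : (-1 : ℝ) * (2 * π) < n * (2 * π) := by rw [hn]; linarith [ht.1, hη.2]
      exact lt_of_mul_lt_mul_right this hpi.le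
    have : n = 0 := by
      have h2' : n < 1 := by exact_mod_cast h2
      have h3' : -1 < n := by exact_mod_cast h3
      omega
    rw [this, Int.cast_zero, zero_mul] at hn
    linarith
  have hsub : Icc 0 x ⊆ Icc 0 (2 * π) := Icc_subset_Icc_right hx.2
  -- The value at the diagonal is the limit, the logarithm of the speed.
  set F : ℝ → ℝ := Function.update (fun ξ => regularLog γ ξ η) η (Real.log (speed γ η)) with hF
  have hFe : ∀ t, t ≠ η → F t = regularLog γ t η := fun t ht => Function.update_of_ne ht _ _
  have hFc : ContinuousOn F (Icc 0 x) := by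
    intro t ht
    rcases eq_or_ne t η with rfl | hne
    · exact (continuousAt_update_same.2 (hγ.tendsto_regularLog t)).continuousWithinAt
    · exact ((continuousAt_update_of_ne hne).2
        (hγ.hasDerivAt_regularLog (hpos t (hsub ht) hne)).continuousAt).continuousWithinAt
  have hFd : ∀ t ∈ Ioo 0 x \ {η}, HasDerivAt F (regularKer γ t η) t := by
    rintro t ⟨ht, hne⟩
    refine (hγ.hasDerivAt_regularLog (hpos t (hsub (Ioo_subset_Icc_self ht)) hne)).congr_of_eventuallyEq
      ?_
    filter_upwards [isOpen_ne.mem_nhds hne] with y hy using hFe y hy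
  have hint : IntervalIntegrable (fun t => regularKer γ t η) volume 0 x := by
    rw [intervalIntegrable_iff_integrableOn_Ioc_of_le hx.1]
    have h1 : Integrable (fun t => torDist (t - η) ^ (1 - 1 / p - 1)) torusMeasure :=
      integrable_torus_add_right (F := fun t => torDist t ^ (1 - 1 / p - 1))
        (fun x => by simp only [torDist_periodic x]) (integrable_torDist_rpow hγ.exponent_gt) (-η)
    have h2 : Integrable (fun t => regularKer γ t η) torusMeasure :=
      (h1.const_mul (M ^ 2 + π)).mono'
        (hγ.measurable_regularKer.comp measurable_prodMk_right).aestronglyMeasurable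
        (Eventually.of_forall fun t => hγ.abs_regularKer_le t η)
    have h3 : IntegrableOn (fun t => regularKer γ t η) (Ioc 0 (2 * π)) := h2
    exact h3.mono_set (Ioc_subset_Ioc_right hx.2)
  rw [← hFe x hxη, ← hFe 0 hη.1.ne]
  exact (integral_eq_of_hasDerivAt_off_countable_of_le F _ hx.1 (countable_singleton η) hFc hFd
    hint).symm

end RegularCurve

/-! ### Potentials of `L^p` densities along a curve. -/

namespace RegularCurve

variable {p M : ℝ} {γ : ℝ → Plane} {f : ℝ → Plane}

theorem integrable_regularKer_smul (hγ : RegularCurve p M γ) (hm : Measurable f)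
    (hi : Integrable f torusMeasure) :
    Integrable (Function.uncurry fun ξ η => regularKer γ ξ η • f η)
      (torusMeasure.prod torusMeasure) := by
  refine ((integrable_torDist_smul_prod hγ.exponent_gt hm.norm hi.norm).const_mul
    (M ^ 2 + π)).mono' (hγ.measurable_regularKer.smul (hm.comp measurable_snd)).aestronglyMeasurable
    (Eventually.of_forall fun z => ?_)
  rw [Function.uncurry, norm_smul, Real.norm_eq_abs, ← mul_assoc]
  exact mul_le_mul_of_nonneg_right (hγ.abs_regularKer_le _ _) (norm_nonneg _)

theorem regularKer_periodic (hγ : RegularCurve p M γ) (ξ η : ℝ) :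
    regularKer γ (ξ + 2 * π) η = regularKer γ ξ η := by
  rw [regularKer, regularKer, hγ.periodic, hγ.deriv_periodic, add_sub_right_comm, conjKer_periodic]

theorem regularKer_periodic_right (hγ : RegularCurve p M γ) (ξ η : ℝ) :
    regularKer γ ξ (η + 2 * π) = regularKer γ ξ η := by
  rw [regularKer, regularKer, hγ.periodic, ← conjKer_periodic 1 (ξ - (η + 2 * π)),
    sub_add_eq_sub_sub, sub_add_cancel]

theorem integrable_regularLog_smul (hγ : RegularCurve p M γ) (hm : Measurable f)
    (hfin : ∫⁻ x, ‖f x‖ₑ ^ p ∂torusMeasure < ⊤) (ξ : ℝ) :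
    Integrable (fun η => logKer 1 (ξ - η) • f η) torusMeasure ∧
      Integrable (fun η => regularLog γ ξ η • f η) torusMeasure := by
  obtain ⟨β, hβ, -, hint⟩ := integrable_mul_torDist hγ.one_lt hm hfin
  have h1 := integrable_logKer_smul hβ hm.aestronglyMeasurable (hint ξ)
  refine ⟨h1, ((hγ.integrable_logInt hm hfin le_rfl zero_le_one ξ).sub h1).congr
    (Eventually.of_forall fun η => ?_)⟩
  simp only [regularLog, sub_smul, Pi.sub_apply]

theorem isPrimitive_integral_regularLog (hγ : RegularCurve p M γ) (hm : Measurable f)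
    (hfin : ∫⁻ x, ‖f x‖ₑ ^ p ∂torusMeasure < ⊤) :
    IsPrimitive (fun ξ => ∫ η, regularLog γ ξ η • f η ∂torusMeasure)
      (fun ξ => ∫ η, regularKer γ ξ η • f η ∂torusMeasure) := by
  have hi := integrable_of_lintegral_rpow_lt_top hγ.one_lt.le hm.aestronglyMeasurable hfin
  refine isPrimitive_integral (Φ := fun ξ η => regularLog γ ξ η • f η)
    (F := fun ξ η => regularKer γ ξ η • f η) (fun x hx => ?_)
    (hγ.integrable_regularKer_smul hm hi) (fun x => (hγ.integrable_regularLog_smul hm hfin x).2)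
    (fun x η => ?_) (fun x η => by rw [hγ.regularKer_periodic])
  · have h1 : ∀ᵐ η ∂torusMeasure, η ∈ Ioo 0 (2 * π) := by
      have : ∀ᵐ η ∂torusMeasure, η ≠ 2 * π := ae_torus_of_ae (by simp [ae_iff])
      filter_upwards [this, ae_restrict_mem measurableSet_Ioc] with η hη h
      exact ⟨h.1, lt_of_le_of_ne h.2 hη⟩
    have h2 : ∀ᵐ η ∂torusMeasure, η ≠ x := ae_torus_of_ae (by simp [ae_iff])
    filter_upwards [h1, h2] with η hη hηx
    rw [← sub_smul, hγ.regularLog_sub_eq hη hx hηx.symm, intervalIntegral.integral_smul_const]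
  · rw [regularLog, regularLog, regDenom, regDenom, hγ.periodic, add_sub_right_comm, logKer_periodic]

theorem logInt_zero_eq (hγ : RegularCurve p M γ) (hm : Measurable f)
    (hfin : ∫⁻ x, ‖f x‖ₑ ^ p ∂torusMeasure < ⊤) : logInt γ 0 f = fun ξ =>
      (∫ η, logKer 1 (ξ - η) • f η ∂torusMeasure) + ∫ η, regularLog γ ξ η • f η ∂torusMeasure := by
  ext1 ξ
  obtain ⟨h1, h2⟩ := hγ.integrable_regularLog_smul hm hfin ξ
  rw [← integral_add h1 h2, logInt]
  refine integral_congr_ae (Eventually.of_forall fun η => ?_)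
  simp only
  rw [← add_smul, regularLog, add_sub_cancel]

/-- The logarithmic potential along a curve of an `L^p` density is an indefinite integral of an
`L^p` function, which is the principal value of the differentiated potential. -/
theorem exists_logInt_isPrimitive (hp : 1 < p) (M : ℝ) :
    ∃ C : ℝ≥0, ∀ γ : ℝ → Plane, RegularCurve p M γ → ∀ f : ℝ → Plane, Measurable f →
      Function.Periodic f (2 * π) → ∫⁻ x, ‖f x‖ₑ ^ p ∂torusMeasure < ⊤ →
      ∃ h : ℝ → Plane, Function.Periodic h (2 * π) ∧ IsPrimitive (logInt γ 0 f) h ∧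
        ∫⁻ x, ‖h x‖ₑ ^ p ∂torusMeasure ≤ C * ∫⁻ x, ‖f x‖ₑ ^ p ∂torusMeasure ∧
        ∀ᵐ ξ, Tendsto (fun ε => ∫ η in pvDomain ξ ε,
          (inner ℝ (γ ξ - γ η) (deriv γ ξ) / ‖γ ξ - γ η‖ ^ 2) • f η) (𝓝[>] 0) (𝓝 (h ξ)) := by
  obtain ⟨C, hC⟩ := exists_conjugate_plane hp
  have hp0 : 0 < p := by linarith
  set w : ℝ → ℝ≥0∞ := fun x => ENNReal.ofReal ((M ^ 2 + π) * torDist x ^ (1 - 1 / p - 1)) with hw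
  have hwm : Measurable w :=
    ((continuous_torDist.measurable.pow_const _).const_mul _).ennreal_ofReal
  have hwp : Function.Periodic w (2 * π) := fun x => by simp only [hw, torDist_periodic x]
  have hβ : -1 < 1 - 1 / p - 1 := by
    have : 1 / p < 1 := (div_lt_one hp0).2 hp
    linarith
  have hW : ∫⁻ x, w x ∂torusMeasure ≠ ⊤ := by
    have := ((integrable_torDist_rpow hβ).const_mul (M ^ 2 + π)).2
    rw [hasFiniteIntegral_iff_ofReal (Eventually.of_forall fun x => mul_nonneg
      (by have := Real.pi_pos; positivity) (Real.rpow_nonneg (torDist_nonneg x) _))] at this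
    exact this.ne
  refine ⟨2 ^ (p - 1) * (C + (∫⁻ x, w x ∂torusMeasure).toNNReal ^ p), fun γ hγ f hm hf hfin => ?_⟩
  obtain ⟨h, hhm, hhp, hprim, hb, hpv⟩ := hC f hm hf hfin
  have hi := integrable_of_lintegral_rpow_lt_top hp.le hm.aestronglyMeasurable hfin
  have hk := hγ.integrable_regularKer_smul hm hi
  refine ⟨fun ξ => h ξ + ∫ η, regularKer γ ξ η • f η ∂torusMeasure, fun ξ => ?_, ?_, ?_, ?_⟩
  · simp only [hhp ξ, hγ.regularKer_periodic]
  · rw [hγ.logInt_zero_eq hm hfin]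
    exact hprim.add (hγ.isPrimitive_integral_regularLog hm hfin)
  · have hY := lintegral_rpow_convolution_le hp hwm hm.enorm hwp (fun x => by simp only [hf x])
    have h1 : ∀ ξ, ‖h ξ + ∫ η, regularKer γ ξ η • f η ∂torusMeasure‖ₑ ^ p ≤ 2 ^ (p - 1) *
        (‖h ξ‖ₑ ^ p + (∫⁻ η, w (ξ - η) * ‖f η‖ₑ ∂torusMeasure) ^ p) := fun ξ => by
      refine le_trans (ENNReal.rpow_le_rpow ((enorm_add_le _ _).trans (add_le_add_right
        ((enorm_integral_le_lintegral_enorm _).trans (lintegral_mono fun η => ?_)) _)) hp0.le)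
        (ENNReal.rpow_add_le_mul_rpow_add_rpow _ _ hp.le)
      simp only
      rw [enorm_smul]
      gcongr
      rw [← ofReal_norm]
      exact ENNReal.ofReal_le_ofReal (hγ.abs_regularKer_le ξ η)
    refine (lintegral_mono h1).trans ?_
    rw [lintegral_const_mul' _ _ (ENNReal.rpow_ne_top_of_nonneg (by linarith) (by simp)),
      lintegral_add_left (hhm.enorm.pow_const p), ENNReal.coe_mul,
      ENNReal.coe_rpow_of_nonneg _ (by linarith), ENNReal.coe_add,
      ENNReal.coe_rpow_of_nonneg _ hp0.le, ENNReal.coe_toNNReal hW, mul_assoc, add_mul]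
    exact mul_le_mul_right (add_le_add hb hY) _
  -- Integrability on the product gives integrability in `η` only for almost every `ξ`, which is
  -- enough here.
  · have hae : ∀ᵐ ξ, Integrable (fun η => regularKer γ ξ η • f η) torusMeasure :=
      ae_of_ae_torus (fun ξ => by simp only [hγ.regularKer_periodic]) hk.prod_right_ae
    filter_upwards [hpv, hae] with ξ h1 h2
    have hper : Function.Periodic (fun η => regularKer γ ξ η • f η) (2 * π) := fun η => by
      simp only [hγ.regularKer_periodic_right, hf η]
    have h3 := (integrable_torus_iff_Ioc_centered hper ξ).1 h2
    have t := tendsto_integral_pvDomain h3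
    rw [← integral_torus_eq_Ioc_centered hper] at t
    refine (h1.add t).congr' ?_
    filter_upwards [self_mem_nhdsWithin] with ε hε
    have hfI := (integrable_torus_iff_Ioc_centered hf ξ).1 hi
    rw [← integral_add (integrableOn_pvDomain_smul (k := fun η => conjKer 1 (ξ - η)) hfI
      ((measurable_conjKer 1).comp (measurable_const.sub measurable_id))
      fun η hη => abs_conjKer_one_le hε (le_torDist_of_mem_pvDomain hη))
      (h3.mono_set (pvDomain_subset ξ ε))]
    refine integral_congr_ae (Eventually.of_forall fun η => ?_)
    simp only [regularKer, sub_smul, add_sub_cancel]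

end RegularCurve

/-! ### Kernels of the second derivative and their `L^p` majorant. -/

theorem IsPrimitive.inner {u u' w w' : ℝ → Plane} (hu : IsPrimitive u u') (hw : IsPrimitive w w') :
    IsPrimitive (fun x => inner ℝ (u x) (w x))
      (fun x => inner ℝ (u x) (w' x) + inner ℝ (u' x) (w x)) := by
  have h : ∀ i : Fin 2, IsPrimitive (fun x => u x i • w x i) (fun x => u x i • w' x i + u' x i • w x i) :=
    fun i => (hu.clm (EuclideanSpace.proj i)).smul (hw.clm (EuclideanSpace.proj i))
  have := (h 0).add (h 1)
  convert this using 2 with x x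
  · simp only [PiLp.inner_apply, Fin.sum_univ_two, RCLike.inner_apply, conj_trivial, smul_eq_mul]
    ring
  · simp only [PiLp.inner_apply, Fin.sum_univ_two, RCLike.inner_apply, conj_trivial, smul_eq_mul]
    ring

/-- The part of the differentiated kernel that involves the curvature at `ξ`, regularized by `s`. -/
noncomputable def curvKerB (γ : ℝ → Plane) (s ξ η : ℝ) : ℝ :=
  (inner ℝ (tangent γ ξ - tangent γ η) (tangent γ ξ) +
    (speed γ ξ)⁻¹ * inner ℝ (γ ξ - γ η) (deriv (tangent γ) ξ)) / regDenom γ s ξ η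

/-- The quartic part of the differentiated kernel, regularized by `s`. -/
noncomputable def curvKerC (γ : ℝ → Plane) (s ξ η : ℝ) : ℝ :=
  inner ℝ (γ ξ - γ η) (tangent γ ξ) * inner ℝ (γ ξ - γ η) (tangent γ ξ - tangent γ η) /
    regDenom γ s ξ η ^ 2

/-- The majorant of the differentiated kernel. -/
noncomputable def curvBound (p : ℝ) (γ : ℝ → Plane) (ξ η : ℝ) : ℝ :=
  torDist (ξ - η) ^ (1 - 1 / p - 2) * ‖tangent γ ξ - tangent γ η‖ +
    torDist (ξ - η) ^ (1 - 1 / p - 1) * ‖deriv (tangent γ) ξ‖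

namespace RegularCurve

variable {p M : ℝ} {γ : ℝ → Plane}

theorem norm_tangent_sub_le_torDist (hγ : RegularCurve p M γ) (ξ η : ℝ) :
    ‖tangent γ ξ - tangent γ η‖ ≤ 2 * M ^ 2 * torDist (ξ - η) ^ (1 - 1 / p) := by
  have hM := hγ.M_pos
  refine (hγ.norm_tangent_sub_le ξ η).trans ?_
  calc _ ≤ 2 * M * (M * torDist (ξ - η) ^ (1 - 1 / p)) := by
        gcongr; exact hγ.norm_deriv_sub_le ξ η
    _ = _ := by ring

/-- For unit vectors this product is quadratic in the difference. One of the two factors supplies a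
gain of `t^α`. -/
theorem inner_tangent_sub (hγ : RegularCurve p M γ) (ξ η : ℝ) :
    inner ℝ (tangent γ ξ - tangent γ η) (tangent γ ξ) = ‖tangent γ ξ - tangent γ η‖ ^ 2 / 2 := by
  have h1 := norm_sub_sq_real (tangent γ ξ) (tangent γ η)
  rw [hγ.norm_tangent, hγ.norm_tangent] at h1
  rw [inner_sub_left, real_inner_self_eq_norm_sq, hγ.norm_tangent, h1,
    real_inner_comm (tangent γ ξ) (tangent γ η)]
  ring

theorem inner_tangent_sub_le (hγ : RegularCurve p M γ) (ξ η : ℝ) :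
    |inner ℝ (tangent γ ξ - tangent γ η) (tangent γ ξ)| ≤
      M ^ 2 * torDist (ξ - η) ^ (1 - 1 / p) * ‖tangent γ ξ - tangent γ η‖ := by
  rw [hγ.inner_tangent_sub, abs_of_nonneg (by positivity)]
  nlinarith [hγ.norm_tangent_sub_le_torDist ξ η, norm_nonneg (tangent γ ξ - tangent γ η)]

/-- Chords are nearly tangent. -/
theorem abs_inner_chord_le (hγ : RegularCurve p M γ) (ξ η : ℝ) (u : Plane) {K : ℝ}
    (hu : |inner ℝ (deriv γ ξ) u| ≤ K * torDist (ξ - η) ^ (1 - 1 / p)) :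
    |inner ℝ (γ ξ - γ η) u| ≤ (M * ‖u‖ + K) * torDist (ξ - η) ^ (1 - 1 / p) * torDist (ξ - η) := by
  have hM := hγ.M_pos
  have key : ∀ x, |inner ℝ (deriv γ ξ) u| ≤ K * torDist x ^ (1 - 1 / p) →
      |inner ℝ (γ ξ - γ (ξ - x)) u| ≤ (M * ‖u‖ + K) * torDist x ^ (1 - 1 / p) * torDist x := by
    refine periodic_induction (fun x => ?_) fun x hx hK => ?_
    · have : γ (ξ - (x + 2 * π)) = γ (ξ - x) := by
        rw [← hγ.periodic (ξ - (x + 2 * π)), sub_add_eq_sub_sub, sub_add_cancel]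
      rw [this, torDist_periodic]
    · rw [torDist_eq_abs hx] at hK ⊢
      have e : inner ℝ (γ ξ - γ (ξ - x)) u =
          inner ℝ (γ ξ - γ (ξ - x) - x • deriv γ ξ) u + x * inner ℝ (deriv γ ξ) u := by
        rw [inner_sub_left (γ ξ - γ (ξ - x)), inner_smul_left]; simp
      rw [e]
      refine (abs_add_le _ _).trans ?_
      rw [abs_mul]
      have h1 := (abs_real_inner_le_norm (γ ξ - γ (ξ - x) - x • deriv γ ξ) u).trans
        (mul_le_mul_of_nonneg_right (hγ.norm_taylor_le ξ x) (norm_nonneg u))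
      have h2 := mul_le_mul_of_nonneg_left hK (abs_nonneg x)
      linarith
  have := key (ξ - η)
  rw [sub_sub_cancel] at this
  exact this hu

theorem inv_regDenom_le (hγ : RegularCurve p M γ) {s ξ η : ℝ} (hs : 0 ≤ s) (h : 0 < torDist (ξ - η)) :
    (regDenom γ s ξ η)⁻¹ ≤ M ^ 2 * ((torDist (ξ - η)) ^ 2)⁻¹ := by
  have hd := hγ.chord_pos h
  have h1 : ‖γ ξ - γ η‖ ^ 2 ≤ regDenom γ s ξ η := by rw [regDenom]; linarith
  refine (inv_anti₀ (by positivity) h1).trans ?_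
  rw [← inv_pow, ← inv_pow, ← mul_pow]
  exact pow_le_pow_left₀ (by positivity) (hγ.inv_norm_sub_le h) 2

theorem chord_eq_zero (hγ : RegularCurve p M γ) {ξ η : ℝ} (h : torDist (ξ - η) = 0) :
    γ ξ - γ η = 0 ∧ tangent γ ξ - tangent γ η = 0 := by
  have h1 := hγ.norm_sub_le_torDist ξ η
  have h2 := hγ.norm_tangent_sub_le_torDist ξ η
  rw [h, mul_zero, norm_le_zero_iff] at h1
  rw [h, Real.zero_rpow hγ.exponent_pos.ne', mul_zero, norm_le_zero_iff] at h2
  exact ⟨h1, h2⟩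

theorem curvBound_nonneg (p : ℝ) (γ : ℝ → Plane) (ξ η : ℝ) : 0 ≤ curvBound p γ ξ η := by
  have h1 := Real.rpow_nonneg (torDist_nonneg (ξ - η)) (1 - 1 / p - 2)
  have h2 := Real.rpow_nonneg (torDist_nonneg (ξ - η)) (1 - 1 / p - 1)
  unfold curvBound; positivity

/-- The tangent term is quadratic in `T(ξ) - T(η)`. In the other term `∂_ξ T(ξ)` is orthogonal to
`γ̇(ξ)`, so only the Taylor remainder of the chord contributes. These give the two summands of
`curvBound`. -/
theorem abs_curvKerB_le (hγ : RegularCurve p M γ) {s : ℝ} (hs : 0 ≤ s) (ξ η : ℝ) :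
    |curvKerB γ s ξ η| ≤ 2 * M ^ 6 * curvBound p γ ξ η := by
  have hM := hγ.M_pos
  have hM1 := hγ.one_lt'.le
  rcases (torDist_nonneg (ξ - η)).eq_or_lt with h0 | h0
  · obtain ⟨h1, h2⟩ := hγ.chord_eq_zero h0.symm
    have := curvBound_nonneg p γ ξ η
    simp only [curvKerB, h1, h2, inner_zero_left, mul_zero, add_zero, zero_div, abs_zero]
    positivity
  have hQ := hγ.regDenom_pos hs h0
  have hQi := hγ.inv_regDenom_le hs h0
  set t := torDist (ξ - η) with ht
  have h1 := hγ.inner_tangent_sub_le ξ η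
  -- Orthogonality of `∂_ξ T` and `γ̇` allows `K = 0`.
  have h2 := hγ.abs_inner_chord_le ξ η (deriv (tangent γ) ξ) (K := 0) (by
    rw [← hγ.speed_smul_tangent, inner_smul_left, real_inner_comm, hγ.inner_deriv_tangent]
    simp)
  rw [add_zero, ← ht] at h2
  rw [← ht] at h1
  have hg := hγ.inv_speed_le ξ
  have hg0 : 0 ≤ (speed γ ξ)⁻¹ := inv_nonneg.2 (hγ.speed_pos ξ).le
  have hn : |inner ℝ (tangent γ ξ - tangent γ η) (tangent γ ξ) +
      (speed γ ξ)⁻¹ * inner ℝ (γ ξ - γ η) (deriv (tangent γ) ξ)| ≤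
      M ^ 2 * t ^ (1 - 1 / p) * ‖tangent γ ξ - tangent γ η‖ +
      M * (M * ‖deriv (tangent γ) ξ‖ * t ^ (1 - 1 / p) * t) := by
    refine (abs_add_le _ _).trans (add_le_add h1 ?_)
    rw [abs_mul, abs_of_nonneg hg0]
    exact mul_le_mul hg h2 (abs_nonneg _) hM.le
  have e1 : t ^ (1 - 1 / p - 1) = t ^ (1 - 1 / p) * t * (t ^ 2)⁻¹ := by
    rw [Real.rpow_sub_one h0.ne']; field_simp
  have e2 : t ^ (1 - 1 / p - 2) = t ^ (1 - 1 / p) * (t ^ 2)⁻¹ := by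
    rw [Real.rpow_sub h0, Real.rpow_two, div_eq_mul_inv]
  have hM46 : M ^ 4 ≤ 2 * M ^ 6 := by
    have : M ^ 4 ≤ M ^ 6 := pow_le_pow_right₀ hM1 (by norm_num)
    have : 0 < M ^ 6 := by positivity
    linarith
  rw [curvKerB, abs_div, abs_of_pos hQ, div_eq_mul_inv]
  calc _ ≤ (M ^ 2 * t ^ (1 - 1 / p) * ‖tangent γ ξ - tangent γ η‖ +
        M * (M * ‖deriv (tangent γ) ξ‖ * t ^ (1 - 1 / p) * t)) * (M ^ 2 * (t ^ 2)⁻¹) :=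
        mul_le_mul hn hQi (by positivity) (by positivity)
    _ = M ^ 4 * curvBound p γ ξ η := by rw [curvBound, ← ht, e1, e2]; ring
    _ ≤ _ := mul_le_mul_of_nonneg_right hM46 (curvBound_nonneg p γ ξ η)

/-- The vector `T(ξ) - T(η)` is nearly orthogonal to `T(ξ)`, hence to the chord. The second inner
product therefore gains a factor `t^α` over the Cauchy-Schwarz bound. -/
theorem abs_curvKerC_le (hγ : RegularCurve p M γ) {s : ℝ} (hs : 0 ≤ s) (ξ η : ℝ) :
    |curvKerC γ s ξ η| ≤ 2 * M ^ 6 * curvBound p γ ξ η := by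
  have hM := hγ.M_pos
  have hM1 := hγ.one_lt'.le
  rcases (torDist_nonneg (ξ - η)).eq_or_lt with h0 | h0
  · obtain ⟨h1, h2⟩ := hγ.chord_eq_zero h0.symm
    have := curvBound_nonneg p γ ξ η
    simp only [curvKerC, h1, inner_zero_left, mul_zero, zero_div, abs_zero]
    positivity
  have hd := hγ.chord_pos h0
  have hQ := hγ.regDenom_pos hs h0
  have hQd : ‖γ ξ - γ η‖ ^ 2 ≤ regDenom γ s ξ η := by rw [regDenom]; linarith
  have hinv := hγ.inv_norm_sub_le h0
  set t := torDist (ξ - η) with ht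
  have h1 := hγ.inner_tangent_sub_le ξ η
  -- This `K` is the speed bound `M` times the factor `M ^ 2 * ‖tangent γ ξ - tangent γ η‖` of the
  -- quadratic estimate.
  have h2 := hγ.abs_inner_chord_le ξ η (tangent γ ξ - tangent γ η)
    (K := M ^ 3 * ‖tangent γ ξ - tangent γ η‖) (by
      rw [← hγ.speed_smul_tangent, inner_smul_left, real_inner_comm, conj_trivial, abs_mul,
        abs_of_pos (hγ.speed_pos ξ)]
      refine (mul_le_mul (hγ.speed_le ξ) h1 (abs_nonneg _) hM.le).trans (le_of_eq ?_)
      ring)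
  rw [← ht] at h2
  have h3 : |inner ℝ (γ ξ - γ η) (tangent γ ξ)| ≤ ‖γ ξ - γ η‖ := by
    have := abs_real_inner_le_norm (γ ξ - γ η) (tangent γ ξ)
    rwa [hγ.norm_tangent, mul_one] at this
  have e2 : t ^ (1 - 1 / p - 2) = t ^ (1 - 1 / p) * t * t⁻¹ ^ 3 := by
    rw [Real.rpow_sub h0, Real.rpow_two]; field_simp
  have hM46 : (M + M ^ 3) * M ^ 3 ≤ 2 * M ^ 6 := by
    have : M ^ 4 ≤ M ^ 6 := pow_le_pow_right₀ hM1 (by norm_num)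
    nlinarith
  have hb : t ^ (1 - 1 / p - 2) * ‖tangent γ ξ - tangent γ η‖ ≤ curvBound p γ ξ η := by
    have := Real.rpow_nonneg h0.le (1 - 1 / p - 1)
    rw [curvBound, ← ht]
    have : 0 ≤ t ^ (1 - 1 / p - 1) * ‖deriv (tangent γ) ξ‖ := by positivity
    linarith
  have hT := norm_nonneg (tangent γ ξ - tangent γ η)
  have hta := Real.rpow_nonneg h0.le (1 - 1 / p)
  rw [curvKerC, abs_div, abs_mul, abs_of_pos (pow_pos hQ 2)]
  calc _ ≤ ‖γ ξ - γ η‖ * ((M * ‖tangent γ ξ - tangent γ η‖ + M ^ 3 * ‖tangent γ ξ - tangent γ η‖) *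
        t ^ (1 - 1 / p) * t) / (‖γ ξ - γ η‖ ^ 2) ^ 2 := by gcongr
    _ = (M + M ^ 3) * ‖tangent γ ξ - tangent γ η‖ * t ^ (1 - 1 / p) * t * ‖γ ξ - γ η‖⁻¹ ^ 3 := by
        field_simp
    _ ≤ (M + M ^ 3) * ‖tangent γ ξ - tangent γ η‖ * t ^ (1 - 1 / p) * t * (M * t⁻¹) ^ 3 := by gcongr
    _ = ((M + M ^ 3) * M ^ 3) * (t ^ (1 - 1 / p - 2) * ‖tangent γ ξ - tangent γ η‖) := by
        rw [e2]; ring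
    _ ≤ _ := mul_le_mul hM46 hb (by positivity) (by positivity)

theorem deriv_tangent_periodic (hγ : RegularCurve p M γ) :
    Function.Periodic (deriv (tangent γ)) (2 * π) := hγ.tangent_periodic.deriv_periodic

theorem lintegral_deriv_tangent_le (hγ : RegularCurve p M γ) :
    ∫⁻ x, ‖deriv (tangent γ) x‖ₑ ^ p ∂torusMeasure ≤ ENNReal.ofReal (2 * M ^ 2) ^ p := by
  have hM := hγ.M_pos
  have hp : 0 ≤ p := by linarith [hγ.one_lt]
  have h1 : ∫⁻ x, ‖deriv (tangent γ) x‖ₑ ^ p ∂torusMeasure ≤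
      ∫⁻ x, ENNReal.ofReal (2 * M) ^ p * ‖deriv (deriv γ) x‖ₑ ^ p ∂torusMeasure := by
    refine lintegral_mono_ae ?_
    filter_upwards [ae_torus_of_ae hγ.isPrimitive_tangent.2] with x hx
    rw [← ENNReal.mul_rpow_of_nonneg _ _ hp]
    refine ENNReal.rpow_le_rpow ?_ hp
    rw [← ofReal_norm, ← ofReal_norm, ← ENNReal.ofReal_mul (by positivity)]
    exact ENNReal.ofReal_le_ofReal hx
  refine h1.trans ?_
  rw [lintegral_const_mul' _ _ (ENNReal.rpow_ne_top_of_nonneg hp ENNReal.ofReal_ne_top)]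
  refine (mul_le_mul_right hγ.lintegral_le _).trans (le_of_eq ?_)
  rw [← ENNReal.mul_rpow_of_nonneg _ _ hp, ← ENNReal.ofReal_mul (by positivity)]
  congr 2; ring

theorem lintegral_deriv_tangent_lt_top (hγ : RegularCurve p M γ) :
    ∫⁻ x, ‖deriv (tangent γ) x‖ₑ ^ p ∂torusMeasure < ⊤ :=
  hγ.lintegral_deriv_tangent_le.trans_lt
    (ENNReal.rpow_lt_top_of_nonneg (by linarith [hγ.one_lt]) ENNReal.ofReal_ne_top)

/-- The `L^p` bound of the majorant of the differentiated kernel. -/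
theorem exists_lintegral_curvBound_le (hp : 1 < p) (M : ℝ) :
    ∃ C : ℝ≥0, ∀ γ : ℝ → Plane, RegularCurve p M γ →
      ∫⁻ ξ, (∫⁻ η, ENNReal.ofReal (curvBound p γ ξ η) ∂torusMeasure) ^ p ∂torusMeasure ≤ C := by
  have hp0 : 0 < p := by linarith
  set W := ∫⁻ x, ENNReal.ofReal (torDist x ^ (1 - 1 / p - 1)) ∂torusMeasure with hW
  have hβ : -1 < 1 - 1 / p - 1 := by
    have : 1 / p < 1 := (div_lt_one hp0).2 hp
    linarith
  have hWt : W ≠ ⊤ := (lintegral_torDist_rpow_lt_top hβ).ne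
  set A : ℝ≥0∞ := 2 ^ (p - 1) * (W ^ p * ENNReal.ofReal (2 * M ^ 2) ^ p +
    W ^ p * ENNReal.ofReal (2 * M ^ 2) ^ p) with hA
  have hWp : W ^ p * ENNReal.ofReal (2 * M ^ 2) ^ p ≠ ⊤ :=
    ENNReal.mul_ne_top (ENNReal.rpow_ne_top_of_nonneg hp0.le hWt)
      (ENNReal.rpow_ne_top_of_nonneg hp0.le ENNReal.ofReal_ne_top)
  have hAt : A ≠ ⊤ := ENNReal.mul_ne_top (ENNReal.rpow_ne_top_of_nonneg (by linarith) (by simp))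
    (ENNReal.add_ne_top.2 ⟨hWp, hWp⟩)
  refine ⟨A.toNNReal, fun γ hγ => ?_⟩
  rw [ENNReal.coe_toNNReal hAt]
  have htm : Measurable torDist := continuous_torDist.measurable
  have hTm := hγ.continuous_tangent.measurable
  have hdm : Measurable (deriv (tangent γ)) := measurable_deriv _
  have h1 := hγ.isPrimitive_tangent.1.lintegral_increment_le hp (α := 1 - 1 / p) hγ.exponent_lt
    hdm hγ.tangent_periodic hγ.deriv_tangent_periodic
  -- The first summand is covered by the increment inequality for `T`. The second integrates to the
  -- constant `W` times `|∂_ξ T(ξ)|`.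
  have e : ∀ ξ, ∫⁻ η, ENNReal.ofReal (curvBound p γ ξ η) ∂torusMeasure =
      (∫⁻ η, ENNReal.ofReal (torDist (ξ - η) ^ (1 - 1 / p - 2)) * ‖tangent γ ξ - tangent γ η‖ₑ
        ∂torusMeasure) + W * ‖deriv (tangent γ) ξ‖ₑ := fun ξ => by
    have e1 : ∀ η, ENNReal.ofReal (curvBound p γ ξ η) =
        ENNReal.ofReal (torDist (ξ - η) ^ (1 - 1 / p - 2)) * ‖tangent γ ξ - tangent γ η‖ₑ +
        ENNReal.ofReal (torDist (ξ - η) ^ (1 - 1 / p - 1)) * ‖deriv (tangent γ) ξ‖ₑ := fun η => by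
      have h2 := Real.rpow_nonneg (torDist_nonneg (ξ - η)) (1 - 1 / p - 2)
      have h3 := Real.rpow_nonneg (torDist_nonneg (ξ - η)) (1 - 1 / p - 1)
      rw [curvBound, ENNReal.ofReal_add (by positivity) (by positivity), ENNReal.ofReal_mul h2,
        ENNReal.ofReal_mul h3, ofReal_norm, ofReal_norm]
    simp_rw [e1]
    rw [lintegral_add_left, lintegral_mul_const' _ _ (by simp),
      lintegral_torus_sub_left (F := fun x => ENNReal.ofReal (torDist x ^ (1 - 1 / p - 1)))
        (fun x => by simp only [torDist_periodic x])]
    exact ((htm.comp (measurable_const.sub measurable_id)).pow_const _).ennreal_ofReal.mul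
      (measurable_const.sub hTm).enorm
  simp_rw [e]
  refine (lintegral_mono fun ξ => ENNReal.rpow_add_le_mul_rpow_add_rpow _ _ hp.le).trans ?_
  rw [lintegral_const_mul' _ _ (ENNReal.rpow_ne_top_of_nonneg (by linarith) (by simp)),
    lintegral_add_right _ ((hdm.enorm.const_mul W).pow_const p)]
  refine mul_le_mul_right (add_le_add (h1.trans ?_) ?_) _
  · exact mul_le_mul_right hγ.lintegral_deriv_tangent_le _
  · simp_rw [ENNReal.mul_rpow_of_nonneg _ _ hp0.le]
    rw [lintegral_const_mul' _ _ (ENNReal.rpow_ne_top_of_nonneg hp0.le hWt)]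
    exact mul_le_mul_right hγ.lintegral_deriv_tangent_le _

theorem measurable_curvBound (hγ : RegularCurve p M γ) :
    Measurable fun z : ℝ × ℝ => curvBound p γ z.1 z.2 := by
  have htm : Measurable fun z : ℝ × ℝ => torDist (z.1 - z.2) :=
    continuous_torDist.measurable.comp (measurable_fst.sub measurable_snd)
  have hTm := hγ.continuous_tangent.measurable
  have hdm : Measurable (deriv (tangent γ)) := measurable_deriv _
  have h1 : Measurable fun z : ℝ × ℝ => ‖tangent γ z.1 - tangent γ z.2‖ :=
    ((hTm.comp measurable_fst).sub (hTm.comp measurable_snd)).norm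
  have h2 : Measurable fun z : ℝ × ℝ => ‖deriv (tangent γ) z.1‖ := (hdm.comp measurable_fst).norm
  unfold curvBound
  exact ((htm.pow_const _).mul h1).add ((htm.pow_const _).mul h2)

theorem integrable_curvBound (hγ : RegularCurve p M γ) :
    Integrable (fun z : ℝ × ℝ => curvBound p γ z.1 z.2) (torusMeasure.prod torusMeasure) := by
  obtain ⟨C, hC⟩ := exists_lintegral_curvBound_le hγ.one_lt M
  have hm := hγ.measurable_curvBound
  -- On a finite measure space this turns the `L^p` bound of the inner integral into integrability.
  have h1 : ∀ a : ℝ≥0∞, a ≤ 1 + a ^ p := fun a => by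
    rcases le_total a 1 with h | h
    · exact h.trans le_self_add
    · refine le_trans ?_ le_add_self
      conv_lhs => rw [← ENNReal.rpow_one a]
      exact ENNReal.rpow_le_rpow_of_exponent_le h hγ.one_lt.le
  have h2 : ∫⁻ ξ, (1 + (∫⁻ η, ENNReal.ofReal (curvBound p γ ξ η) ∂torusMeasure) ^ p)
      ∂torusMeasure < ⊤ := by
    rw [lintegral_add_left measurable_const, lintegral_const, one_mul]
    exact ENNReal.add_lt_top.2 ⟨measure_lt_top _ _, (hC γ hγ).trans_lt ENNReal.coe_lt_top⟩
  have h3 : ∫⁻ z : ℝ × ℝ, ENNReal.ofReal (curvBound p γ z.1 z.2) ∂torusMeasure.prod torusMeasure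
      < ⊤ := by
    rw [lintegral_prod _ hm.ennreal_ofReal.aemeasurable]
    exact (lintegral_mono fun ξ => h1 _).trans_lt h2
  have h0 : 0 ≤ᵐ[torusMeasure.prod torusMeasure] fun z : ℝ × ℝ => curvBound p γ z.1 z.2 :=
    Eventually.of_forall fun z => curvBound_nonneg p γ z.1 z.2
  refine ⟨hm.aestronglyMeasurable, ?_⟩
  rw [hasFiniteIntegral_iff_ofReal h0]
  exact h3

end RegularCurve

/-- The kernel of the differentiated tangential derivative, regularized by `s`. -/
noncomputable def curvKer (γ : ℝ → Plane) (s ξ η : ℝ) : ℝ :=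
  curvKerB γ s ξ η - 2 * curvKerC γ s ξ η

/-- The integrand of the regularized tangential derivative of the velocity, minus the logarithmic
potential of the derivative of the tangent. -/
noncomputable def tangentialInt (γ : ℝ → Plane) (s ξ η : ℝ) : Plane :=
  ((regDenom γ s ξ η)⁻¹ • inner ℝ (γ ξ - γ η) (tangent γ ξ)) • deriv γ η +
    (Real.log (regDenom γ s ξ η) / 2) • (-deriv (tangent γ) η)

/-- The derivative of `tangentialInt` in its first label. -/
noncomputable def tangentialInt' (γ : ℝ → Plane) (s ξ η : ℝ) : Plane :=
  ((regDenom γ s ξ η)⁻¹ • (inner ℝ (γ ξ - γ η) (deriv (tangent γ) ξ) +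
      inner ℝ (deriv γ ξ) (tangent γ ξ)) +
    (-(2 * inner ℝ (γ ξ - γ η) (deriv γ ξ)) / regDenom γ s ξ η ^ 2) •
      inner ℝ (γ ξ - γ η) (tangent γ ξ)) • deriv γ η +
  (inner ℝ (γ ξ - γ η) (deriv γ ξ) / regDenom γ s ξ η) • (-deriv (tangent γ) η)

/-! ### Differentiation of the regularized tangential derivative. -/

namespace RegularCurve

variable {p M : ℝ} {γ : ℝ → Plane}

theorem continuous_regDenom_left (hγ : RegularCurve p M γ) (s η : ℝ) :
    Continuous fun ξ => regDenom γ s ξ η := by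
  have := hγ.continuous
  unfold regDenom
  fun_prop

theorem continuous_regDenom_right (hγ : RegularCurve p M γ) (s ξ : ℝ) :
    Continuous fun η => regDenom γ s ξ η := by
  have := hγ.continuous
  unfold regDenom
  fun_prop

/-- With `η` fixed and `s > 0`, every factor is `C¹` in `ξ` except `T(ξ)`, which is merely
absolutely continuous. Hence the product rules for primitives are used instead of pointwise
derivatives. -/
theorem isPrimitive_tangentialInt (hγ : RegularCurve p M γ) {s : ℝ} (hs : 0 < s) (η : ℝ) :
    IsPrimitive (fun ξ => tangentialInt γ s ξ η) (fun ξ => tangentialInt' γ s ξ η) := by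
  have hc1 := hγ.continuous
  have hc2 := hγ.continuous_deriv
  have hq : Continuous fun ξ => regDenom γ s ξ η :=
    hγ.continuous_regDenom_left s η
  have hQ : ∀ ξ, regDenom γ s ξ η ≠ 0 := fun ξ => (regDenom_pos_of_pos γ hs ξ η).ne'
  have h1 : IsPrimitive (fun ξ => γ ξ - γ η) (deriv γ) :=
    isPrimitive_of_hasDerivAt (fun ξ => (hγ.hasDerivAt ξ).sub_const (γ η)) hc2
  have h2 := h1.inner hγ.isPrimitive_tangent.1
  have h3 : IsPrimitive (fun ξ => (regDenom γ s ξ η)⁻¹)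
      (fun ξ => -(2 * inner ℝ (γ ξ - γ η) (deriv γ ξ)) / regDenom γ s ξ η ^ 2) := by
    refine isPrimitive_of_hasDerivAt (fun ξ => (hγ.hasDerivAt_regDenom s ξ η).inv (hQ ξ)) ?_
    exact Continuous.div (by fun_prop) (hq.pow 2) fun ξ => pow_ne_zero 2 (hQ ξ)
  have h4 : IsPrimitive (fun ξ => Real.log (regDenom γ s ξ η) / 2)
      (fun ξ => inner ℝ (γ ξ - γ η) (deriv γ ξ) / regDenom γ s ξ η) := by
    refine isPrimitive_of_hasDerivAt (fun ξ => ?_) (Continuous.div (by fun_prop) hq hQ)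
    exact (((hγ.hasDerivAt_regDenom s ξ η).log (hQ ξ)).div_const 2).congr_deriv (by ring)
  exact ((h3.smul h2).clm (ContinuousLinearMap.toSpanSingleton ℝ (deriv γ η))).add
    (h4.clm (ContinuousLinearMap.toSpanSingleton ℝ (-deriv (tangent γ) η)))

theorem continuous_curvKer_right (hγ : RegularCurve p M γ) {s : ℝ} (hs : 0 < s) (ξ : ℝ) :
    Continuous (curvKer γ s ξ) := by
  have hc1 := hγ.continuous
  have hc2 := hγ.continuous_tangent
  have hq : Continuous fun η => regDenom γ s ξ η :=
    hγ.continuous_regDenom_right s ξ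
  have hQ : ∀ η, regDenom γ s ξ η ≠ 0 := fun η => (regDenom_pos_of_pos γ hs ξ η).ne'
  unfold curvKer curvKerB curvKerC
  exact (Continuous.div (by fun_prop) hq hQ).sub (continuous_const.mul
    (Continuous.div (by fun_prop) (hq.pow 2) fun η => pow_ne_zero 2 (hQ η)))

/-- Integration by parts in the second label. -/
theorem integral_tangentialInt' (hγ : RegularCurve p M γ) {s : ℝ} (hs : 0 < s) (ξ : ℝ) :
    ∫ η, tangentialInt' γ s ξ η ∂torusMeasure =
      ∫ η, (speed γ ξ * curvKer γ s ξ η) • deriv γ η ∂torusMeasure := by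
  have hc1 := hγ.continuous
  have hc2 := hγ.continuous_deriv
  have hq : Continuous fun η => regDenom γ s ξ η :=
    hγ.continuous_regDenom_right s ξ
  have hQ : ∀ η, regDenom γ s ξ η ≠ 0 := fun η => (regDenom_pos_of_pos γ hs ξ η).ne'
  -- The total derivative of the periodic function `η ↦ c(η) T(η)` integrates to zero. Subtracting
  -- `g(ξ)` times it converts `tangentialInt'` into the `curvKer` integrand.
  set c : ℝ → ℝ := fun η => (regDenom γ s ξ η)⁻¹ * inner ℝ (γ ξ - γ η) (tangent γ ξ) with hc
  set c' : ℝ → ℝ := fun η => (2 * inner ℝ (γ ξ - γ η) (deriv γ η)) / regDenom γ s ξ η ^ 2 *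
    inner ℝ (γ ξ - γ η) (tangent γ ξ) - (regDenom γ s ξ η)⁻¹ * inner ℝ (deriv γ η) (tangent γ ξ)
    with hc'
  have h1 : IsPrimitive c c' := by
    refine isPrimitive_of_hasDerivAt (fun η => ?_) ?_
    · have d1 := (hγ.hasDerivAt_regDenom_right s ξ η).inv (hQ η)
      have d2 := ((hγ.hasDerivAt η).const_sub (γ ξ)).inner ℝ (hasDerivAt_const η (tangent γ ξ))
      refine (d1.mul d2).congr_deriv ?_
      simp only [hc', inner_neg_left, inner_zero_right, neg_neg, Pi.inv_apply]
      ring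
    · have e1 : Continuous fun η => (2 * inner ℝ (γ ξ - γ η) (deriv γ η)) / regDenom γ s ξ η ^ 2 :=
        Continuous.div (by fun_prop) (hq.pow 2) fun η => pow_ne_zero 2 (hQ η)
      have e2 : Continuous fun η => (regDenom γ s ξ η)⁻¹ := hq.inv₀ hQ
      fun_prop
  have h2 := h1.smul hγ.isPrimitive_tangent.1
  have h3 := h2.integral_torus_eq_zero fun η => by
    simp only [hc, regDenom, hγ.periodic η, hγ.tangent_periodic η]
  have e : ∀ η, tangentialInt' γ s ξ η = (speed γ ξ * curvKer γ s ξ η) • deriv γ η -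
      speed γ ξ • (c η • deriv (tangent γ) η + c' η • tangent γ η) := fun η => by
    have hg := (hγ.speed_pos ξ).ne'
    have hT : inner ℝ (tangent γ ξ) (tangent γ ξ) = (1 : ℝ) := by
      rw [real_inner_self_eq_norm_sq, hγ.norm_tangent, one_pow]
    -- Comparison of the scalar coefficients of `T(η)`, after writing `γ̇ = g T` at both labels and
    -- using `T · T = 1`.
    have hA : ((regDenom γ s ξ η)⁻¹ • (inner ℝ (γ ξ - γ η) (deriv (tangent γ) ξ) +
        inner ℝ (deriv γ ξ) (tangent γ ξ)) + (-(2 * inner ℝ (γ ξ - γ η) (deriv γ ξ)) /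
        regDenom γ s ξ η ^ 2) • inner ℝ (γ ξ - γ η) (tangent γ ξ)) * speed γ η =
        speed γ ξ * curvKer γ s ξ η * speed γ η - speed γ ξ * c' η := by
      simp only [hc', curvKer, curvKerB, curvKerC, smul_eq_mul, ← hγ.speed_smul_tangent ξ,
        ← hγ.speed_smul_tangent η, inner_smul_right, inner_smul_left, conj_trivial, hT,
        inner_sub_left (tangent γ ξ), inner_sub_right (γ ξ - γ η) (tangent γ ξ)]
      have := hQ η
      field_simp
      ring
    have hB : inner ℝ (γ ξ - γ η) (deriv γ ξ) / regDenom γ s ξ η = speed γ ξ * c η := by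
      simp only [hc, ← hγ.speed_smul_tangent ξ, inner_smul_right]
      ring
    rw [tangentialInt', hB, ← hγ.speed_smul_tangent η, smul_smul, hA]
    module
  have i1 : Continuous fun η => (speed γ ξ * curvKer γ s ξ η) • deriv γ η :=
    (continuous_const.mul (hγ.continuous_curvKer_right hs ξ)).smul hc2
  have i2 : Integrable (fun η => speed γ ξ • (c η • deriv (tangent γ) η + c' η • tangent γ η))
    torusMeasure := h2.integrable_torus.smul (speed γ ξ)
  simp_rw [e]
  rw [integral_sub i1.integrable_torus i2, integral_smul, h3, smul_zero, sub_zero]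

theorem integrable_deriv_tangent (hγ : RegularCurve p M γ) :
    Integrable (deriv (tangent γ)) torusMeasure :=
  hγ.isPrimitive_tangent.1.integrable_torus

theorem measurable_tangentialInt' (hγ : RegularCurve p M γ) (s : ℝ) :
    Measurable fun z : ℝ × ℝ => tangentialInt' γ s z.1 z.2 := by
  have hc1 := hγ.continuous
  have hc2 := hγ.continuous_deriv
  have hc3 := hγ.continuous_tangent
  have hdm : Measurable (deriv (tangent γ)) := measurable_deriv _
  have hq := (hγ.continuous_regDenom s).measurable
  have m1 : Measurable fun z : ℝ × ℝ => γ z.1 - γ z.2 :=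
    (by fun_prop : Continuous fun z : ℝ × ℝ => γ z.1 - γ z.2).measurable
  have m2 : Measurable fun z : ℝ × ℝ => inner ℝ (γ z.1 - γ z.2) (deriv (tangent γ) z.1) :=
    m1.inner (hdm.comp measurable_fst)
  have m3 : Measurable fun z : ℝ × ℝ => inner ℝ (deriv γ z.1) (tangent γ z.1) :=
    (by fun_prop : Continuous fun z : ℝ × ℝ => inner ℝ (deriv γ z.1) (tangent γ z.1)).measurable
  have m4 : Measurable fun z : ℝ × ℝ => inner ℝ (γ z.1 - γ z.2) (deriv γ z.1) :=
    (by fun_prop : Continuous fun z : ℝ × ℝ => inner ℝ (γ z.1 - γ z.2) (deriv γ z.1)).measurable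
  have m5 : Measurable fun z : ℝ × ℝ => inner ℝ (γ z.1 - γ z.2) (tangent γ z.1) :=
    (by fun_prop : Continuous fun z : ℝ × ℝ => inner ℝ (γ z.1 - γ z.2) (tangent γ z.1)).measurable
  have m6 : Measurable fun z : ℝ × ℝ => deriv γ z.2 := hc2.measurable.comp measurable_snd
  have m7 : Measurable fun z : ℝ × ℝ => -deriv (tangent γ) z.2 := (hdm.comp measurable_snd).neg
  exact (((hq.inv.smul (m2.add m3)).add (((m4.const_mul 2).neg.div (hq.pow_const 2)).smul m5)).smul
    m6).add ((m4.div hq).smul m7)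

/-- A crude bound that degenerates as `s → 0`. It serves only Fubini's theorem at fixed `s`;
uniformity is needed only after integration by parts. -/
theorem integrable_tangentialInt' (hγ : RegularCurve p M γ) {s : ℝ} (hs : 0 < s) :
    Integrable (Function.uncurry (tangentialInt' γ s)) (torusMeasure.prod torusMeasure) := by
  have hM := hγ.M_pos
  have hpi := Real.pi_pos
  have hi := hγ.integrable_deriv_tangent.norm
  have hB : Integrable (fun z : ℝ × ℝ =>
      (s⁻¹ * (M * π * ‖deriv (tangent γ) z.1‖ + M) + 2 * (M * π * M) / s ^ 2 * (M * π)) * M +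
        M * π * M / s * ‖deriv (tangent γ) z.2‖) (torusMeasure.prod torusMeasure) :=
    ((((((hi.comp_fst torusMeasure).const_mul (M * π)).add (integrable_const M)).const_mul s⁻¹).add
      (integrable_const _)).mul_const M).add ((hi.comp_snd torusMeasure).const_mul _)
  refine hB.mono' (hγ.measurable_tangentialInt' s).aestronglyMeasurable
    (Eventually.of_forall fun z => ?_)
  obtain ⟨ξ, η⟩ := z
  simp only [Function.uncurry]
  have hQ := regDenom_pos_of_pos γ hs ξ η
  have hsQ : s ≤ regDenom γ s ξ η := by rw [regDenom]; linarith [sq_nonneg ‖γ ξ - γ η‖]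
  have hin : ∀ {u : Plane} {K : ℝ}, ‖u‖ ≤ K → |inner ℝ (γ ξ - γ η) u| ≤ M * π * K := fun {u K} hu =>
    (abs_real_inner_le_norm _ _).trans (mul_le_mul (hγ.norm_chord_le ξ η) hu (norm_nonneg _)
      (by positivity))
  have hT := hin (hγ.norm_tangent ξ).le
  rw [mul_one] at hT
  have hDT : |inner ℝ (deriv γ ξ) (tangent γ ξ)| ≤ M := by
    refine (abs_real_inner_le_norm _ _).trans ?_
    rw [hγ.norm_tangent, mul_one]; exact hγ.norm_deriv_le ξ
  have hQi : (regDenom γ s ξ η)⁻¹ ≤ s⁻¹ := inv_anti₀ hs hsQ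
  have h1 := hin (le_refl ‖deriv (tangent γ) ξ‖)
  have h2 := hin (hγ.norm_deriv_le ξ)
  rw [tangentialInt']
  refine (norm_add_le _ _).trans (add_le_add ?_ ?_)
  · rw [norm_smul, Real.norm_eq_abs]
    refine mul_le_mul ((abs_add_le _ _).trans (add_le_add ?_ ?_)) (hγ.norm_deriv_le η)
      (norm_nonneg _) (by positivity)
    · rw [smul_eq_mul, abs_mul, abs_of_pos (inv_pos.2 hQ)]
      exact mul_le_mul hQi ((abs_add_le _ _).trans (add_le_add h1 hDT)) (abs_nonneg _)
        (by positivity)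
    · rw [smul_eq_mul, abs_mul, abs_div, abs_neg, abs_mul, abs_two, abs_of_pos (pow_pos hQ 2)]
      refine mul_le_mul ?_ hT (abs_nonneg _) (by positivity)
      gcongr
  · rw [norm_smul, norm_neg, Real.norm_eq_abs]
    exact mul_le_mul_of_nonneg_right
      (hγ.abs_inner_div_regDenom_le hs ξ η (hγ.norm_deriv_le ξ)) (norm_nonneg _)

theorem integral_tangentialInt (hγ : RegularCurve p M γ) {s : ℝ} (hs : 0 < s) (hs1 : s ≤ 1) (ξ : ℝ) :
    Integrable (tangentialInt γ s ξ) torusMeasure ∧ ∫ η, tangentialInt γ s ξ η ∂torusMeasure =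
      (speed γ ξ)⁻¹ • (∫ η, crossKer γ s ξ η ∂torusMeasure) - logInt γ s (deriv (tangent γ)) ξ := by
  have hc1 := hγ.continuous
  have hc2 := hγ.continuous_deriv
  have hq : Continuous fun η => regDenom γ s ξ η :=
    hγ.continuous_regDenom_right s ξ
  have hQ : ∀ η, regDenom γ s ξ η ≠ 0 := fun η => (regDenom_pos_of_pos γ hs ξ η).ne'
  have i1 : Continuous fun η =>
      (inner ℝ (γ ξ - γ η) (deriv γ ξ) / regDenom γ s ξ η) • deriv γ η :=
    (Continuous.div (by fun_prop) hq hQ).smul hc2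
  have i2 := hγ.integrable_logInt (measurable_deriv _) hγ.lintegral_deriv_tangent_lt_top hs.le hs1 ξ
  have i3 : Integrable (fun η => (speed γ ξ)⁻¹ •
      ((inner ℝ (γ ξ - γ η) (deriv γ ξ) / regDenom γ s ξ η) • deriv γ η)) torusMeasure :=
    i1.integrable_torus.smul (speed γ ξ)⁻¹
  have e : tangentialInt γ s ξ = fun η => (speed γ ξ)⁻¹ •
      ((inner ℝ (γ ξ - γ η) (deriv γ ξ) / regDenom γ s ξ η) • deriv γ η) -
      (Real.log (regDenom γ s ξ η) / 2) • deriv (tangent γ) η := by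
    funext η
    rw [tangentialInt, smul_neg, ← sub_eq_add_neg, tangent, inner_smul_right, smul_smul]
    congr 2
    rw [smul_eq_mul]; ring
  rw [e]
  refine ⟨i3.sub i2, ?_⟩
  rw [integral_sub i3 i2, integral_smul, hγ.integral_crossKer_eq hs, logInt]

theorem measurable_curvKerB (hγ : RegularCurve p M γ) (s : ℝ) :
    Measurable fun z : ℝ × ℝ => curvKerB γ s z.1 z.2 := by
  have hc1 := hγ.continuous
  have hc3 := hγ.continuous_tangent
  have hdm : Measurable (deriv (tangent γ)) := measurable_deriv _
  have m1 : Measurable fun z : ℝ × ℝ => γ z.1 - γ z.2 :=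
    (by fun_prop : Continuous fun z : ℝ × ℝ => γ z.1 - γ z.2).measurable
  have m2 : Measurable fun z : ℝ × ℝ => inner ℝ (γ z.1 - γ z.2) (deriv (tangent γ) z.1) :=
    m1.inner (hdm.comp measurable_fst)
  have m3 : Measurable fun z : ℝ × ℝ =>
      inner ℝ (tangent γ z.1 - tangent γ z.2) (tangent γ z.1) :=
    (by fun_prop : Continuous fun z : ℝ × ℝ =>
      inner ℝ (tangent γ z.1 - tangent γ z.2) (tangent γ z.1)).measurable
  have m5 : Measurable fun z : ℝ × ℝ => (speed γ z.1)⁻¹ :=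
    (hγ.continuous_speed.measurable.comp measurable_fst).inv
  exact (m3.add (m5.mul m2)).div (hγ.continuous_regDenom s).measurable

theorem measurable_curvKerC (hγ : RegularCurve p M γ) (s : ℝ) :
    Measurable fun z : ℝ × ℝ => curvKerC γ s z.1 z.2 := by
  have hc1 := hγ.continuous
  have hc3 := hγ.continuous_tangent
  have m4 : Measurable fun z : ℝ × ℝ => inner ℝ (γ z.1 - γ z.2) (tangent γ z.1) *
      inner ℝ (γ z.1 - γ z.2) (tangent γ z.1 - tangent γ z.2) :=
    (by fun_prop : Continuous fun z : ℝ × ℝ => inner ℝ (γ z.1 - γ z.2) (tangent γ z.1) *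
      inner ℝ (γ z.1 - γ z.2) (tangent γ z.1 - tangent γ z.2)).measurable
  exact m4.div ((hγ.continuous_regDenom s).measurable.pow_const 2)

theorem measurable_curvKer (hγ : RegularCurve p M γ) (s : ℝ) :
    Measurable fun z : ℝ × ℝ => curvKer γ s z.1 z.2 :=
  (hγ.measurable_curvKerB s).sub ((hγ.measurable_curvKerC s).const_mul 2)

theorem abs_curvKer_le (hγ : RegularCurve p M γ) {s : ℝ} (hs : 0 ≤ s) (ξ η : ℝ) :
    |curvKer γ s ξ η| ≤ 6 * M ^ 6 * curvBound p γ ξ η := by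
  rw [curvKer]
  refine (abs_sub _ _).trans ?_
  rw [abs_mul, abs_two]
  linarith [hγ.abs_curvKerB_le hs ξ η, hγ.abs_curvKerC_le hs ξ η]

theorem norm_curvKer_smul_le (hγ : RegularCurve p M γ) {s : ℝ} (hs : 0 ≤ s) (ξ η : ℝ) :
    ‖(speed γ ξ * curvKer γ s ξ η) • deriv γ η‖ ≤ 6 * M ^ 8 * curvBound p γ ξ η := by
  have hM := hγ.M_pos
  have h1 := hγ.abs_curvKer_le hs ξ η
  have h2 := curvBound_nonneg p γ ξ η
  rw [norm_smul, norm_mul, Real.norm_eq_abs (curvKer _ _ _ _), Real.norm_of_nonneg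
    (hγ.speed_pos ξ).le]
  calc speed γ ξ * |curvKer γ s ξ η| * ‖deriv γ η‖
      ≤ M * (6 * M ^ 6 * curvBound p γ ξ η) * M := by
        gcongr
        · exact hγ.speed_le ξ
        · exact hγ.norm_deriv_le η
    _ = _ := by ring

theorem tendsto_curvKer (hγ : RegularCurve p M γ) {ξ η : ℝ} (h : 0 < torDist (ξ - η)) :
    Tendsto (fun n => curvKer γ (regSeq n) ξ η) atTop (𝓝 (curvKer γ 0 ξ η)) := by
  have hQ := (hγ.regDenom_pos le_rfl h).ne'
  exact (tendsto_const_nhds.div tendsto_regDenom hQ).sub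
    ((tendsto_const_nhds.div (tendsto_regDenom.pow 2) (pow_ne_zero 2 hQ)).const_mul 2)

/-- The derivative of the tangential derivative of the velocity, up to a logarithmic potential. -/
theorem isPrimitive_tangentialDeriv (hγ : RegularCurve p M γ) :
    IsPrimitive (fun ξ => (speed γ ξ)⁻¹ • (∫ η, crossKer γ 0 ξ η ∂torusMeasure) -
        logInt γ 0 (deriv (tangent γ)) ξ)
      (fun ξ => ∫ η, (speed γ ξ * curvKer γ 0 ξ η) • deriv γ η ∂torusMeasure) := by
  have hM := hγ.M_pos
  have hdm : Measurable (deriv (tangent γ)) := measurable_deriv _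
  have hfin := hγ.lintegral_deriv_tangent_lt_top
  -- The uniform majorant is a multiple of `curvBound`. Subtracting the potential of `∂_ξ T` is what
  -- makes such a majorant available.
  refine (isPrimitive_of_tendsto_integral
    (F := fun n ξ η => (speed γ ξ * curvKer γ (regSeq n) ξ η) • deriv γ η)
    (G := fun n ξ => ∫ η, tangentialInt γ (regSeq n) ξ η ∂torusMeasure)
    (B := fun ξ η => 6 * M ^ 8 * curvBound p γ ξ η) (fun n x hx => ?_)
    (fun n => ?_) (hγ.integrable_curvBound.const_mul _)
    (fun n => Eventually.of_forall fun z => ?_) ?_ (fun x => ?_) ?_ ?_).1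
  · rw [integral_sub_integral_eq (F := tangentialInt' γ (regSeq n))
      (fun x hx => Eventually.of_forall fun η =>
        (hγ.isPrimitive_tangentialInt (regSeq_pos n) η).sub_eq 0 x)
      (hγ.integrable_tangentialInt' (regSeq_pos n))
      (fun x => (hγ.integral_tangentialInt (regSeq_pos n) (regSeq_le_one n) x).1) hx]
    simp_rw [hγ.integral_tangentialInt' (regSeq_pos n)]
  · exact (((hγ.continuous_speed.measurable.comp measurable_fst).mul
      (hγ.measurable_curvKer _)).smul
      (hγ.continuous_deriv.measurable.comp measurable_snd)).aestronglyMeasurable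
  · exact hγ.norm_curvKer_smul_le (regSeq_pos n).le z.1 z.2
  · filter_upwards [ae_prod_torDist_pos] with z hz
    exact ((hγ.tendsto_curvKer hz).const_mul _).smul_const _
  · simp_rw [fun n => (hγ.integral_tangentialInt (regSeq_pos n) (regSeq_le_one n) x).2]
    exact ((hγ.tendsto_integral_crossKer x).const_smul _).sub (hγ.tendsto_logInt hdm hfin x)
  · intro x
    simp only [hγ.logInt_periodic _ _ x, hγ.speed_periodic x, crossKer, regDenom, hγ.periodic x,
      hγ.deriv_periodic x]
  · intro x η
    simp only [curvKer, curvKerB, curvKerC, regDenom, hγ.periodic x, hγ.tangent_periodic x,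
      hγ.speed_periodic x, hγ.deriv_tangent_periodic x]

end RegularCurve

/-! ### Sobolev norms -/

theorem HasWeakDeriv.memSobolev_one {p : ℝ≥0∞} {f h : ℝ → Plane} (w : HasWeakDeriv f h)
    (hf : MemLp f p torusMeasure) (hh : MemLp h p torusMeasure) : MemSobolev 1 p f := by
  refine ⟨w.periodic, fun i hi => ?_, fun i hi => ?_⟩
  · obtain rfl : i = 0 := by omega
    exact w.weakDeriv
  · interval_cases i
    · exact hf
    · exact hh.ae_eq (EventuallyEq.symm (ae_torus_of_ae w.weakDeriv_ae_eq))

theorem HasWeakDeriv.memSobolev_two {p : ℝ≥0∞} {f h k : ℝ → Plane} (w : HasWeakDeriv f h)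
    (w' : HasWeakDeriv h k) (hf : MemLp f p torusMeasure) (hh : MemLp h p torusMeasure)
    (hk : MemLp k p torusMeasure) : MemSobolev 2 p f ∧ sobolevNorm 2 p f =
      eLpNorm f p torusMeasure + eLpNorm h p torusMeasure + eLpNorm k p torusMeasure := by
  have w2 : HasWeakDeriv (_root_.weakDeriv f) k :=
    w'.congr w.weakDeriv_ae_eq.symm w.weakDeriv.periodic'
  have e1 : _root_.weakDeriv f =ᵐ[torusMeasure] h := ae_torus_of_ae w.weakDeriv_ae_eq
  have e2 : _root_.weakDeriv (_root_.weakDeriv f) =ᵐ[torusMeasure] k :=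
    ae_torus_of_ae w2.weakDeriv_ae_eq
  refine ⟨⟨w.periodic, fun i hi => ?_, fun i hi => ?_⟩, ?_⟩
  · interval_cases i
    · exact w.weakDeriv
    · exact w2.weakDeriv
  · interval_cases i
    · exact hf
    · exact hh.ae_eq e1.symm
    · exact hk.ae_eq e2.symm
  · rw [sobolevNorm, Finset.sum_range_succ, Finset.sum_range_succ, Finset.sum_range_one]
    exact congrArg₂ _ (congrArg₂ _ rfl (eLpNorm_congr_ae e1)) (eLpNorm_congr_ae e2)

theorem eLpNorm_le_of_lintegral_le {α E : Type*} [MeasurableSpace α] [NormedAddCommGroup E]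
    {μ : Measure α} {p C : ℝ≥0∞} (hp : 0 < p.toReal) {f : α → E}
    (h : ∫⁻ x, ‖f x‖ₑ ^ p.toReal ∂μ ≤ C) : eLpNorm f p μ ≤ C ^ (1 / p.toReal) := by
  obtain ⟨h0, ht⟩ := ENNReal.toReal_pos_iff.1 hp
  rw [eLpNorm_eq_lintegral_rpow_enorm_toReal h0.ne' ht.ne]
  exact ENNReal.rpow_le_rpow h (by positivity)

/-! ### The tangential derivatives of the velocity -/

/-- The derivative of the velocity in the arc-length parameter. -/
noncomputable def tangentialDeriv (γ : ℝ → Plane) (ξ : ℝ) : Plane :=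
  (speed γ ξ)⁻¹ • ∫ η, crossKer γ 0 ξ η ∂torusMeasure

/-- The absolutely convergent part of the derivative of `tangentialDeriv`. -/
noncomputable def curvInt (γ : ℝ → Plane) (ξ : ℝ) : Plane :=
  ∫ η, (speed γ ξ * curvKer γ 0 ξ η) • deriv γ η ∂torusMeasure

namespace RegularCurve

section

variable {p M : ℝ} {γ : ℝ → Plane}

theorem tangentialDeriv_periodic (hγ : RegularCurve p M γ) :
    Function.Periodic (tangentialDeriv γ) (2 * π) := fun x => by
  simp only [tangentialDeriv, hγ.speed_periodic x, crossKer, regDenom, hγ.periodic x,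
    hγ.deriv_periodic x]

theorem curvInt_periodic (hγ : RegularCurve p M γ) :
    Function.Periodic (curvInt γ) (2 * π) := fun x => by
  simp only [curvInt, curvKer, curvKerB, curvKerC, regDenom, hγ.periodic x, hγ.tangent_periodic x,
    hγ.speed_periodic x, hγ.deriv_tangent_periodic x]

theorem speed_smul_tangentialDeriv (hγ : RegularCurve p M γ) (ξ : ℝ) :
    speed γ ξ • tangentialDeriv γ ξ = ∫ η, crossKer γ 0 ξ η ∂torusMeasure := by
  rw [tangentialDeriv, smul_inv_smul₀ (hγ.speed_pos ξ).ne']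

theorem enorm_curvInt_le (hγ : RegularCurve p M γ) (ξ : ℝ) : ‖curvInt γ ξ‖ₑ ≤
    ENNReal.ofReal (6 * M ^ 8) * ∫⁻ η, ENNReal.ofReal (curvBound p γ ξ η) ∂torusMeasure := by
  have hM := hγ.M_pos
  refine (enorm_integral_le_lintegral_enorm _).trans ?_
  rw [← lintegral_const_mul' _ _ ENNReal.ofReal_ne_top]
  refine lintegral_mono fun η => ?_
  rw [← ENNReal.ofReal_mul (by positivity), ← ofReal_norm]
  exact ENNReal.ofReal_le_ofReal (hγ.norm_curvKer_smul_le le_rfl ξ η)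

/-- The potential of `∂_ξ T` is added back, and its derivative `h` is the principal value of the
second formula up to sign and the factor `g⁻¹`. The constant combines the bound on `curvBound` with
that on potentials. -/
theorem exists_tangentialDeriv_isPrimitive (hp : 1 < p) (M : ℝ) :
    ∃ C : ℝ≥0, ∀ γ : ℝ → Plane, RegularCurve p M γ → ∃ h : ℝ → Plane,
      Function.Periodic h (2 * π) ∧
      IsPrimitive (tangentialDeriv γ) (fun ξ => curvInt γ ξ + h ξ) ∧
      ∫⁻ ξ, ‖curvInt γ ξ + h ξ‖ₑ ^ p ∂torusMeasure ≤ C ∧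
      ∀ᵐ ξ, Tendsto (fun ε => ∫ η in pvDomain ξ ε,
        (inner ℝ (γ ξ - γ η) (deriv γ ξ) / ‖γ ξ - γ η‖ ^ 2) • deriv (tangent γ) η) (𝓝[>] 0)
        (𝓝 (h ξ)) := by
  have hp0 : 0 ≤ p := by linarith
  obtain ⟨C₁, hC₁⟩ := exists_lintegral_curvBound_le hp M
  obtain ⟨C₂, hC₂⟩ := exists_logInt_isPrimitive hp M
  set K : ℝ≥0∞ := 2 ^ (p - 1) * (ENNReal.ofReal (6 * M ^ 8) ^ p * C₁ +
    C₂ * ENNReal.ofReal (2 * M ^ 2) ^ p) with hK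
  have hKt : K ≠ ⊤ := ENNReal.mul_ne_top (ENNReal.rpow_ne_top_of_nonneg (by linarith) (by simp))
    (ENNReal.add_ne_top.2 ⟨ENNReal.mul_ne_top (ENNReal.rpow_ne_top_of_nonneg hp0 ENNReal.ofReal_ne_top)
      (by simp), ENNReal.mul_ne_top (by simp) (ENNReal.rpow_ne_top_of_nonneg hp0 ENNReal.ofReal_ne_top)⟩)
  refine ⟨K.toNNReal, fun γ hγ => ?_⟩
  obtain ⟨h, hper, hprim, hle, hpv⟩ := hC₂ γ hγ (deriv (tangent γ)) (measurable_deriv _)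
    hγ.deriv_tangent_periodic hγ.lintegral_deriv_tangent_lt_top
  have hP : IsPrimitive (tangentialDeriv γ) (fun ξ => curvInt γ ξ + h ξ) := by
    have e : tangentialDeriv γ = fun ξ => (speed γ ξ)⁻¹ • (∫ η, crossKer γ 0 ξ η ∂torusMeasure) -
        logInt γ 0 (deriv (tangent γ)) ξ + logInt γ 0 (deriv (tangent γ)) ξ :=
      funext fun ξ => (sub_add_cancel _ _).symm
    rw [e]
    exact hγ.isPrimitive_tangentialDeriv.add hprim
  refine ⟨h, hper, hP, ?_, hpv⟩
  rw [ENNReal.coe_toNNReal hKt]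
  have h1 : ∀ ξ, ‖curvInt γ ξ + h ξ‖ₑ ^ p ≤ 2 ^ (p - 1) * (‖curvInt γ ξ‖ₑ ^ p + ‖h ξ‖ₑ ^ p) :=
    fun ξ => (ENNReal.rpow_le_rpow (enorm_add_le _ _) hp0).trans
      (ENNReal.rpow_add_le_mul_rpow_add_rpow _ _ hp.le)
  refine (lintegral_mono h1).trans ?_
  rw [lintegral_const_mul' _ _ (ENNReal.rpow_ne_top_of_nonneg (by linarith) (by simp)),
    lintegral_add_right' _ (hprim.integrable_torus.aestronglyMeasurable.enorm.pow_const p)]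
  refine mul_le_mul_right (add_le_add ?_ (hle.trans ?_)) _
  · refine (lintegral_mono fun ξ => ENNReal.rpow_le_rpow (hγ.enorm_curvInt_le ξ) hp0).trans ?_
    simp_rw [ENNReal.mul_rpow_of_nonneg _ _ hp0]
    rw [lintegral_const_mul' _ _ (ENNReal.rpow_ne_top_of_nonneg hp0 ENNReal.ofReal_ne_top)]
    exact mul_le_mul_right (hC₁ γ hγ) _
  · exact mul_le_mul_right hγ.lintegral_deriv_tangent_le _

theorem exists_norm_velocity_le (p M : ℝ) :
    ∃ C : ℝ, ∀ γ : ℝ → Plane, RegularCurve p M γ → ∀ ξ, ‖velocity γ ξ‖ ≤ C := by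
  obtain ⟨C, hC, hCb⟩ := exists_abs_log_regDenom_le p M (β := 1 / 2) (by norm_num)
  refine ⟨C * M * ∫ x, torDist x ^ (-(1 / 2) : ℝ) ∂torusMeasure, fun γ hγ ξ => ?_⟩
  have hβ : (-1 : ℝ) < -(1 / 2) := by norm_num
  rw [velocity_eq, logInt]
  refine (norm_integral_le_of_norm_le ((integrable_torDist_sub hβ ξ).const_mul (C * M)) ?_).trans
    (le_of_eq ?_)
  · filter_upwards [ae_torDist_pos ξ] with η hη
    rw [norm_smul, Real.norm_eq_abs, mul_right_comm]
    exact mul_le_mul (hCb γ hγ 0 ξ η le_rfl zero_le_one hη) (hγ.norm_deriv_le η) (norm_nonneg _)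
      (mul_nonneg hC (Real.rpow_nonneg (torDist_nonneg _) _))
  · rw [integral_const_mul, integral_torus_sub_left (F := fun x => torDist x ^ (-(1 / 2) : ℝ))
      (fun x => by simp only [torDist_periodic x])]

theorem norm_tangentialDeriv_le (hγ : RegularCurve p M γ) (ξ : ℝ) : ‖tangentialDeriv γ ξ‖ ≤
    M * (2 * M ^ 3 * ∫ x, torDist x ^ (1 - 1 / p - 1) ∂torusMeasure) := by
  rw [tangentialDeriv, norm_smul, norm_inv, Real.norm_of_nonneg (hγ.speed_pos ξ).le]
  exact mul_le_mul (hγ.inv_speed_le ξ) (hγ.norm_integral_crossKer_le ξ) (norm_nonneg _) hγ.M_pos.le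

/-! ### The kernels of the second derivative -/

theorem inner_div_tangent (γ : ℝ → Plane) (ξ η : ℝ) :
    inner ℝ (γ ξ - γ η) (tangent γ ξ) / ‖γ ξ - γ η‖ ^ 2 =
      (speed γ ξ)⁻¹ * (inner ℝ (γ ξ - γ η) (deriv γ ξ) / ‖γ ξ - γ η‖ ^ 2) := by
  rw [tangent, inner_smul_right, mul_div_assoc]

theorem secondKernelA_eq (hγ : RegularCurve p M γ) (ξ η : ℝ) : secondKernelA γ ξ η =
    (inner ℝ (γ ξ - γ η) (tangent γ ξ) / ‖γ ξ - γ η‖ ^ 2) • -deriv (tangent γ) η := by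
  rw [secondKernelA, ← hγ.curvature_smul_normal, smul_smul]
  congr 1; ring

theorem secondKernelB_eq (hγ : RegularCurve p M γ) (ξ η : ℝ) :
    secondKernelB γ ξ η = curvKerB γ 0 ξ η • deriv γ η := by
  have h1 : curvature γ ξ * inner ℝ (γ ξ - γ η) (normal γ ξ) =
      -((speed γ ξ)⁻¹ * inner ℝ (γ ξ - γ η) (deriv (tangent γ) ξ)) := by
    have h := congrArg (fun v => inner ℝ (γ ξ - γ η) v) (hγ.curvature_smul_normal ξ)
    simp only [inner_smul_right, inner_neg_right] at h
    rw [← mul_neg, ← h]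
    field_simp [(hγ.speed_pos ξ).ne']
  rw [secondKernelB, curvKerB, regDenom, add_zero, h1, sub_neg_eq_add, mul_smul,
    hγ.speed_smul_tangent]

theorem secondKernelC_eq (hγ : RegularCurve p M γ) (ξ η : ℝ) :
    secondKernelC γ ξ η = curvKerC γ 0 ξ η • deriv γ η := by
  rw [secondKernelC, curvKerC, regDenom, add_zero, ← pow_mul, mul_smul, hγ.speed_smul_tangent]

theorem ae_integrable_curvBound (hγ : RegularCurve p M γ) :
    ∀ᵐ ξ : ℝ, Integrable (curvBound p γ ξ) torusMeasure := by
  refine ae_of_ae_torus (fun ξ => ?_) hγ.integrable_curvBound.prod_right_ae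
  have : curvBound p γ (ξ + 2 * π) = curvBound p γ ξ := funext fun η => by
    simp only [curvBound, add_sub_right_comm, torDist_periodic (ξ - η), hγ.tangent_periodic ξ,
      hγ.deriv_tangent_periodic ξ]
  rw [this]

theorem integrable_smul_deriv_of_abs_le (hγ : RegularCurve p M γ) {k : ℝ × ℝ → ℝ} {ξ K : ℝ}
    (hk : Measurable k) (hb : ∀ η, |k (ξ, η)| ≤ K * curvBound p γ ξ η)
    (hi : Integrable (curvBound p γ ξ) torusMeasure) :
    Integrable (fun η => k (ξ, η) • deriv γ η) torusMeasure := by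
  refine ((hi.const_mul K).mul_const M).mono' ((hk.comp measurable_prodMk_left).smul
    hγ.continuous_deriv.measurable).aestronglyMeasurable (Eventually.of_forall fun η => ?_)
  rw [norm_smul, Real.norm_eq_abs]
  exact mul_le_mul (hb η) (hγ.norm_deriv_le η) (norm_nonneg _) ((abs_nonneg _).trans (hb η))

theorem integrable_secondKernelB (hγ : RegularCurve p M γ) {ξ : ℝ}
    (hi : Integrable (curvBound p γ ξ) torusMeasure) :
    Integrable (secondKernelB γ ξ) torusMeasure := by
  rw [funext (hγ.secondKernelB_eq ξ)]
  exact hγ.integrable_smul_deriv_of_abs_le (k := fun z => curvKerB γ 0 z.1 z.2)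
    (hγ.measurable_curvKerB 0) (hγ.abs_curvKerB_le le_rfl ξ) hi

theorem integrable_secondKernelC (hγ : RegularCurve p M γ) {ξ : ℝ}
    (hi : Integrable (curvBound p γ ξ) torusMeasure) :
    Integrable (secondKernelC γ ξ) torusMeasure := by
  rw [funext (hγ.secondKernelC_eq ξ)]
  exact hγ.integrable_smul_deriv_of_abs_le (k := fun z => curvKerC γ 0 z.1 z.2)
    (hγ.measurable_curvKerC 0) (hγ.abs_curvKerC_le le_rfl ξ) hi

theorem curvInt_eq (hγ : RegularCurve p M γ) {ξ : ℝ}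
    (hi : Integrable (curvBound p γ ξ) torusMeasure) :
    curvInt γ ξ = speed γ ξ • ((∫ η, secondKernelB γ ξ η ∂torusMeasure) -
      (2 : ℝ) • ∫ η, secondKernelC γ ξ η ∂torusMeasure) := by
  have i1 := hγ.integrable_secondKernelB hi
  have i2 : Integrable (fun η => (2 : ℝ) • secondKernelC γ ξ η) torusMeasure :=
    (hγ.integrable_secondKernelC hi).smul (2 : ℝ)
  rw [curvInt, ← integral_smul, ← integral_sub i1 i2, ← integral_smul]
  congr 1 with η : 1
  rw [hγ.secondKernelB_eq, hγ.secondKernelC_eq, curvKer]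
  module

/-- Since `g κ N = -∂_ξ T`, this kernel is `-g(ξ)⁻¹` times the differentiated logarithmic kernel
acting on `∂_ξ T`. -/
theorem hasPVIntegral_secondKernelA (hγ : RegularCurve p M γ) {ξ : ℝ} {L : Plane}
    (hL : Tendsto (fun ε => ∫ η in pvDomain ξ ε,
      (inner ℝ (γ ξ - γ η) (deriv γ ξ) / ‖γ ξ - γ η‖ ^ 2) • deriv (tangent γ) η) (𝓝[>] 0) (𝓝 L)) :
    HasPVIntegral (secondKernelA γ ξ) ξ (-((speed γ ξ)⁻¹ • L)) := by
  refine ⟨fun ε hε => ?_, ?_⟩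
  · rw [funext (hγ.secondKernelA_eq ξ)]
    refine integrableOn_pvDomain_smul (C := M * ε⁻¹ * ‖tangent γ ξ‖) ?_
      (hγ.measurable_inner_div_sq ξ (tangent γ ξ))
      fun η hη => hγ.abs_inner_div_sq_le_of_mem hε hη (tangent γ ξ)
    exact ((integrable_torus_iff_Ioc_centered hγ.deriv_tangent_periodic ξ).1
      hγ.integrable_deriv_tangent).neg
  · refine ((hL.const_smul (speed γ ξ)⁻¹).neg).congr fun ε => ?_
    rw [← integral_smul, ← integral_neg]
    refine integral_congr_ae (Eventually.of_forall fun η => ?_)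
    simp only [hγ.secondKernelA_eq, inner_div_tangent, smul_neg, smul_smul]

end

/-- Estimates the second label derivative of `v` after the product rule for `∂_ξ v = g ∂_s v`. The
derivative of the speed is dominated by `|γ̈|`, hence lies in `L^p`, and it multiplies a bounded
function. -/
theorem eLpNorm_speed_smul_add_le {p : ℝ≥0∞} {M : ℝ} {γ : ℝ → Plane}
    (hγ : RegularCurve p.toReal M γ) (hp : 1 < p) (hp' : p < ⊤) {f h : ℝ → Plane} {K : ℝ}
    {A : ℝ≥0∞} (mU : AEStronglyMeasurable h torusMeasure) (nU : eLpNorm h p torusMeasure ≤ A)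
    (hf : Continuous f) (bU : ∀ ξ, ‖f ξ‖ ≤ K) :
    eLpNorm (fun ξ => speed γ ξ • h ξ + deriv (speed γ) ξ • f ξ) p torusMeasure ≤
      ENNReal.ofReal M * A + ENNReal.ofReal K * ENNReal.ofReal M := by
  have hp0 : 0 < p.toReal := ENNReal.toReal_pos (by positivity) hp'.ne
  have nD : eLpNorm (deriv (deriv γ)) p torusMeasure ≤ ENNReal.ofReal M := by
    refine (eLpNorm_le_of_lintegral_le hp0 hγ.lintegral_le).trans (le_of_eq ?_)
    rw [← ENNReal.rpow_mul, mul_one_div_cancel hp0.ne', ENNReal.rpow_one]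
  have n1 : eLpNorm (fun ξ => speed γ ξ • h ξ) p torusMeasure ≤
      ENNReal.ofReal M * A := by
    refine (eLpNorm_le_mul_eLpNorm_of_ae_le_mul (c := M) (Eventually.of_forall fun ξ => ?_) p).trans
      (mul_le_mul_right nU _)
    rw [norm_smul, Real.norm_of_nonneg (hγ.speed_pos ξ).le]
    exact mul_le_mul_of_nonneg_right (hγ.speed_le ξ) (norm_nonneg _)
  have n2 : eLpNorm (fun ξ => deriv (speed γ) ξ • f ξ) p torusMeasure ≤
      ENNReal.ofReal (K) * ENNReal.ofReal M := by
    refine (eLpNorm_le_mul_eLpNorm_of_ae_le_mul (c := K) ?_ p).trans (mul_le_mul_right nD _)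
    filter_upwards [ae_torus_of_ae hγ.isPrimitive_speed.2] with ξ hξ
    rw [norm_smul, mul_comm]
    exact mul_le_mul (bU ξ) hξ (norm_nonneg _) ((norm_nonneg _).trans (bU ξ))
  have m1 : AEStronglyMeasurable (fun ξ => speed γ ξ • h ξ) torusMeasure :=
    hγ.continuous_speed.aestronglyMeasurable.smul mU
  have m2 : AEStronglyMeasurable (fun ξ => deriv (speed γ) ξ • f ξ) torusMeasure :=
    (measurable_deriv (speed γ)).aestronglyMeasurable.smul hf.aestronglyMeasurable
  exact (eLpNorm_add_le m1 m2 hp.le).trans (add_le_add n1 n2)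

/-- The Sobolev bounds of the velocity and of its tangential derivatives. -/
theorem exists_velocity_bounds {p : ℝ≥0∞} (hp : 1 < p) (hp' : p < ⊤) (M : ℝ) :
    ∃ C : ℝ≥0, ∀ γ : ℝ → Plane, RegularCurve p.toReal M γ →
      MemSobolev 2 p (velocity γ) ∧ sobolevNorm 2 p (velocity γ) ≤ C ∧
      MemSobolev 1 p (tangentialDeriv γ) ∧
      ∃ h : ℝ → Plane, IsPrimitive (tangentialDeriv γ) (fun ξ => curvInt γ ξ + h ξ) ∧
        MemLp (fun ξ => curvInt γ ξ + h ξ) p torusMeasure ∧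
        ∀ᵐ ξ, Tendsto (fun ε => ∫ η in pvDomain ξ ε,
          (inner ℝ (γ ξ - γ η) (deriv γ ξ) / ‖γ ξ - γ η‖ ^ 2) • deriv (tangent γ) η) (𝓝[>] 0)
          (𝓝 (h ξ)) := by
  have hp1 : 1 < p.toReal := by
    rw [← ENNReal.toReal_one]; exact (ENNReal.toReal_lt_toReal (by simp) hp'.ne).2 hp
  have hp0 : 0 < p.toReal := by linarith
  obtain ⟨K₀, hK₀⟩ := exists_norm_velocity_le p.toReal M
  obtain ⟨K₂, hK₂⟩ := exists_tangentialDeriv_isPrimitive hp1 M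
  set K₁ : ℝ := 2 * M ^ 3 * ∫ x, torDist x ^ (1 - 1 / p.toReal - 1) ∂torusMeasure with hK₁
  set T : ℝ≥0∞ := torusMeasure univ ^ p.toReal⁻¹ with hT
  set K : ℝ≥0∞ := T * ENNReal.ofReal K₀ + T * ENNReal.ofReal K₁ +
    (ENNReal.ofReal M * K₂ ^ (1 / p.toReal) + ENNReal.ofReal (M * K₁) * ENNReal.ofReal M) with hK
  have hKt : K ≠ ⊤ := by
    have h1 : T ≠ ⊤ := ENNReal.rpow_ne_top_of_nonneg (by positivity) (measure_ne_top _ _)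
    have h2 : (K₂ : ℝ≥0∞) ^ (1 / p.toReal) ≠ ⊤ :=
      ENNReal.rpow_ne_top_of_nonneg (by positivity) (by simp)
    simp only [hK, ne_eq, ENNReal.add_eq_top, not_or]
    exact ⟨⟨ENNReal.mul_ne_top h1 (by simp), ENNReal.mul_ne_top h1 (by simp)⟩,
      ENNReal.mul_ne_top (by simp) h2, ENNReal.mul_ne_top (by simp) (by simp)⟩
  refine ⟨K.toNNReal, fun γ hγ => ?_⟩
  rw [ENNReal.coe_toNNReal hKt]
  obtain ⟨h, hper, hU, hUle, hpv⟩ := hK₂ γ hγ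
  have hV := hγ.isPrimitive_velocity
  -- The label derivative of `v` is the speed times `tangentialDeriv γ`, so the product rule
  -- produces its second derivative.
  have hV' := hγ.isPrimitive_speed.1.smul hU
  simp_rw [hγ.speed_smul_tangentialDeriv] at hV'
  have hperU : Function.Periodic (fun ξ => curvInt γ ξ + h ξ) (2 * π) := fun ξ => by
    simp only [hγ.curvInt_periodic ξ, hper ξ]
  have hperV : Function.Periodic (velocity γ) (2 * π) := by
    rw [velocity_eq]; exact hγ.logInt_periodic 0 _
  have hperV' : Function.Periodic (fun ξ => ∫ η, crossKer γ 0 ξ η ∂torusMeasure) (2 * π) :=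
    fun ξ => by simp only [crossKer, regDenom, hγ.periodic ξ, hγ.deriv_periodic ξ]
  have hperV'' : Function.Periodic (fun ξ => speed γ ξ • (curvInt γ ξ + h ξ) +
      deriv (speed γ) ξ • tangentialDeriv γ ξ) (2 * π) := fun ξ => by
    simp only [hγ.curvInt_periodic ξ, hper ξ, hγ.speed_periodic ξ,
      hγ.speed_periodic.deriv_periodic ξ, hγ.tangentialDeriv_periodic ξ]
  have bU : ∀ ξ, ‖tangentialDeriv γ ξ‖ ≤ M * K₁ := hγ.norm_tangentialDeriv_le
  have bV' : ∀ ξ, ‖∫ η, crossKer γ 0 ξ η ∂torusMeasure‖ ≤ K₁ := hγ.norm_integral_crossKer_le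
  have lU : MemLp (tangentialDeriv γ) p torusMeasure :=
    MemLp.of_bound hU.continuous.aestronglyMeasurable _ (Eventually.of_forall bU)
  have lV : MemLp (velocity γ) p torusMeasure :=
    MemLp.of_bound hV.continuous.aestronglyMeasurable _ (Eventually.of_forall (hK₀ γ hγ))
  have lV' : MemLp (fun ξ => ∫ η, crossKer γ 0 ξ η ∂torusMeasure) p torusMeasure :=
    MemLp.of_bound hV'.continuous.aestronglyMeasurable _ (Eventually.of_forall bV')
  have mU := hU.integrable_torus.aestronglyMeasurable
  have nU : eLpNorm (fun ξ => curvInt γ ξ + h ξ) p torusMeasure ≤ (K₂ : ℝ≥0∞) ^ (1 / p.toReal) :=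
    eLpNorm_le_of_lintegral_le hp0 hUle
  have lU' : MemLp (fun ξ => curvInt γ ξ + h ξ) p torusMeasure :=
    ⟨mU, nU.trans_lt (ENNReal.rpow_lt_top_of_nonneg (by positivity) (by simp))⟩
  have nV'' := hγ.eLpNorm_speed_smul_add_le hp hp' mU nU hU.continuous bU
  have lV'' : MemLp (fun ξ => speed γ ξ • (curvInt γ ξ + h ξ) +
      deriv (speed γ) ξ • tangentialDeriv γ ξ) p torusMeasure :=
    ⟨hV'.integrable_torus.aestronglyMeasurable, nV''.trans_lt
      ((le_add_self.trans_lt hKt.lt_top))⟩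
  obtain ⟨s1, s2⟩ := (hV.hasWeakDeriv hperV hperV').memSobolev_two
    (hV'.hasWeakDeriv hperV' hperV'') lV lV' lV''
  refine ⟨s1, ?_, (hU.hasWeakDeriv hγ.tangentialDeriv_periodic hperU).memSobolev_one lU lU',
    h, hU, lU', hpv⟩
  rw [s2]
  exact add_le_add (add_le_add (eLpNorm_le_of_ae_bound (Eventually.of_forall (hK₀ γ hγ)))
    (eLpNorm_le_of_ae_bound (Eventually.of_forall bV'))) nV''

end RegularCurve

theorem proposition2p4 (p : ℝ≥0∞) (hp : 1 < p) (hp' : p < ⊤) (M : ℝ) (hM : 1 < M) :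
    ∃ C : ℝ≥0, ∀ γ ∈ curveBall p M,
      (∀ ξ : ℝ, Integrable (velocityKernel γ ξ) torusMeasure) ∧
      MemSobolev 2 p (velocity γ) ∧
      sobolevNorm 2 p (velocity γ) ≤ (C : ℝ≥0∞) ∧
      ∃ v₁ v₂ : ℝ → Plane,
        -- the formula for `∂_s v`
        (∀ ξ : ℝ, HasPVIntegral (firstKernel γ ξ) ξ (v₁ ξ)) ∧
        MemSobolev 1 p v₁ ∧
        (∀ᵐ ξ : ℝ, HasArcDerivAt γ (velocity γ) (v₁ ξ) ξ) ∧
        -- the formula for `∂_s² v`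
        (∀ᵐ ξ : ℝ, ∃ A : Plane, HasPVIntegral (secondKernelA γ ξ) ξ A ∧
          Integrable (secondKernelB γ ξ) torusMeasure ∧
          Integrable (secondKernelC γ ξ) torusMeasure ∧
          v₂ ξ = -A + (∫ η, secondKernelB γ ξ η ∂torusMeasure)
            - (2 : ℝ) • ∫ η, secondKernelC γ ξ η ∂torusMeasure) ∧
        MemLp v₂ p torusMeasure ∧
        (∀ᵐ ξ : ℝ, HasArcDerivAt γ v₁ (v₂ ξ) ξ) := by
  obtain ⟨C, hC⟩ := RegularCurve.exists_velocity_bounds hp hp' M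
  refine ⟨C, fun γ hmem => ?_⟩
  have hγ : RegularCurve p.toReal M γ := regularCurve_of_mem_curveBall hp hp' hM hmem
  obtain ⟨hs2, hle, hs1, h, hU, lU, hpv⟩ := hC γ hγ
  -- The density `curvInt γ + h` is the label derivative of `tangentialDeriv γ`; dividing by the
  -- speed makes it the arc-length derivative.
  refine ⟨fun ξ => ?_, hs2, hle, tangentialDeriv γ, fun ξ => (speed γ ξ)⁻¹ • (curvInt γ ξ + h ξ),
    hγ.hasPVIntegral_firstKernel, hs1, ?_, ?_, ?_, ?_⟩
  · refine (hγ.integrable_logInt hγ.continuous_deriv.measurable hγ.lintegral_deriv_lt_top le_rfl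
      zero_le_one ξ).congr (Eventually.of_forall fun η => ?_)
    simp only [velocityKernel, regDenom, add_zero, Real.log_pow]
    push_cast
    rw [mul_div_cancel_left₀ _ two_ne_zero]
  · filter_upwards [hγ.isPrimitive_velocity.ae_hasDerivAt] with ξ hξ using ⟨_, hξ, rfl⟩
  · filter_upwards [hpv, hγ.ae_integrable_curvBound] with ξ h1 h2
    -- Here `A = -g(ξ)⁻¹ h(ξ)`, so the term `-A` of the formula restores `g(ξ)⁻¹ h(ξ)`.
    refine ⟨_, hγ.hasPVIntegral_secondKernelA h1, hγ.integrable_secondKernelB h2,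
      hγ.integrable_secondKernelC h2, ?_⟩
    rw [hγ.curvInt_eq h2, smul_add, inv_smul_smul₀ (hγ.speed_pos ξ).ne']
    abel
  · refine lU.of_le_mul (c := M) ((hγ.continuous_speed.measurable.inv.aestronglyMeasurable).smul
      lU.aestronglyMeasurable) (Eventually.of_forall fun ξ => ?_)
    rw [norm_smul, norm_inv, Real.norm_of_nonneg (hγ.speed_pos ξ).le]
    exact mul_le_mul_of_nonneg_right (hγ.inv_speed_le ξ) (norm_nonneg _)
  · filter_upwards [hU.ae_hasDerivAt] with ξ hξ using ⟨_, hξ, rfl⟩
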